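/- Let $0<\delta<1$. For $f:\mathbb{R}\to\mathbb{R}$ continuously differentiable put $$\|f\|_{C^{1+\delta}}=\sup_x|f(x)|+\sup_x|f'(x)|+\sup_{x\neq y}\frac{|f'(x)-f'(y)|}{|x-y|^{\delta}},$$ let $C^{1+\delta}(\mathbb{R})$ be the space of such $f$ with $\|f\|_{C^{1+\delta}}<\infty$, and let $Hf(x)=\frac1\pi\,\mathrm{P.V.}\!\int_{\mathbb{R}}\frac{f(y)}{x-y}\,dy$ be the Hilbert transform. Let $u_0\in L^2(\mathbb{R})\cap C^{1+\delta}(\mathbb{R})$. A solution on $[0,T)$ of the Burgers–Hilbert equation $$u_t+u\,u_x=Hu,\qquad u(x,0)=u_0(x),$$ is a function $u$ on $\mathbb{R}\times[0,T)$ with $u(\cdot,0)=u_0$ which is continuous in time with values in $L^2(\mathbb{R})$, takes values in $C^{1+\delta}(\mathbb{R})$ with $\sup_{0\le t\le S}\|u(\cdot,t)\|_{C^{1+\delta}}<\infty$ for every $0\le S<T$, and satisfies the equation at every point $(x,t)\in\mathbb{R}\times[0,T)$ (with the right time derivative at $t=0$). Suppose that there is a point $\beta_0\in\mathbb{R}$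 with $$Hu_0(\beta_0)>0\qquad\text{and}\qquad u_0(\beta_0)\ \ge\ \bigl(32\pi\,\|u_0\|_{L^2(\mathbb{R})}^2\bigr)^{1/3}.$$ Then there are a finite time $T>0$ and a solution $u$ on $[0,T)$ such that $$\lim_{t\to T^-}\|u(\cdot,t)\|_{C^{1+\delta}(\mathbb{R})}=\infty ,$$ and $u$ is the unique solution: if $v$ is a solution on $[0,T')$ with the same initial data, then $T'\le T$ and $v=u$ on $\mathbb{R}\times[0,T')$. -/

import Mathlib

open MeasureTheory Filter Set Topology
open scoped NNReal ENNReal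

noncomputable section

namespace BurgersHilbert

/-- The integral `(1/π) ∫_{|x-y| > ε} f(y)/(x-y) dy`, truncated at distance `ε` from the
singularity. -/
def truncatedHilbert (f : ℝ → ℝ) (x ε : ℝ) : ℝ :=
  (1 / Real.pi) * ∫ y in {y : ℝ | ε < |x - y|}, f y / (x - y)

/-- The Hilbert transform `Hf(x) = (1/π) P.V. ∫ f(y)/(x-y) dy`, the limit of the truncated
integrals as `ε → 0⁺`. The limit exists whenever `f ∈ L²` is Lipschitz, see
`tendsto_truncatedHilbert`. -/
def hilbertTransform (f : ℝ → ℝ) (x : ℝ) : ℝ :=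
  limUnder (𝓝[>] (0 : ℝ)) (truncatedHilbert f x)

/-- For `f ∈ L²(ℝ)` and `ε > 0` the truncated integrals converge absolutely. -/
theorem integrableOn_truncatedHilbert {f : ℝ → ℝ} (hf : MemLp f 2 volume) (x : ℝ) {ε : ℝ}
    (hε : 0 < ε) : IntegrableOn (fun y => f y / (x - y)) {y : ℝ | ε < |x - y|} := by
  have hm : MeasurableSet {y : ℝ | ε < |x - y|} :=
    measurableSet_lt measurable_const (by fun_prop)
  have h1 : Integrable (fun y => (f y) ^ 2 + (1 + 1 / ε ^ 2) * (1 + (x - y) ^ 2)⁻¹) :=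
    hf.integrable_sq.add ((integrable_inv_one_add_sq.comp_sub_left x).const_mul _)
  refine Integrable.mono' h1.integrableOn ?_ ?_
  · have : AEMeasurable (fun y => f y / (x - y)) :=
      hf.aestronglyMeasurable.aemeasurable.div (by fun_prop)
    exact this.aestronglyMeasurable.restrict
  · filter_upwards [ae_restrict_mem hm] with y hy
    have hy' : ε < |x - y| := hy
    have hsq : ε ^ 2 < (x - y) ^ 2 := by
      rw [← sq_abs (x - y)]; gcongr
    have hp : 0 < (x - y) ^ 2 := lt_trans (by positivity) hsq
    have hd : ((x - y) ^ 2)⁻¹ ≤ (1 + 1 / ε ^ 2) * (1 + (x - y) ^ 2)⁻¹ := by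
      rw [← div_eq_mul_inv, inv_eq_one_div, div_le_div_iff₀ hp (by positivity)]
      have : 1 ≤ 1 / ε ^ 2 * (x - y) ^ 2 := by
        rw [one_div, inv_mul_eq_div, one_le_div (by positivity)]; exact hsq.le
      nlinarith
    rw [Real.norm_eq_abs, div_eq_mul_inv, abs_mul]
    have h2 : |(x - y)⁻¹| ^ 2 = ((x - y) ^ 2)⁻¹ := by rw [sq_abs, inv_pow]
    nlinarith [sq_nonneg (|f y| - |(x - y)⁻¹|), sq_abs (f y), sq_nonneg (|f y|),
      sq_nonneg (|(x - y)⁻¹|)]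

/-- For Lipschitz `f ∈ L²(ℝ)` the principal value defining the Hilbert transform exists. -/
theorem tendsto_truncatedHilbert {f : ℝ → ℝ} {K : ℝ≥0} (hf : MemLp f 2 volume)
    (hK : LipschitzWith K f) (x : ℝ) :
    Tendsto (truncatedHilbert f x) (𝓝[>] (0 : ℝ)) (𝓝 (hilbertTransform f x)) := by
  let C : ℝ → Set ℝ := fun ε => {y | ε < |x - y| ∧ |x - y| ≤ 1}
  let B : Set ℝ := {y | 1 < |x - y|}
  have hC : ∀ ε, MeasurableSet (C ε) := fun ε =>
    MeasurableSet.inter (s₁ := {y | ε < |x - y|}) (s₂ := {y | |x - y| ≤ 1})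
      (measurableSet_lt measurable_const (by fun_prop))
      (measurableSet_le (by fun_prop) measurable_const)
  have hB : MeasurableSet B := measurableSet_lt measurable_const (by fun_prop)
  let h : ℝ → ℝ := fun y => (f y - f x) / (x - y)
  have hmeas : Measurable h :=
    (hK.continuous.measurable.sub_const _).div (by fun_prop)
  let D : Set ℝ := {y | |x - y| ≤ 1}
  have hDm : MeasurableSet D := measurableSet_le (by fun_prop) measurable_const
  have hD : volume D ≠ ∞ := by
    have : D = Metric.closedBall x 1 := by
      ext y; simp [D, Real.dist_eq, abs_sub_comm]
    rw [this]; exact measure_closedBall_lt_top.ne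
  have hbd : ∀ y, ‖h y‖ ≤ K := by
    intro y
    have := hK.dist_le_mul y x
    simp only [h, norm_div]
    refine div_le_of_le_mul₀ (norm_nonneg _) K.2 ?_
    rw [Real.dist_eq, Real.dist_eq, abs_sub_comm y x] at this
    exact this
  have hodd : ∀ ε, ∫ y in C ε, f x / (x - y) = 0 := by
    intro ε
    rw [← integral_indicator (hC ε)]
    set g := (C ε).indicator fun y => f x / (x - y) with hg
    have e1 : ∫ y, g (2 * x - y) = ∫ y, g y := integral_sub_left_eq_self g volume (2 * x)
    have e2 : ∀ y, g (2 * x - y) = - g y := by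
      intro y
      have hx : x - (2 * x - y) = -(x - y) := by ring
      by_cases hy : y ∈ C ε
      · have hy2 : 2 * x - y ∈ C ε := by
          simpa only [C, mem_ofPred_eq, hx, abs_neg] using hy
        rw [hg, indicator_of_mem hy, indicator_of_mem hy2, hx, div_neg]
      · have hy2 : 2 * x - y ∉ C ε := by
          simpa only [C, mem_ofPred_eq, hx, abs_neg] using hy
        rw [hg, indicator_of_notMem hy, indicator_of_notMem hy2, neg_zero]
    simp only [e2, integral_neg] at e1
    linarith
  have hlim : Tendsto (fun ε => ∫ y, (C ε).indicator h y) (𝓝[>] (0 : ℝ))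
      (𝓝 (∫ y, D.indicator h y)) := by
    refine tendsto_integral_filter_of_dominated_convergence (D.indicator fun _ => (K : ℝ))
      (Eventually.of_forall fun ε => (hmeas.indicator (hC ε)).aestronglyMeasurable) ?_ ?_ ?_
    · refine Eventually.of_forall fun ε => Eventually.of_forall fun y => ?_
      by_cases hy : y ∈ C ε
      · rw [indicator_of_mem hy, indicator_of_mem (show y ∈ D from hy.2)]
        exact hbd y
      · rw [indicator_of_notMem hy, norm_zero]
        exact indicator_nonneg (fun _ _ => K.2) y
    · exact (integrable_indicator_iff hDm).2 (integrableOn_const hD)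
    · refine Eventually.of_forall fun y => ?_
      rcases eq_or_ne x y with rfl | hxy
      · have h0 : h x = 0 := by simp [h]
        have : ∀ s : Set ℝ, s.indicator h x = 0 := fun s => by
          by_cases hs : x ∈ s <;> simp [hs, h0]
        simp [this]
      · have hpos : 0 < |x - y| := abs_pos.2 (sub_ne_zero.2 hxy)
        refine tendsto_const_nhds.congr' ?_
        filter_upwards [Ioo_mem_nhdsGT hpos] with ε hε
        by_cases hy : y ∈ D
        · rw [indicator_of_mem hy, indicator_of_mem (show y ∈ C ε from ⟨hε.2, hy⟩)]
        · rw [indicator_of_notMem hy, indicator_of_notMem (fun hc => hy hc.2)]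
  refine tendsto_nhds_limUnder
    ⟨(1 / Real.pi) * ((∫ y in B, f y / (x - y)) + ∫ y, D.indicator h y), ?_⟩
  refine ((hlim.const_add _).const_mul _).congr' ?_
  filter_upwards [Ioo_mem_nhdsGT (zero_lt_one' ℝ)] with ε hε
  have hA : {y : ℝ | ε < |x - y|} = B ∪ C ε := by
    ext y
    simp only [B, C, mem_union, mem_ofPred_eq]
    constructor
    · intro h; rcases lt_or_ge 1 |x - y| with h' | h'
      · exact Or.inl h'
      · exact Or.inr ⟨h, h'⟩
    · rintro (h | h)
      · exact hε.2.trans h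
      · exact h.1
  have hint := integrableOn_truncatedHilbert hf x hε.1
  have hint' := hint
  rw [hA] at hint'
  have hdis : Disjoint B (C ε) := by
    rw [Set.disjoint_left]
    intro y h1 h2
    exact absurd h2.2 (not_le.2 h1)
  have hCh : IntegrableOn h (C ε) :=
    Measure.integrableOn_of_bounded (M := K)
      (ne_top_of_le_ne_top hD (measure_mono fun y hy => hy.2))
      hmeas.aestronglyMeasurable (Eventually.of_forall hbd)
  have hsum : ∫ y in C ε, f y / (x - y) = ∫ y in C ε, h y := by
    have hc : IntegrableOn (fun y => f x / (x - y)) (C ε) := by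
      refine (hint'.right_of_union.sub hCh).congr (Eventually.of_forall fun y => ?_)
      simp only [h, Pi.sub_apply]
      ring
    have : ∫ y in C ε, f y / (x - y) = ∫ y in C ε, (h y + f x / (x - y)) := by
      congr 1; ext y; simp only [h]; ring
    rw [this, integral_add hCh hc, hodd ε, add_zero]
  rw [truncatedHilbert, hA, setIntegral_union hdis (hC ε) hint'.left_of_union
    hint'.right_of_union, hsum, integral_indicator (hC ε)]

/-- The norm `‖f‖_{C^{1+δ}(ℝ)} = sup |f| + sup |f'| + [f']_δ`, with values in `[0, ∞]`; here
`[g]_δ` is the Hölder seminorm of exponent `δ`. -/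
def c1HolderNorm (δ : ℝ≥0) (f : ℝ → ℝ) : ℝ≥0∞ :=
  (⨆ x, ‖f x‖ₑ) + (⨆ x, ‖deriv f x‖ₑ) + eHolderNorm δ (deriv f)

/-- `f ∈ C^{1+δ}(ℝ)`: `f` is continuously differentiable with finite `C^{1+δ}` norm. -/
def MemC1Holder (δ : ℝ≥0) (f : ℝ → ℝ) : Prop :=
  ContDiff ℝ 1 f ∧ c1HolderNorm δ f < ∞

/-- `u` (written `u t x`) is a solution on the time interval `[0, T)` of
`u_t + u u_x = Hu`, `u(·, 0) = u₀`: it is continuous in time with values in `L²(ℝ)`, locally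
bounded in time with values in `C^{1+δ}(ℝ)`, and satisfies the equation at every point (at
`t = 0` the time derivative is the right derivative). The values of `u` at times outside
`[0, T)` are irrelevant. -/
structure IsSolution (δ : ℝ≥0) (u₀ : ℝ → ℝ) (T : ℝ) (u : ℝ → ℝ → ℝ) : Prop where
  initial : u 0 = u₀
  memLp : ∀ t ∈ Ico 0 T, MemLp (u t) 2 volume
  continuous_L2 : ∀ s ∈ Ico 0 T,
    Tendsto (fun t => eLpNorm (u t - u s) 2 volume) (𝓝[Ico 0 T] s) (𝓝 0)
  memC1Holder : ∀ t ∈ Ico 0 T, MemC1Holder δ (u t)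
  locallyBounded : ∀ S ∈ Ico 0 T, ∃ M : ℝ≥0, ∀ t ∈ Icc 0 S, c1HolderNorm δ (u t) ≤ M
  equation : ∀ t ∈ Ico 0 T, ∀ x : ℝ,
    HasDerivWithinAt (fun s => u s x)
      (hilbertTransform (u t) x - u t x * deriv (u t) x) (Ico 0 T) t

end BurgersHilbert

end

noncomputable section

namespace BurgersHilbert

/-! ### Calculus of functions bounded in C^{1+δ} and in L². -/

section

/-! Blow-up. Follow a characteristic X' = u(X, t) from β₀ and put U = u(X, t), V = Hu(X, t), E =
‖u‖²_{L²}, a conserved quantity. Then U' = V. Formally V' = H(Hu) - H(u u_x) + u H(u_x): the first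
term is -U because H² = -1, and the other two, after an integration by parts and completion of a
square, equal (1/2π) ∫ (u(X) - u(y))² / (X - y)² dy, which is nonnegative. Bounding the numerator
below by u(X)²/2 - u(y)² and the kernel by 1 / ((X - y)² + r²), with the optimal r = 4E / (π U²),
gives U'' ≥ c U⁴ - U with c = π / (32 E). The size of u₀(β₀) makes the quartic term dominate as long
as U stays above its initial value, and Hu₀(β₀) > 0 makes U start to grow; so U would be infinite by
a time depending on u₀ alone, and no solution lives longer (`exists_time_bound`).

To make this rigorous, H is replaced by `conjPoisson ε`, whose kernel (1/π) z / (z² + ε²) is smooth,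
and V is never differentiated. `integral_kernelRate` is the regularized formula for V',
`integral_kernelRate_ge` its lower bound; this is integrated in time before ε → 0
(`ContPath.hilbertTransform_characteristic_ge`), and `le_timeBound` treats the resulting integral
inequality.

Well-posedness. In Lagrangian coordinates the equation is an ordinary differential equation:
displacement ξ and velocity U satisfy ξ_t = U, U_t = (Hu)(a + ξ), and the right-hand side loses no
derivatives. It is bounded in C^{1+δ} ∩ L² (`holderC1_lagHilbert`) and Lipschitz in L²
(`l2Le_lagHilbert_sub`), so the Picard iteration stays bounded in the strong norm and contracts in
the weak one; the interpolation `abs_pow_three_le` turns L² convergence into pointwise convergence.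
Uniqueness is the L² energy estimate, in which H drops out by antisymmetry. The local existence time
depends only on the C^{1+δ} and L² norms, and the latter is conserved; hence on a finite maximal
interval the C^{1+δ} norm must tend to infinity, not merely be unbounded (`exists_maximal`).

Both halves rest on two facts about H: boundedness on C^{1+δ} ∩ L², proved by estimating Cauchy
integrals in the upper half plane uniformly up to the real axis (`norm_cauchyPow_three_le`,
`cauchyPow_two_holder`), and the L² theory (contraction, antisymmetry, H² = -1), obtained from
explicit convolutions of conjugate Poisson kernels. -/

/-- `f` is differentiable, with `|f|`, `|f'|` and the `δ`-Hölder seminorm of `f'` at most `M`. -/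
structure HolderC1 (δ M : ℝ) (f : ℝ → ℝ) : Prop where
  differentiable : Differentiable ℝ f
  abs_le : ∀ x, |f x| ≤ M
  abs_deriv_le : ∀ x, |deriv f x| ≤ M
  holder : ∀ x y, |deriv f x - deriv f y| ≤ M * |x - y| ^ δ

namespace HolderC1

variable {δ M : ℝ} {f : ℝ → ℝ}

theorem nonneg (h : HolderC1 δ M f) : 0 ≤ M := (abs_nonneg _).trans (h.abs_le 0)

theorem mono {N : ℝ} (h : HolderC1 δ M f) (hMN : M ≤ N) : HolderC1 δ N f where
  differentiable := h.differentiable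
  abs_le x := (h.abs_le x).trans hMN
  abs_deriv_le x := (h.abs_deriv_le x).trans hMN
  holder x y := (h.holder x y).trans (by gcongr)

theorem abs_sub_le (h : HolderC1 δ M f) (x y : ℝ) : |f x - f y| ≤ M * |x - y| :=
  convex_univ.norm_image_sub_le_of_norm_deriv_le (fun z _ => h.differentiable z)
    (fun z _ => h.abs_deriv_le z) (mem_univ y) (mem_univ x)

theorem lipschitzWith (h : HolderC1 δ M f) : LipschitzWith M.toNNReal f :=
  LipschitzWith.of_dist_le_mul fun x y => by
    rw [Real.dist_eq, Real.dist_eq, Real.coe_toNNReal _ h.nonneg]; exact h.abs_sub_le x y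

theorem continuous (h : HolderC1 δ M f) : Continuous f := h.differentiable.continuous

theorem continuous_deriv (h : HolderC1 δ M f) (hδ : 0 < δ) : Continuous (deriv f) := by
  refine continuous_iff_continuousAt.2 fun x => ?_
  rw [ContinuousAt, tendsto_iff_dist_tendsto_zero]
  have h0 : Tendsto (fun y => M * |y - x| ^ δ) (𝓝 x) (𝓝 0) := by
    have : ContinuousAt (fun y => M * |y - x| ^ δ) x := by
      refine ContinuousAt.mul continuousAt_const (ContinuousAt.rpow_const (by fun_prop) (Or.inr hδ.le))
    simpa [ContinuousAt, Real.zero_rpow hδ.ne'] using this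
  refine squeeze_zero (fun _ => dist_nonneg) (fun y => ?_) h0
  rw [Real.dist_eq]; exact h.holder y x

theorem taylor (h : HolderC1 δ M f) (hδ : 0 ≤ δ) (x y : ℝ) :
    |f y - f x - deriv f x * (y - x)| ≤ M * |y - x| ^ δ * |y - x| := by
  have hd : ∀ z ∈ uIcc x y, HasDerivWithinAt (fun z => f z - deriv f x * z)
      (deriv f z - deriv f x) (uIcc x y) z := fun z _ =>
    (((h.differentiable z).hasDerivAt).sub
      (by simpa using (hasDerivAt_id z).const_mul (deriv f x))).hasDerivWithinAt
  have := (convex_uIcc x y).norm_image_sub_le_of_norm_hasDerivWithin_le hd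
    (C := M * |y - x| ^ δ) (fun z hz => ?_) left_mem_uIcc right_mem_uIcc
  · simp only [Real.norm_eq_abs] at this
    convert this using 2; ring
  · refine (h.holder z x).trans ?_
    have := abs_sub_left_of_mem_uIcc hz
    have hM := h.nonneg
    gcongr

theorem add {N : ℝ} {g : ℝ → ℝ} (hf : HolderC1 δ M f) (hg : HolderC1 δ N g) :
    HolderC1 δ (M + N) (fun x => f x + g x) := by
  have hd : ∀ x, deriv (fun x => f x + g x) x = deriv f x + deriv g x := fun x =>
    deriv_add (hf.differentiable x) (hg.differentiable x)
  refine ⟨hf.differentiable.add hg.differentiable, fun x => ?_, fun x => ?_, fun x y => ?_⟩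
  · exact (abs_add_le _ _).trans (add_le_add (hf.abs_le x) (hg.abs_le x))
  · rw [hd]; exact (abs_add_le _ _).trans (add_le_add (hf.abs_deriv_le x) (hg.abs_deriv_le x))
  · rw [hd, hd, add_sub_add_comm, add_mul]
    exact (abs_add_le _ _).trans (add_le_add (hf.holder x y) (hg.holder x y))

theorem const_mul (hf : HolderC1 δ M f) (c : ℝ) : HolderC1 δ (|c| * M) (fun x => c * f x) := by
  have hd : ∀ x, deriv (fun x => c * f x) x = c * deriv f x := fun x =>
    deriv_const_mul c (hf.differentiable x)
  refine ⟨hf.differentiable.const_mul c, fun x => ?_, fun x => ?_, fun x y => ?_⟩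
  · rw [abs_mul]; exact mul_le_mul_of_nonneg_left (hf.abs_le x) (abs_nonneg c)
  · rw [hd, abs_mul]; exact mul_le_mul_of_nonneg_left (hf.abs_deriv_le x) (abs_nonneg c)
  · rw [hd, hd, ← mul_sub, abs_mul, mul_assoc]
    exact mul_le_mul_of_nonneg_left (hf.holder x y) (abs_nonneg c)

theorem sub {N : ℝ} {g : ℝ → ℝ} (hf : HolderC1 δ M f) (hg : HolderC1 δ N g) :
    HolderC1 δ (M + N) (fun x => f x - g x) := by
  simpa [sub_eq_add_neg] using hf.add (hg.const_mul (-1))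

theorem slope_le (h : HolderC1 δ M f) (hδ : 0 ≤ δ) (x : ℝ) {k : ℝ} (hk : k ≠ 0) :
    |(f (x + k) - f x) / k - deriv f x| ≤ M * |k| ^ δ := by
  have := h.taylor hδ x (x + k)
  rw [add_sub_cancel_left] at this
  have e : (f (x + k) - f x) / k - deriv f x = (f (x + k) - f x - deriv f x * k) / k := by
    field_simp
  rw [e, abs_div, div_le_iff₀ (abs_pos.2 hk)]
  exact this

/-- A pointwise limit of functions that are uniformly bounded in `C^{1+δ}` is in `C^{1+δ}`, and the
derivatives converge. -/
theorem of_tendsto {ι : Type*} {l : Filter ι} [l.NeBot] {F : ι → ℝ → ℝ} (hδ : 0 < δ)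
    (hF : ∀ᶠ i in l, HolderC1 δ M (F i)) (hlim : ∀ x, Tendsto (fun i => F i x) l (𝓝 (f x))) :
    HolderC1 δ M f ∧ ∀ x, Tendsto (fun i => deriv (F i) x) l (𝓝 (deriv f x)) := by
  have hM : 0 ≤ M := by obtain ⟨i, hi⟩ := hF.exists; exact hi.nonneg
  have hpow : Tendsto (fun k : ℝ => M * |k| ^ δ) (𝓝[≠] 0) (𝓝 0) := by
    have : ContinuousAt (fun k : ℝ => M * |k| ^ δ) 0 :=
      ContinuousAt.mul continuousAt_const (ContinuousAt.rpow_const (by fun_prop) (Or.inr hδ.le))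
    have h2 : Tendsto (fun k : ℝ => M * |k| ^ δ) (𝓝 0) (𝓝 0) := by
      simpa [ContinuousAt, Real.zero_rpow hδ.ne'] using this
    exact h2.mono_left nhdsWithin_le_nhds
  -- The difference quotient with a fixed small step k lies within M|k|^δ of the derivative,
  -- uniformly in i, and converges for that k. Hence the derivatives are Cauchy along the filter.
  have hc : ∀ x, ∃ g, Tendsto (fun i => deriv (F i) x) l (𝓝 g) := by
    intro x
    refine cauchy_map_iff_exists_tendsto.1 ?_
    refine cauchy_map_iff.2 ⟨inferInstance, ?_⟩
    rw [Metric.uniformity_basis_dist.tendsto_right_iff]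
    intro ε hε
    obtain ⟨k, hk, hk0⟩ := ((hpow.eventually (gt_mem_nhds (show (0 : ℝ) < ε / 3 by positivity))).and
      self_mem_nhdsWithin).exists
    have hk0 : k ≠ 0 := hk0
    have hs : Tendsto (fun i => (F i (x + k) - F i x) / k) l (𝓝 ((f (x + k) - f x) / k)) :=
      ((hlim _).sub (hlim _)).div_const _
    have hcs := (cauchy_map_iff.1 hs.cauchy_map).2
    rw [Metric.uniformity_basis_dist.tendsto_right_iff] at hcs
    filter_upwards [hcs (ε / 3) (by positivity), hF.prod_inl l, hF.prod_inr l] with p h1 h2 h3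
    simp only [Real.dist_eq] at h1 ⊢
    have h4 := h2.slope_le hδ.le x hk0
    have h5 := h3.slope_le hδ.le x hk0
    rw [_root_.abs_le] at h4 h5
    rw [abs_lt] at h1 ⊢
    constructor <;> linarith
  choose g hg using hc
  have hder : ∀ x, HasDerivAt f (g x) x := by
    intro x
    rw [hasDerivAt_iff_tendsto_slope_zero]
    rw [tendsto_iff_dist_tendsto_zero]
    refine squeeze_zero' (Eventually.of_forall fun _ => dist_nonneg) ?_ hpow
    filter_upwards [self_mem_nhdsWithin] with k hk
    have hk : k ≠ 0 := hk
    rw [Real.dist_eq, smul_eq_mul, inv_mul_eq_div]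
    have hs : Tendsto (fun i => |(F i (x + k) - F i x) / k - deriv (F i) x|) l
      (𝓝 |(f (x + k) - f x) / k - g x|) :=
      ((((hlim _).sub (hlim _)).div_const _).sub (hg x)).abs
    refine le_of_tendsto hs ?_
    filter_upwards [hF] with i hi using hi.slope_le hδ.le x hk
  have hdg : ∀ x, deriv f x = g x := fun x => (hder x).deriv
  refine ⟨⟨fun x => (hder x).differentiableAt, fun x => ?_, fun x => ?_, fun x y => ?_⟩, fun x => ?_⟩
  · exact le_of_tendsto (hlim x).abs (hF.mono fun i hi => hi.abs_le x)
  · rw [hdg]; exact le_of_tendsto (hg x).abs (hF.mono fun i hi => hi.abs_deriv_le x)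
  · rw [hdg, hdg]
    exact le_of_tendsto ((hg x).sub (hg y)).abs (hF.mono fun i hi => hi.holder x y)
  · rw [hdg]; exact hg x

end HolderC1

/-- The factor 3 counts the summands of the norm, each of which is at most M. -/
theorem memC1Holder_of_holderC1 {δ : ℝ≥0} (hδ : 0 < δ) {M : ℝ} {f : ℝ → ℝ}
    (h : HolderC1 δ M f) : c1HolderNorm δ f ≤ ENNReal.ofReal (3 * M) ∧ MemC1Holder δ f := by
  have hM := h.nonneg
  have h1 : c1HolderNorm δ f ≤ ENNReal.ofReal (3 * M) := by
    have e : ENNReal.ofReal (3 * M) = ENNReal.ofReal M + ENNReal.ofReal M + ENNReal.ofReal M := by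
      rw [← ENNReal.ofReal_add hM hM, ← ENNReal.ofReal_add (by positivity) hM]; congr 1; ring
    rw [e, c1HolderNorm]
    gcongr
    · refine iSup_le fun x => ?_
      rw [Real.enorm_eq_ofReal_abs]; exact ENNReal.ofReal_le_ofReal (h.abs_le x)
    · refine iSup_le fun x => ?_
      rw [Real.enorm_eq_ofReal_abs]; exact ENNReal.ofReal_le_ofReal (h.abs_deriv_le x)
    · refine HolderWith.eHolderNorm_le (C := M.toNNReal) fun x y => ?_
      rw [edist_dist, edist_dist, Real.dist_eq, Real.dist_eq,
        ENNReal.ofReal_rpow_of_nonneg (abs_nonneg _) (NNReal.coe_nonneg δ), ENNReal.ofNNReal_toNNReal,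
        ← ENNReal.ofReal_mul hM]
      exact ENNReal.ofReal_le_ofReal (h.holder x y)
  exact ⟨h1, contDiff_one_iff_deriv.2 ⟨h.differentiable, h.continuous_deriv (by exact_mod_cast hδ)⟩,
    h1.trans_lt ENNReal.ofReal_lt_top⟩

theorem holderC1_of_norm_le {δ : ℝ≥0} {M : ℝ≥0} {f : ℝ → ℝ}
    (hf : MemC1Holder δ f) (h : c1HolderNorm δ f ≤ M) : HolderC1 δ M f := by
  rw [c1HolderNorm] at h
  have h1 : (⨆ x, ‖f x‖ₑ) ≤ M := (le_self_add.trans le_self_add).trans h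
  have h2 : (⨆ x, ‖deriv f x‖ₑ) ≤ M := (le_add_self.trans le_self_add).trans h
  have h3 : eHolderNorm δ (deriv f) ≤ M := le_add_self.trans h
  have hb : ∀ g : ℝ → ℝ, (⨆ x, ‖g x‖ₑ) ≤ M → ∀ x, |g x| ≤ M := by
    intro g hg x
    have := (le_iSup (fun x => ‖g x‖ₑ) x).trans hg
    simpa [enorm_eq_nnnorm, ← NNReal.coe_le_coe] using this
  refine ⟨hf.1.differentiable (by norm_num), hb _ h1, hb _ h2, fun x y => ?_⟩
  have hm : MemHolder δ (deriv f) := eHolderNorm_ne_top.1 (ne_top_of_le_ne_top ENNReal.coe_ne_top h3)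
  have h4 : nnHolderNorm δ (deriv f) ≤ M := by
    rw [← hm.coe_nnHolderNorm_eq_eHolderNorm] at h3; exact_mod_cast h3
  have := hm.holderWith.dist_le x y
  rw [Real.dist_eq, Real.dist_eq] at this
  exact this.trans (by gcongr)

/-- `f ∈ L²` with `‖f‖_{L²} ≤ N`. -/
def L2Le (N : ℝ) (f : ℝ → ℝ) : Prop :=
  MemLp f 2 volume ∧ eLpNorm f 2 volume ≤ ENNReal.ofReal N

theorem eLpNorm_two_eq {f : ℝ → ℝ} (hf : MemLp f 2 volume) :
    eLpNorm f 2 volume = ENNReal.ofReal (√(∫ x, f x ^ 2)) := by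
  rw [hf.eLpNorm_eq_integral_rpow_norm (by norm_num) (by norm_num), Real.sqrt_eq_rpow]
  norm_num

theorem toReal_eLpNorm_two_sq {f : ℝ → ℝ} (hf : MemLp f 2 volume) :
    (eLpNorm f 2 volume).toReal ^ 2 = ∫ x, f x ^ 2 := by
  rw [eLpNorm_two_eq hf, ENNReal.toReal_ofReal (Real.sqrt_nonneg _),
    Real.sq_sqrt (integral_nonneg fun x => sq_nonneg _)]

theorem L2Le.integral_sq_le {N : ℝ} {f : ℝ → ℝ} (hf : L2Le N f) (hN : 0 ≤ N) :
    ∫ x, f x ^ 2 ≤ N ^ 2 := by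
  have := hf.2
  rw [eLpNorm_two_eq hf.1, ENNReal.ofReal_le_ofReal_iff hN] at this
  exact (Real.sqrt_le_left hN).1 this

theorem l2Le_of_integral_sq_le {N : ℝ} {f : ℝ → ℝ} (hf : MemLp f 2 volume) (hN : 0 ≤ N)
    (h : ∫ x, f x ^ 2 ≤ N ^ 2) : L2Le N f := by
  refine ⟨hf, ?_⟩
  rw [eLpNorm_two_eq hf]
  exact ENNReal.ofReal_le_ofReal ((Real.sqrt_le_left hN).2 h)

theorem L2Le.mono {N N' : ℝ} {f : ℝ → ℝ} (hf : L2Le N f) (h : N ≤ N') : L2Le N' f :=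
  ⟨hf.1, hf.2.trans (ENNReal.ofReal_le_ofReal h)⟩

theorem L2Le.add {N N' : ℝ} {f g : ℝ → ℝ} (hf : L2Le N f) (hg : L2Le N' g) (hN : 0 ≤ N)
    (hN' : 0 ≤ N') : L2Le (N + N') (fun x => f x + g x) := by
  refine ⟨hf.1.add hg.1, ?_⟩
  rw [ENNReal.ofReal_add hN hN']
  exact (eLpNorm_add_le hf.1.1 hg.1.1 (by norm_num)).trans (add_le_add hf.2 hg.2)

theorem L2Le.const_mul {N : ℝ} {f : ℝ → ℝ} (hf : L2Le N f) (c : ℝ) :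
    L2Le (|c| * N) (fun x => c * f x) := by
  refine ⟨hf.1.const_mul c, ?_⟩
  have := eLpNorm_const_smul_le (c := c) (f := f) (p := 2) (μ := volume)
  rw [ENNReal.ofReal_mul (abs_nonneg c), ← Real.enorm_eq_ofReal_abs]
  exact this.trans (by gcongr; exact hf.2)

theorem L2Le.sub {N N' : ℝ} {f g : ℝ → ℝ} (hf : L2Le N f) (hg : L2Le N' g) (hN : 0 ≤ N)
    (hN' : 0 ≤ N') : L2Le (N + N') (fun x => f x - g x) := by
  refine ⟨hf.1.sub hg.1, ?_⟩
  rw [ENNReal.ofReal_add hN hN']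
  exact (eLpNorm_sub_le hf.1.1 hg.1.1 (by norm_num)).trans (add_le_add hf.2 hg.2)

theorem L2Le.of_abs_le {N : ℝ} {f g : ℝ → ℝ} (hg : L2Le N g) (hf : AEStronglyMeasurable f volume)
    (h : ∀ x, |f x| ≤ |g x|) : L2Le N f := by
  refine ⟨hg.1.mono hf (Eventually.of_forall h), (eLpNorm_mono h).trans hg.2⟩

/-- Fatou: bounds in `L²` are stable under pointwise limits. -/
theorem L2Le.of_tendsto {ι : Type*} {l : Filter ι} [l.NeBot] [l.IsCountablyGenerated] {N : ℝ}
    {F : ι → ℝ → ℝ} {f : ℝ → ℝ} (hF : ∀ᶠ i in l, L2Le N (F i))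
    (hlim : ∀ x, Tendsto (fun i => F i x) l (𝓝 (f x))) : L2Le N f := by
  obtain ⟨s, hs⟩ := exists_seq_tendsto l
  obtain ⟨n0, hn0⟩ := eventually_atTop.1 (hs.eventually hF)
  have hFs : ∀ n, L2Le N (F (s (n + n0))) := fun n => hn0 _ (by omega)
  have hlim' : ∀ x, Tendsto (fun n => F (s (n + n0)) x) atTop (𝓝 (f x)) := fun x =>
    ((hlim x).comp hs).comp (tendsto_add_atTop_nat n0)
  have hle : eLpNorm f 2 volume ≤ ENNReal.ofReal N := by
    refine (Lp.eLpNorm_lim_le_liminf_eLpNorm (fun n => (hFs n).1.1) f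
      (Eventually.of_forall hlim')).trans ?_
    refine liminf_le_of_le (by isBoundedDefault) fun b hb => ?_
    obtain ⟨n, hn⟩ := hb.exists
    exact hn.trans (hFs n).2
  exact ⟨⟨aestronglyMeasurable_of_tendsto_ae atTop (fun n => (hFs n).1.1)
    (Eventually.of_forall hlim'), hle.trans_lt ENNReal.ofReal_lt_top⟩, hle⟩

/-- Interpolation: the sup norm is controlled by the Lipschitz constant and the `L²` norm. -/
theorem abs_pow_three_le {K : ℝ} (hK : 0 < K) {f : ℝ → ℝ} (hf : MemLp f 2 volume)
    (hL : ∀ x y, |f x - f y| ≤ K * |x - y|) (x : ℝ) :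
    |f x| ^ 3 ≤ 4 * K * ∫ y, f y ^ 2 := by
  rcases eq_or_ne (f x) 0 with h0 | h0
  · have : 0 ≤ ∫ y, f y ^ 2 := integral_nonneg fun y => sq_nonneg _
    simpa [h0] using mul_nonneg (by positivity : 0 ≤ 4 * K) this
  have hp : 0 < |f x| := abs_pos.2 h0
  -- On the interval of radius r about x the function varies by at most |f x| / 2, so it keeps at
  -- least half its size there.
  set r := |f x| / (2 * K) with hr
  have hr0 : 0 < r := by positivity
  have h1 : ∫ y in Icc (x - r) (x + r), (|f x| / 2) ^ 2 ≤ ∫ y in Icc (x - r) (x + r), f y ^ 2 := by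
    refine setIntegral_mono_on (by simp) hf.integrable_sq.integrableOn measurableSet_Icc ?_
    intro y hy
    have h2 : |x - y| ≤ r := by rw [abs_le]; constructor <;> linarith [hy.1, hy.2]
    have h3 := hL x y
    have h4 : K * |x - y| ≤ |f x| / 2 := by
      calc K * |x - y| ≤ K * r := by gcongr
        _ = |f x| / 2 := by rw [hr]; field_simp
    have h5 : |f x| / 2 ≤ |f y| := by
      have := abs_sub_abs_le_abs_sub (f x) (f y); linarith
    rw [← sq_abs (f y)]; gcongr
  have h2 : ∫ y in Icc (x - r) (x + r), f y ^ 2 ≤ ∫ y, f y ^ 2 :=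
    setIntegral_le_integral hf.integrable_sq (Eventually.of_forall fun y => sq_nonneg _)
  rw [setIntegral_const, Measure.real, Real.volume_Icc, ENNReal.toReal_ofReal (by linarith),
    smul_eq_mul] at h1
  have h3 := h1.trans h2
  have e : (x + r - (x - r)) * (|f x| / 2) ^ 2 = |f x| ^ 3 / (4 * K) := by rw [hr]; field_simp; ring
  rw [e, div_le_iff₀ (by positivity)] at h3
  linarith

/-- Convergence in `L²` of functions with a common Lipschitz constant implies pointwise
convergence. -/
theorem tendsto_of_eLpNorm_tendsto {ι : Type*} {l : Filter ι} {δ M : ℝ}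
    {F : ι → ℝ → ℝ} {f : ℝ → ℝ} (hF : ∀ᶠ i in l, HolderC1 δ M (F i)) (hf : HolderC1 δ M f)
    (hF2 : ∀ᶠ i in l, MemLp (F i) 2 volume) (hf2 : MemLp f 2 volume)
    (h : Tendsto (fun i => eLpNorm (F i - f) 2 volume) l (𝓝 0)) (x : ℝ) :
    Tendsto (fun i => F i x) l (𝓝 (f x)) := by
  -- The Lipschitz constant 2M of the difference is enlarged by 1 because the interpolation
  -- inequality needs a positive constant, and M may vanish.
  have h1 : Tendsto (fun i => 4 * (2 * M + 1) * (eLpNorm (F i - f) 2 volume).toReal ^ 2) l (𝓝 0) := by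
    have := (ENNReal.tendsto_toReal ENNReal.zero_ne_top).comp h
    simpa using (this.pow 2).const_mul (4 * (2 * M + 1))
  have h2 : Tendsto (fun i => |F i x - f x| ^ 3) l (𝓝 0) := by
    refine squeeze_zero' (Eventually.of_forall fun _ => by positivity) ?_ h1
    filter_upwards [hF, hF2] with i hi hi2
    rw [toReal_eLpNorm_two_sq (hi2.sub hf2)]
    have hM := hf.nonneg
    refine abs_pow_three_le (by positivity) (hi2.sub hf2) (fun a b => ?_) x
    have := (hi.sub hf).abs_sub_le a b
    exact this.trans (mul_le_mul_of_nonneg_right (by linarith) (abs_nonneg _))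
  have h3 : Tendsto (fun i => |F i x - f x|) l (𝓝 0) := by
    have := h2.rpow_const (p := (1 : ℝ) / 3) (Or.inr (by norm_num))
    rw [Real.zero_rpow (by norm_num)] at this
    refine this.congr fun i => ?_
    rw [← Real.rpow_natCast, ← Real.rpow_mul (abs_nonneg _)]; norm_num
  exact tendsto_iff_dist_tendsto_zero.2 h3

/-- The transport part of the chain rule: the derivative of `s ↦ f s (X s) - f s (X t)` at `t`. -/
theorem hasDerivWithinAt_transport {δ M : ℝ} (hδ : 0 < δ) {A : Set ℝ} {t v : ℝ} (ht : t ∈ A)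
    {f : ℝ → ℝ → ℝ} {X : ℝ → ℝ} (hf : ∀ s ∈ A, HolderC1 δ M (f s))
    (hlim : ∀ x, Tendsto (fun s => f s x) (𝓝[A] t) (𝓝 (f t x)))
    (hX : HasDerivWithinAt X v A t) :
    HasDerivWithinAt (fun s => f s (X s) - f s (X t)) (deriv (f t) (X t) * v) A t := by
  have hne : (𝓝[A] t).NeBot := mem_closure_iff_nhdsWithin_neBot.1 (subset_closure ht)
  have hd := (HolderC1.of_tendsto hδ (by filter_upwards [self_mem_nhdsWithin] with s hs using hf s hs)
    hlim).2 (X t)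
  -- compare with the linear part
  have h1 : HasDerivWithinAt (fun s => deriv (f s) (X t) * (X s - X t)) (deriv (f t) (X t) * v) A t := by
    rw [hasDerivWithinAt_iff_tendsto_slope] at hX ⊢
    have := (hd.mono_left (nhdsWithin_mono t (sdiff_subset (t := {t})))).mul hX
    refine this.congr fun s => ?_
    simp only [slope_def_field]; ring
  -- The Taylor remainder is at most M |X s - X t|^{1+δ}, uniformly in the function f s. It is
  -- therefore o(X s - X t), and X s - X t = O(s - t).
  have h2 : HasDerivWithinAt (fun s => f s (X s) - f s (X t) - deriv (f s) (X t) * (X s - X t))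
      0 A t := by
    rw [hasDerivWithinAt_iff_isLittleO]
    have hXO : (fun s => X s - X t) =O[𝓝[A] t] fun s => s - t := HasFDerivWithinAt.isBigO_sub hX
    have hXc : Tendsto (fun s => M * |X s - X t| ^ δ) (𝓝[A] t) (𝓝 0) := by
      have h0 : Tendsto (fun s => |X s - X t|) (𝓝[A] t) (𝓝 0) := by
        have := (hX.continuousWithinAt.tendsto.sub_const (X t)).abs
        simpa using this
      have := (h0.rpow_const (p := δ) (Or.inr hδ.le)).const_mul M
      simpa [Real.zero_rpow hδ.ne'] using this
    have hl : (fun s => f s (X s) - f s (X t) - deriv (f s) (X t) * (X s - X t))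
        =o[𝓝[A] t] fun s => X s - X t := by
      rw [Asymptotics.isLittleO_iff]
      intro c hc
      filter_upwards [hXc.eventually (gt_mem_nhds hc), self_mem_nhdsWithin] with s hs hsA
      refine ((hf s hsA).taylor hδ.le _ _).trans ?_
      rw [Real.norm_eq_abs]
      gcongr
    simpa using hl.trans_isBigO hXO
  have := h2.add h1
  rw [zero_add] at this
  refine this.congr_of_mem (fun s _ => ?_) ht
  simp

end

/-! ### Cauchy integrals in the upper half plane. -/

section

/-- Convolution with the conjugate Poisson kernel at height `ε`. -/
def conjPoisson (ε : ℝ) (f : ℝ → ℝ) (x : ℝ) : ℝ :=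
  (1 / Real.pi) * ∫ y, f y * ((x - y) / ((x - y) ^ 2 + ε ^ 2))

theorem integrable_comp_affine {g : ℝ → ℝ} (hg : Integrable g) (x : ℝ) {s : ℝ} (hs : 0 < s) :
    Integrable (fun z => g ((z - x) / s)) :=
  (hg.comp_div hs.ne').comp_sub_right x

theorem integral_comp_affine (g : ℝ → ℝ) (x : ℝ) {s : ℝ} (hs : 0 < s) :
    ∫ z, g ((z - x) / s) = s * ∫ z, g z := by
  rw [integral_sub_right_eq_self (fun z => g (z / s)) x, Measure.integral_comp_div, abs_of_pos hs,
    smul_eq_mul]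

theorem inv_sq_add_sq_eq (x : ℝ) {s : ℝ} (hs : 0 < s) (z : ℝ) :
    ((z - x) ^ 2 + s ^ 2)⁻¹ = (s ^ 2)⁻¹ * (1 + ((z - x) / s) ^ 2)⁻¹ := by
  rw [← mul_inv]; congr 1; field_simp; ring

theorem integrable_inv_sq_add_sq (x : ℝ) {s : ℝ} (hs : 0 < s) :
    Integrable (fun z : ℝ => ((z - x) ^ 2 + s ^ 2)⁻¹) := by
  simp_rw [inv_sq_add_sq_eq x hs]
  exact (integrable_comp_affine integrable_inv_one_add_sq x hs).const_mul _

theorem integral_inv_sq_add_sq (x : ℝ) {s : ℝ} (hs : 0 < s) :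
    ∫ z : ℝ, ((z - x) ^ 2 + s ^ 2)⁻¹ = Real.pi / s := by
  simp_rw [inv_sq_add_sq_eq x hs]
  rw [integral_const_mul, integral_comp_affine (fun z => (1 + z ^ 2)⁻¹) x hs,
    integral_univ_inv_one_add_sq]
  field_simp

/-- The reciprocal of `z - w`, for real `z`. -/
def cauchyKernel (w : ℂ) (z : ℝ) : ℂ := ((z : ℂ) - w)⁻¹

theorem norm_sub_sq (w : ℂ) (z : ℝ) : ‖(z : ℂ) - w‖ ^ 2 = (z - w.re) ^ 2 + w.im ^ 2 := by
  rw [Complex.sq_norm, Complex.normSq_apply]; simp; ring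

theorem norm_cauchyKernel_sq (w : ℂ) (z : ℝ) :
    ‖cauchyKernel w z‖ ^ 2 = ((z - w.re) ^ 2 + w.im ^ 2)⁻¹ := by
  rw [cauchyKernel, norm_inv, inv_pow, norm_sub_sq]

theorem sub_ne_zero_of_im_pos {w : ℂ} (hw : 0 < w.im) (z : ℝ) : (z : ℂ) - w ≠ 0 := by
  intro h
  have := congrArg Complex.im h
  simp at this
  exact hw.ne' this

theorem im_le_norm_sub (w : ℂ) (z : ℝ) : w.im ≤ ‖(z : ℂ) - w‖ := by
  have := Complex.abs_im_le_norm ((z : ℂ) - w)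
  simp at this
  exact (le_abs_self _).trans this

theorem norm_cauchyKernel_le {w : ℂ} (hw : 0 < w.im) (z : ℝ) : ‖cauchyKernel w z‖ ≤ w.im⁻¹ := by
  rw [cauchyKernel, norm_inv]
  exact inv_anti₀ hw (im_le_norm_sub w z)

theorem continuous_cauchyKernel {w : ℂ} (hw : 0 < w.im) : Continuous (cauchyKernel w) :=
  Continuous.inv₀ (by fun_prop) (sub_ne_zero_of_im_pos hw)

theorem norm_cauchyKernel_pow_le {w : ℂ} (hw : 0 < w.im) (m : ℕ) (z : ℝ) :
    ‖cauchyKernel w z ^ (m + 2)‖ ≤ w.im⁻¹ ^ m * ((z - w.re) ^ 2 + w.im ^ 2)⁻¹ := by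
  rw [norm_pow, pow_add, norm_cauchyKernel_sq]
  gcongr
  exact norm_cauchyKernel_le hw z

theorem integrable_cauchyKernel_pow {w : ℂ} (hw : 0 < w.im) (m : ℕ) :
    Integrable (fun z => cauchyKernel w z ^ (m + 2)) :=
  Integrable.mono' ((integrable_inv_sq_add_sq w.re hw).const_mul (w.im⁻¹ ^ m))
    ((continuous_cauchyKernel hw).pow _).aestronglyMeasurable
    (Eventually.of_forall (norm_cauchyKernel_pow_le hw m))

theorem tendsto_cauchyKernel {l : Filter ℝ} (hl : Tendsto (fun z : ℝ => |z|) l atTop) (w : ℂ) :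
    Tendsto (cauchyKernel w) l (𝓝 0) := by
  rw [tendsto_zero_iff_norm_tendsto_zero]
  simp only [cauchyKernel, norm_inv]
  refine tendsto_inv_atTop_zero.comp ?_
  refine tendsto_atTop_mono (fun z => ?_) (tendsto_atTop_add_const_right _ (-‖w‖) hl)
  have := norm_sub_norm_le (z : ℂ) w
  rw [Complex.norm_real, Real.norm_eq_abs] at this
  linarith

/-- The integrand has a multiple of (z - w)^{-(m+1)} as antiderivative, which vanishes at both ends.
The powers start at 2 because the first power is not integrable. -/
theorem integral_cauchyKernel_pow {w : ℂ} (hw : 0 < w.im) (m : ℕ) :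
    ∫ z, cauchyKernel w z ^ (m + 2) = 0 := by
  have hd : ∀ z : ℝ, HasDerivAt (fun z => cauchyKernel w z ^ (m + 1))
      (-(m + 1 : ℂ) * cauchyKernel w z ^ (m + 2)) z := by
    intro z
    have h1 : HasDerivAt (fun z : ℝ => (z : ℂ) - w) 1 z :=
      (Complex.ofRealCLM.hasDerivAt (x := z)).sub_const w
    have h2 := (h1.inv (sub_ne_zero_of_im_pos hw z)).pow (m + 1)
    refine h2.congr_deriv ?_
    simp only [Pi.inv_apply, cauchyKernel, Nat.add_sub_cancel, div_eq_mul_inv, ← inv_pow]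
    push_cast
    ring
  have h0 : ∀ l : Filter ℝ, Tendsto (fun z : ℝ => |z|) l atTop →
      Tendsto (fun z => cauchyKernel w z ^ (m + 1)) l (𝓝 0) := fun l hl => by
    simpa using (tendsto_cauchyKernel hl w).pow (m + 1)
  have := integral_of_hasDerivAt_of_tendsto hd
    ((integrable_cauchyKernel_pow hw m).const_mul _) (h0 _ tendsto_abs_atBot_atTop)
    (h0 _ tendsto_abs_atTop_atTop)
  rw [integral_const_mul, sub_zero] at this
  refine (mul_eq_zero.1 this).resolve_left ?_
  refine neg_ne_zero.2 ?_
  exact_mod_cast Nat.succ_ne_zero m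

/-- `∫ f(z) / (z - w)ⁿ dz`. -/
def cauchyPow (f : ℝ → ℝ) (n : ℕ) (w : ℂ) : ℂ := ∫ z, (f z : ℂ) * cauchyKernel w z ^ n

variable {δ M : ℝ} {f : ℝ → ℝ}

theorem integrable_cauchyPow_succ_succ (hf : Continuous f) (hb : ∀ x, |f x| ≤ M) {w : ℂ}
    (hw : 0 < w.im) (m : ℕ) : Integrable fun z => (f z : ℂ) * cauchyKernel w z ^ (m + 2) :=
  (integrable_cauchyKernel_pow hw m).bdd_mul (c := M)
    (Complex.continuous_ofReal.comp hf).aestronglyMeasurable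
    (Eventually.of_forall fun x => by simpa using hb x)

theorem memLp_cauchyKernel {w : ℂ} (hw : 0 < w.im) : MemLp (cauchyKernel w) 2 volume := by
  rw [memLp_two_iff_integrable_sq_norm (continuous_cauchyKernel hw).aestronglyMeasurable]
  simp_rw [norm_cauchyKernel_sq]
  exact integrable_inv_sq_add_sq _ hw

theorem integrable_cauchyPow_one (hf : MemLp f 2 volume) {w : ℂ} (hw : 0 < w.im) :
    Integrable fun z => (f z : ℂ) * cauchyKernel w z ^ 1 := by
  have h1 : MemLp (fun z => (f z : ℂ)) 2 volume := hf.ofReal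
  simp only [pow_one]
  exact h1.integrable_mul (memLp_cauchyKernel hw)

/-- Differentiation under the integral: for v within Im w / 2 of w the kernel is at most twice the
kernel at w, which supplies the dominating function. Integrability at w is left as a hypothesis
because its source varies: f ∈ L² for the first power, boundedness of f for the higher ones. -/
theorem hasDerivAt_cauchyPow (hf : Continuous f) (hb : ∀ x, |f x| ≤ M) {w : ℂ} (hw : 0 < w.im)
    (m : ℕ) (hint : Integrable fun z => (f z : ℂ) * cauchyKernel w z ^ (m + 1)) :
    HasDerivAt (cauchyPow f (m + 1)) ((m + 1 : ℂ) * cauchyPow f (m + 2) w) w := by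
  have hM : 0 ≤ M := (abs_nonneg _).trans (hb 0)
  have hball : ∀ v ∈ Metric.ball w (w.im / 2), 0 < v.im := by
    intro v hv
    rw [Metric.mem_ball, Complex.dist_eq] at hv
    have := Complex.abs_im_le_norm (v - w)
    rw [Complex.sub_im] at this
    have := (abs_le.1 (this.trans hv.le)).1
    linarith
  have hker : ∀ v ∈ Metric.ball w (w.im / 2), ∀ z, ‖cauchyKernel v z‖ ≤ 2 * ‖cauchyKernel w z‖ := by
    intro v hv z
    rw [Metric.mem_ball, Complex.dist_eq] at hv
    rw [cauchyKernel, cauchyKernel, norm_inv, norm_inv, ← div_eq_mul_inv, inv_eq_one_div,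
      div_le_div_iff₀ (norm_pos_iff.2 (sub_ne_zero_of_im_pos (hball v (by
        rwa [Metric.mem_ball, Complex.dist_eq])) z)) (norm_pos_iff.2 (sub_ne_zero_of_im_pos hw z))]
    have h1 := norm_sub_norm_le ((z : ℂ) - w) (v - w)
    have h2 := im_le_norm_sub w z
    rw [sub_sub_sub_cancel_right] at h1
    linarith
  have h := hasDerivAt_integral_of_dominated_loc_of_deriv_le (μ := volume) (𝕜 := ℂ)
    (F := fun v z => (f z : ℂ) * cauchyKernel v z ^ (m + 1)) (x₀ := w)
    (F' := fun v z => (m + 1 : ℂ) * ((f z : ℂ) * cauchyKernel v z ^ (m + 2)))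
    (bound := fun z => ((m : ℝ) + 1) * (M * (2 ^ (m + 2) * ‖cauchyKernel w z ^ (m + 2)‖)))
    (Metric.ball_mem_nhds w (by positivity : 0 < w.im / 2)) ?_ hint ?_ ?_ ?_ ?_
  · rw [integral_const_mul] at h
    exact h.2
  · filter_upwards [Metric.ball_mem_nhds w (by positivity : 0 < w.im / 2)] with v hv
    exact ((Complex.continuous_ofReal.comp hf).mul
      ((continuous_cauchyKernel (hball v hv)).pow _)).aestronglyMeasurable
  · exact (continuous_const.mul ((Complex.continuous_ofReal.comp hf).mul
      ((continuous_cauchyKernel hw).pow _))).aestronglyMeasurable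
  · refine Eventually.of_forall fun z v hv => ?_
    have e1 : ‖(m + 1 : ℂ)‖ = (m : ℝ) + 1 := by
      exact_mod_cast Complex.norm_natCast (m + 1)
    rw [norm_mul, norm_mul, e1, Complex.norm_real, Real.norm_eq_abs, norm_pow, norm_pow,
      ← mul_pow]
    gcongr
    · exact hb z
    · exact hker v hv z
  · exact ((((integrable_cauchyKernel_pow hw m).norm.const_mul _).const_mul _).const_mul _)
  · refine Eventually.of_forall fun z v hv => ?_
    have hne := sub_ne_zero_of_im_pos (hball v hv) z
    have h2 := ((((hasDerivAt_id v).const_sub (z : ℂ)).inv hne).pow (m + 1)).const_mul (f z : ℂ)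
    refine h2.congr_deriv ?_
    simp only [Pi.inv_apply, cauchyKernel, Nat.add_sub_cancel, div_eq_mul_inv, ← inv_pow, id]
    push_cast
    ring

/-- The constant `∫ (1 + ζ²)^{-(2-δ)/2} dζ`. -/
def holderConst (δ : ℝ) : ℝ := ∫ z : ℝ, (1 + ‖z‖ ^ 2) ^ (-(2 - δ) / 2)

theorem holderConst_nonneg (δ : ℝ) : 0 ≤ holderConst δ :=
  integral_nonneg fun z => by positivity

/-- The third power of the kernel annihilates affine functions, so the first Taylor polynomial of f
at Re w may be subtracted for free. The remainder is at most M |z - w|^{1+δ}, and ∫ |z - w|^{δ-2} dz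
scales like (Im w)^{δ-1}. This is the one place where Hölder regularity of f' enters the bound for
the Hilbert transform. -/
theorem norm_cauchyPow_three_le (hf : HolderC1 δ M f) (hδ0 : 0 < δ) (hδ1 : δ < 1) {w : ℂ}
    (hw : 0 < w.im) : ‖cauchyPow f 3 w‖ ≤ M * holderConst δ * w.im ^ (δ - 1) := by
  set x := w.re
  set s := w.im
  have hM := hf.nonneg
  have hint : Integrable fun z : ℝ => (1 + ‖z‖ ^ 2) ^ (-(2 - δ) / 2) :=
    integrable_rpow_neg_one_add_norm_sq (by simp; linarith)
  have hk3 := integrable_cauchyKernel_pow hw 1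
  have hk2 := integrable_cauchyKernel_pow hw 0
  simp only [Nat.reduceAdd] at hk2 hk3
  have hf3 := integrable_cauchyPow_succ_succ hf.continuous hf.abs_le hw 1
  simp only [Nat.reduceAdd] at hf3
  have e : cauchyPow f 3 w = ∫ z : ℝ, ((f z - f x - deriv f x * (z - x) : ℝ) : ℂ) *
      cauchyKernel w z ^ 3 := by
    have e1 : ∀ z : ℝ, ((f z - f x - deriv f x * (z - x) : ℝ) : ℂ) * cauchyKernel w z ^ 3 =
        (f z : ℂ) * cauchyKernel w z ^ 3 - ((f x : ℂ) + (deriv f x : ℝ) * (s * Complex.I)) *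
          cauchyKernel w z ^ 3 - (deriv f x : ℝ) * cauchyKernel w z ^ 2 := by
      intro z
      have hne := sub_ne_zero_of_im_pos hw z
      have hz : ((z - x : ℝ) : ℂ) * cauchyKernel w z = 1 + s * Complex.I * cauchyKernel w z := by
        have : ((z - x : ℝ) : ℂ) = ((z : ℂ) - w) + s * Complex.I := by
          conv_rhs => rw [← Complex.re_add_im w]
          push_cast; ring
        rw [this, add_mul, cauchyKernel, mul_inv_cancel₀ hne]
      push_cast at hz ⊢
      linear_combination (-((deriv f x : ℝ) : ℂ) * cauchyKernel w z ^ 2) * hz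
    have h4 : ∫ z, cauchyKernel w z ^ 3 = 0 := integral_cauchyKernel_pow hw 1
    have h5 : ∫ z, cauchyKernel w z ^ 2 = 0 := integral_cauchyKernel_pow hw 0
    simp_rw [e1]
    have hA : Integrable fun z => (f z : ℂ) * cauchyKernel w z ^ 3 -
        ((f x : ℂ) + (deriv f x : ℝ) * (s * Complex.I)) * cauchyKernel w z ^ 3 :=
      hf3.sub (hk3.const_mul _)
    rw [integral_sub hA (hk2.const_mul _),
      integral_sub hf3 (hk3.const_mul _), integral_const_mul, integral_const_mul, h4, h5]
    simp [cauchyPow]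
  have hgi := ((integrable_comp_affine hint x hw).const_mul (s ^ (-(2 - δ)))).const_mul M
  rw [e]
  refine (norm_integral_le_of_norm_le hgi (Eventually.of_forall fun z => ?_)).trans_eq ?_
  · have hn : 0 < ‖(z : ℂ) - w‖ := norm_pos_iff.2 (sub_ne_zero_of_im_pos hw z)
    have hre : |z - x| ≤ ‖(z : ℂ) - w‖ := by
      have := Complex.abs_re_le_norm ((z : ℂ) - w)
      simpa using this
    have h6 : |f z - f x - deriv f x * (z - x)| ≤
        M * ‖(z : ℂ) - w‖ ^ δ * ‖(z : ℂ) - w‖ := by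
      refine (hf.taylor hδ0.le x z).trans ?_
      gcongr
    -- Scaling by s brings |z - w| to the form s (1 + ζ²)^{1/2} with ζ = (z - x) / s, the integrand
    -- of `holderConst`.
    have h7 : s ^ (-(2 - δ)) * (1 + ‖(z - x) / s‖ ^ 2) ^ (-(2 - δ) / 2) =
        ‖(z : ℂ) - w‖ ^ (-(2 - δ)) := by
      have hsq : s * (1 + ‖(z - x) / s‖ ^ 2) ^ (1 / 2 : ℝ) = ‖(z : ℂ) - w‖ := by
        rw [← Real.sqrt_eq_rpow]
        have : ‖(z : ℂ) - w‖ ^ 2 = s ^ 2 * (1 + ‖(z - x) / s‖ ^ 2) := by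
          rw [norm_sub_sq, Real.norm_eq_abs, sq_abs]
          have : s ≠ 0 := hw.ne'
          change (z - x) ^ 2 + s ^ 2 = _
          field_simp; ring
        rw [← Real.sqrt_sq hn.le, this, Real.sqrt_mul (sq_nonneg s), Real.sqrt_sq hw.le]
      rw [← hsq, Real.mul_rpow hw.le (by positivity), ← Real.rpow_mul (by positivity)]
      congr 2; ring
    rw [h7, norm_mul, Complex.norm_real, Real.norm_eq_abs, norm_pow, cauchyKernel, norm_inv]
    calc _ ≤ M * ‖(z : ℂ) - w‖ ^ δ * ‖(z : ℂ) - w‖ * ‖(z : ℂ) - w‖⁻¹ ^ 3 := by gcongr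
      _ = M * (‖(z : ℂ) - w‖ ^ δ * ‖(z : ℂ) - w‖⁻¹ ^ 2) := by field_simp
      _ = M * ‖(z : ℂ) - w‖ ^ (-(2 - δ)) := by
        rw [neg_sub, Real.rpow_sub hn, inv_pow, div_eq_mul_inv]; norm_num
  · rw [integral_const_mul, integral_const_mul,
      integral_comp_affine (fun z => (1 + ‖z‖ ^ 2) ^ (-(2 - δ) / 2)) x hw, holderConst]
    rw [show δ - 1 = -(2 - δ) + 1 by ring, Real.rpow_add hw, Real.rpow_one]
    ring

end

/-! ### The Hilbert transform on C^{1+δ} ∩ L². -/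

section

variable {δ M : ℝ} {f : ℝ → ℝ}

theorem hasDerivAt_cauchyPow_two (hf : HolderC1 δ M f) {w : ℂ} (hw : 0 < w.im) :
    HasDerivAt (cauchyPow f 2) (2 * cauchyPow f 3 w) w := by
  have := hasDerivAt_cauchyPow hf.continuous hf.abs_le hw 1
    (integrable_cauchyPow_succ_succ hf.continuous hf.abs_le hw 0)
  norm_num at this
  exact this

theorem hasDerivAt_cauchyPow_one (hf : HolderC1 δ M f) (hf2 : MemLp f 2 volume) {w : ℂ}
    (hw : 0 < w.im) : HasDerivAt (cauchyPow f 1) (cauchyPow f 2 w) w := by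
  have := hasDerivAt_cauchyPow hf.continuous hf.abs_le hw 0 (integrable_cauchyPow_one hf2 hw)
  norm_num at this
  exact this

theorem hasDerivAt_vertical (x s : ℝ) : HasDerivAt (fun s : ℝ => (⟨x, s⟩ : ℂ)) Complex.I s := by
  have : HasDerivAt (fun s : ℝ => (x : ℂ) + s * Complex.I) (1 * Complex.I) s :=
    ((Complex.ofRealCLM.hasDerivAt (x := s)).mul_const Complex.I).const_add (x : ℂ)
  rw [one_mul] at this
  refine this.congr_of_eventuallyEq (Eventually.of_forall fun s => ?_)
  exact Complex.mk_eq_add_mul_I x s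

theorem hasDerivAt_horizontal (x s : ℝ) : HasDerivAt (fun x : ℝ => (⟨x, s⟩ : ℂ)) 1 x := by
  have : HasDerivAt (fun x : ℝ => (x : ℂ) + s * Complex.I) 1 x :=
    (Complex.ofRealCLM.hasDerivAt (x := x)).add_const (s * Complex.I)
  refine this.congr_of_eventuallyEq (Eventually.of_forall fun x => ?_)
  exact Complex.mk_eq_add_mul_I x s

/-- The vertical derivative is O(s^{δ-1}), which is integrable at s = 0 because δ > 0. The bound is
thus independent of the lower height a. -/
theorem cauchyPow_two_vertical (hf : HolderC1 δ M f) (hδ0 : 0 < δ) (hδ1 : δ < 1) (x : ℝ) {a b : ℝ}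
    (ha : 0 < a) (hab : a ≤ b) :
    ‖cauchyPow f 2 ⟨x, b⟩ - cauchyPow f 2 ⟨x, a⟩‖ ≤ 2 * M * holderConst δ / δ * b ^ δ := by
  have hM := hf.nonneg
  have hc := holderConst_nonneg δ
  have hd : ∀ s, 0 < s → HasDerivAt (fun s : ℝ => cauchyPow f 2 ⟨x, s⟩ - cauchyPow f 2 ⟨x, a⟩)
      (2 * cauchyPow f 3 ⟨x, s⟩ * Complex.I) s := fun s hs =>
    ((hasDerivAt_cauchyPow_two (w := ⟨x, s⟩) hf hs).comp s (hasDerivAt_vertical x s)).sub_const _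
  have hB : ∀ s, 0 < s → HasDerivAt (fun s : ℝ => 2 * M * holderConst δ / δ * s ^ δ)
      (2 * M * holderConst δ * s ^ (δ - 1)) s := fun s hs => by
    refine ((Real.hasDerivAt_rpow_const (Or.inl hs.ne')).const_mul _).congr_deriv ?_
    field_simp
  refine image_norm_le_of_norm_deriv_right_le_deriv_boundary' (a := a) (b := b)
    (f := fun s => cauchyPow f 2 ⟨x, s⟩ - cauchyPow f 2 ⟨x, a⟩)
    (B := fun s => 2 * M * holderConst δ / δ * s ^ δ)
    (fun s hs => (hd s (ha.trans_le hs.1)).continuousAt.continuousWithinAt)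
    (fun s hs => (hd s (ha.trans_le hs.1)).hasDerivWithinAt) ?_
    (fun s hs => (hB s (ha.trans_le hs.1)).continuousAt.continuousWithinAt)
    (fun s hs => (hB s (ha.trans_le hs.1)).hasDerivWithinAt) (fun s hs => ?_) ⟨hab, le_rfl⟩
  · simp only [sub_self, norm_zero]; positivity
  · rw [norm_mul, norm_mul, Complex.norm_I, mul_one, Complex.norm_ofNat]
    have := norm_cauchyPow_three_le hf hδ0 hδ1 (w := ⟨x, s⟩) (ha.trans_le hs.1)
    linarith

theorem cauchyPow_two_horizontal (hf : HolderC1 δ M f) (hδ0 : 0 < δ) (hδ1 : δ < 1) (x y : ℝ) {s : ℝ}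
    (hs : 0 < s) : ‖cauchyPow f 2 ⟨x, s⟩ - cauchyPow f 2 ⟨y, s⟩‖ ≤
      2 * M * holderConst δ * s ^ (δ - 1) * |x - y| := by
  have hd : ∀ x : ℝ, HasDerivAt (fun x : ℝ => cauchyPow f 2 ⟨x, s⟩)
      (2 * cauchyPow f 3 ⟨x, s⟩ * 1) x := fun x => by
    have h := (hasDerivAt_cauchyPow_two (w := ⟨x, s⟩) hf hs).comp x (hasDerivAt_horizontal x s)
    exact h
  refine convex_univ.norm_image_sub_le_of_norm_hasDerivWithin_le
    (fun x _ => (hd x).hasDerivWithinAt) (fun x _ => ?_) (mem_univ y) (mem_univ x)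
  rw [mul_one, norm_mul, Complex.norm_ofNat]
  have := norm_cauchyPow_three_le hf hδ0 hδ1 (w := ⟨x, s⟩) hs
  linarith

/-- If the height s is at least |x - y|, move horizontally. Otherwise climb to height |x - y|, move
across there and descend; each leg costs a multiple of |x - y|^δ. Since δ < 1, horizontal motion is
cheaper at greater height. -/
theorem cauchyPow_two_holder (hf : HolderC1 δ M f) (hδ0 : 0 < δ) (hδ1 : δ < 1) (x y : ℝ) {s : ℝ}
    (hs : 0 < s) : ‖cauchyPow f 2 ⟨x, s⟩ - cauchyPow f 2 ⟨y, s⟩‖ ≤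
      2 * M * holderConst δ * (2 / δ + 1) * |x - y| ^ δ := by
  have hM := hf.nonneg
  have hc := holderConst_nonneg δ
  rcases eq_or_ne x y with rfl | hxy
  · simp only [sub_self, norm_zero]; positivity
  have hh : 0 < |x - y| := abs_pos.2 (sub_ne_zero.2 hxy)
  have key : ∀ r, |x - y| ≤ r → r ^ (δ - 1) * |x - y| ≤ |x - y| ^ δ := by
    intro r hr
    calc r ^ (δ - 1) * |x - y| ≤ |x - y| ^ (δ - 1) * |x - y| := by
          gcongr ?_ * _
          exact Real.rpow_le_rpow_of_nonpos hh hr (by linarith)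
      _ = |x - y| ^ δ := by rw [Real.rpow_sub_one hh.ne']; field_simp
  have hH : ∀ r, |x - y| ≤ r → ‖cauchyPow f 2 ⟨x, r⟩ - cauchyPow f 2 ⟨y, r⟩‖ ≤
      2 * M * holderConst δ * |x - y| ^ δ := fun r hr => by
    refine (cauchyPow_two_horizontal hf hδ0 hδ1 x y (hh.trans_le hr)).trans ?_
    rw [mul_assoc]
    gcongr
    exact key r hr
  rcases le_total |x - y| s with h | h
  · refine (hH s h).trans ?_
    have : 0 ≤ 2 * M * holderConst δ * |x - y| ^ δ * (2 / δ) := by positivity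
    linarith
  · have h1 := cauchyPow_two_vertical hf hδ0 hδ1 x hs h
    have h2 := cauchyPow_two_vertical hf hδ0 hδ1 y hs h
    have h3 := hH _ le_rfl
    have e : cauchyPow f 2 ⟨x, s⟩ - cauchyPow f 2 ⟨y, s⟩ =
      (cauchyPow f 2 ⟨x, |x - y|⟩ - cauchyPow f 2 ⟨y, |x - y|⟩) -
      (cauchyPow f 2 ⟨x, |x - y|⟩ - cauchyPow f 2 ⟨x, s⟩) +
      (cauchyPow f 2 ⟨y, |x - y|⟩ - cauchyPow f 2 ⟨y, s⟩) := by ring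
    rw [e]
    refine (norm_add_le _ _).trans ?_
    refine (add_le_add_left (norm_sub_le _ _) _).trans ?_
    have : 2 * M * holderConst δ * (2 / δ + 1) * |x - y| ^ δ = 2 * M * holderConst δ * |x - y| ^ δ +
      2 * M * holderConst δ / δ * |x - y| ^ δ + 2 * M * holderConst δ / δ * |x - y| ^ δ := by ring
    linarith

theorem norm_cauchyPow_two_le (hf : HolderC1 δ M f) (hδ0 : 0 < δ) (hδ1 : δ < 1) (x : ℝ) {s : ℝ}
    (hs : 0 < s) (hs1 : s ≤ 1) :
    ‖cauchyPow f 2 ⟨x, s⟩‖ ≤ M * Real.pi + 2 * M * holderConst δ / δ := by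
  have h1 := cauchyPow_two_vertical hf hδ0 hδ1 x hs hs1
  rw [Real.one_rpow, mul_one] at h1
  have h2 : ‖cauchyPow f 2 ⟨x, 1⟩‖ ≤ M * Real.pi := by
    have hi := (integrable_inv_sq_add_sq x one_pos).const_mul M
    refine (norm_integral_le_of_norm_le hi (Eventually.of_forall fun z => ?_)).trans_eq ?_
    · rw [norm_mul, Complex.norm_real, Real.norm_eq_abs, norm_pow, norm_cauchyKernel_sq]
      gcongr
      exact hf.abs_le z
    · rw [integral_const_mul, integral_inv_sq_add_sq x one_pos, div_one]
  have := norm_sub_norm_le (cauchyPow f 2 ⟨x, s⟩) (cauchyPow f 2 ⟨x, 1⟩)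
  rw [norm_sub_rev] at this
  linarith

theorem norm_cauchyPow_one_le {N : ℝ} (hf : HolderC1 δ M f) (hf2 : L2Le N f) (hN : 0 ≤ N)
    (hδ0 : 0 < δ) (hδ1 : δ < 1) (x : ℝ) {s : ℝ} (hs : 0 < s) (hs1 : s ≤ 1) :
    ‖cauchyPow f 1 ⟨x, s⟩‖ ≤ (N ^ 2 + Real.pi) + (M * Real.pi + 2 * M * holderConst δ / δ) := by
  have hM := hf.nonneg
  have hc := holderConst_nonneg δ
  have h1 : ‖cauchyPow f 1 ⟨x, 1⟩ - cauchyPow f 1 ⟨x, s⟩‖ ≤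
      (M * Real.pi + 2 * M * holderConst δ / δ) * ‖(1 : ℝ) - s‖ := by
    refine (convex_Icc s 1).norm_image_sub_le_of_norm_hasDerivWithin_le
      (f := fun r : ℝ => cauchyPow f 1 ⟨x, r⟩) (f' := fun r => cauchyPow f 2 ⟨x, r⟩ * Complex.I)
      (fun r hr => ((hasDerivAt_cauchyPow_one (w := ⟨x, r⟩) hf hf2.1 (hs.trans_le hr.1)).comp r
        (hasDerivAt_vertical x r)).hasDerivWithinAt) (fun r hr => ?_) ⟨le_rfl, hs1⟩ ⟨hs1, le_rfl⟩
    rw [norm_mul, Complex.norm_I, mul_one]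
    exact norm_cauchyPow_two_le hf hδ0 hδ1 x (hs.trans_le hr.1) hr.2
  have h2 : ‖cauchyPow f 1 ⟨x, 1⟩‖ ≤ N ^ 2 + Real.pi := by
    have hi := hf2.1.integrable_sq.add (integrable_inv_sq_add_sq x one_pos)
    refine (norm_integral_le_of_norm_le hi (Eventually.of_forall fun z => ?_)).trans ?_
    · rw [norm_mul, Complex.norm_real, Real.norm_eq_abs, pow_one]
      have := norm_cauchyKernel_sq ⟨x, 1⟩ z
      simp only [Pi.add_apply]
      rw [← this]
      nlinarith [sq_nonneg (|f z| - ‖cauchyKernel ⟨x, 1⟩ z‖), sq_abs (f z), sq_nonneg (f z),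
        sq_nonneg (‖cauchyKernel ⟨x, 1⟩ z‖)]
    · simp only [Pi.add_apply]
      rw [integral_add hf2.1.integrable_sq (integrable_inv_sq_add_sq x one_pos),
        integral_inv_sq_add_sq x one_pos, div_one]
      gcongr
      exact hf2.integral_sq_le hN
  have h3 : ‖(1 : ℝ) - s‖ ≤ 1 := by rw [Real.norm_eq_abs, _root_.abs_le]; constructor <;> linarith
  have h4 : (M * Real.pi + 2 * M * holderConst δ / δ) * ‖(1 : ℝ) - s‖ ≤
      (M * Real.pi + 2 * M * holderConst δ / δ) * 1 := by
    have := Real.pi_pos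
    gcongr
  have := norm_sub_norm_le (cauchyPow f 1 ⟨x, s⟩) (cauchyPow f 1 ⟨x, 1⟩)
  rw [norm_sub_rev] at this
  linarith

/-- The conjugate Poisson kernel is minus the real part of 1 / (z - w) at w = x + is, up to 1/π;
this transfers the estimates on Cauchy integrals to the regularized Hilbert transform. -/
theorem conjPoisson_eq_re (hf2 : MemLp f 2 volume) {s : ℝ} (hs : 0 < s) (x : ℝ) :
    conjPoisson s f x = -(1 / Real.pi) * (cauchyPow f 1 ⟨x, s⟩).re := by
  have hi := integrable_cauchyPow_one hf2 (w := ⟨x, s⟩) hs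
  have := integral_re hi
  simp only [RCLike.re_to_complex] at this
  rw [cauchyPow, ← this, conjPoisson, neg_mul, ← mul_neg, ← integral_neg]
  congr 2
  ext z
  rw [pow_one, Complex.re_ofReal_mul, cauchyKernel, Complex.inv_re, Complex.normSq_apply]
  simp only [Complex.sub_re, Complex.sub_im, Complex.ofReal_re, Complex.ofReal_im]
  rw [← mul_neg, ← neg_div]
  congr 2 <;> ring

/-- A bound for the `C^{1+δ}` norm of the Hilbert transform. -/
def hilbertBound (δ M : ℝ) : ℝ :=
  (M ^ 2 + Real.pi) + (M * Real.pi + 2 * M * holderConst δ / δ) +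
    2 * M * holderConst δ * (2 / δ + 1)

/-- The value, the derivative and its Hölder quotient are read off from the Cauchy integrals of
first and second order. The bound does not involve the height s, so it survives the limit s → 0. -/
theorem holderC1_conjPoisson (hf : HolderC1 δ M f) (hf2 : L2Le M f) (hδ0 : 0 < δ) (hδ1 : δ < 1)
    {s : ℝ} (hs : 0 < s) (hs1 : s ≤ 1) : HolderC1 δ (hilbertBound δ M) (conjPoisson s f) := by
  have hM := hf.nonneg
  have hc := holderConst_nonneg δ
  have hpi : |-(1 / Real.pi)| ≤ 1 := by
    rw [abs_neg, abs_of_pos (by positivity), div_le_one Real.pi_pos]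
    linarith [Real.pi_gt_three]
  have hmul : ∀ z : ℂ, |-(1 / Real.pi) * z.re| ≤ ‖z‖ := fun z => by
    rw [abs_mul]
    have := mul_le_mul hpi (Complex.abs_re_le_norm z) (abs_nonneg _) zero_le_one
    linarith
  have hfun : conjPoisson s f = fun x => -(1 / Real.pi) * (cauchyPow f 1 ⟨x, s⟩).re :=
    funext fun x => conjPoisson_eq_re hf2.1 hs x
  have hd : ∀ x, HasDerivAt (conjPoisson s f) (-(1 / Real.pi) * (cauchyPow f 2 ⟨x, s⟩).re) x := by
    intro x
    have h1 := (hasDerivAt_cauchyPow_one (w := ⟨x, s⟩) hf hf2.1 hs).comp x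
      (hasDerivAt_horizontal x s)
    rw [mul_one] at h1
    rw [hfun]
    exact ((Complex.reCLM.hasFDerivAt.comp_hasDerivAt x h1).const_mul _)
  have hd' : ∀ x, deriv (conjPoisson s f) x = -(1 / Real.pi) * (cauchyPow f 2 ⟨x, s⟩).re :=
    fun x => (hd x).deriv
  have hp1 : 0 ≤ M * Real.pi + 2 * M * holderConst δ / δ := by positivity
  have hp2 : 0 ≤ 2 * M * holderConst δ * (2 / δ + 1) := by positivity
  have hp3 : 0 ≤ M ^ 2 + Real.pi := by positivity
  refine ⟨fun x => (hd x).differentiableAt, fun x => ?_, fun x => ?_, fun x y => ?_⟩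
  · rw [hfun]
    refine (hmul _).trans ((norm_cauchyPow_one_le hf hf2 hM hδ0 hδ1 x hs hs1).trans ?_)
    rw [hilbertBound]; linarith
  · rw [hd']
    refine (hmul _).trans ((norm_cauchyPow_two_le hf hδ0 hδ1 x hs hs1).trans ?_)
    rw [hilbertBound]; linarith
  · rw [hd', hd', ← mul_sub, ← Complex.sub_re]
    refine (hmul _).trans ((cauchyPow_two_holder hf hδ0 hδ1 x y hs).trans ?_)
    gcongr
    rw [hilbertBound]; linarith

/-- The difference between the conjugate Poisson kernel and the truncated Hilbert kernel. -/
def kernelDiff (z : ℝ) : ℝ := z / (z ^ 2 + 1) - if 1 < |z| then z⁻¹ else 0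

theorem measurable_kernelDiff : Measurable kernelDiff := by
  unfold kernelDiff
  refine Measurable.sub (by fun_prop) (Measurable.ite ?_ (by fun_prop) (by fun_prop))
  exact measurableSet_lt (by fun_prop) (by fun_prop)

theorem abs_kernelDiff_le (z : ℝ) : |kernelDiff z| ≤ 2 * (1 + z ^ 2)⁻¹ := by
  unfold kernelDiff
  split_ifs with h
  · have hz : z ≠ 0 := by rintro rfl; norm_num at h
    have e : z / (z ^ 2 + 1) - z⁻¹ = - (z⁻¹ * (1 + z ^ 2)⁻¹) := by
      have : z ^ 2 + 1 ≠ 0 := by positivity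
      have : 1 + z ^ 2 ≠ 0 := by positivity
      field_simp; ring
    rw [e, abs_neg, abs_mul, abs_of_pos (a := (1 + z ^ 2)⁻¹) (by positivity), abs_inv]
    have : |z|⁻¹ ≤ 1 := inv_le_one_of_one_le₀ h.le
    gcongr
    linarith
  · rw [not_lt] at h
    rw [sub_zero, abs_div, abs_of_pos (a := z ^ 2 + 1) (by positivity), add_comm (z ^ 2),
      div_eq_mul_inv]
    gcongr
    linarith

theorem integrable_kernelDiff : Integrable kernelDiff :=
  Integrable.mono' (integrable_inv_one_add_sq.const_mul 2)
    measurable_kernelDiff.aestronglyMeasurable (Eventually.of_forall abs_kernelDiff_le)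

theorem integral_kernelDiff : ∫ z, kernelDiff z = 0 := by
  have h : ∀ z, kernelDiff (-z) = - kernelDiff z := by
    intro z
    unfold kernelDiff
    rw [abs_neg, neg_sq, inv_neg]
    split_ifs <;> ring
  have := integral_neg_eq_self kernelDiff volume
  simp only [h, integral_neg] at this
  linarith

/-- The conjugate Poisson integral at height s differs from the Hilbert integral truncated at s by a
convolution with the rescaled `kernelDiff`. That kernel is integrable with mean zero, so the
difference tends to f x · 0. -/
theorem tendsto_conjPoisson (hf : HolderC1 δ M f) (hf2 : MemLp f 2 volume) (x : ℝ) :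
    Tendsto (fun s => conjPoisson s f x) (𝓝[>] 0) (𝓝 (hilbertTransform f x)) := by
  have h1 := tendsto_truncatedHilbert hf2 hf.lipschitzWith x
  have h2 : Tendsto (fun s => (1 / Real.pi) * ∫ z, f (x - s * z) * kernelDiff z) (𝓝[>] 0)
      (𝓝 0) := by
    have : Tendsto (fun s => ∫ z, f (x - s * z) * kernelDiff z) (𝓝[>] 0)
        (𝓝 (∫ z, f x * kernelDiff z)) := by
      refine tendsto_integral_filter_of_dominated_convergence (fun z => M * |kernelDiff z|)
        (Eventually.of_forall fun s => ?_) (Eventually.of_forall fun s => Eventually.of_forall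
        fun z => ?_) (integrable_kernelDiff.norm.const_mul M) (Eventually.of_forall fun z => ?_)
      · have := hf.continuous
        exact ((by fun_prop : Continuous fun z => f (x - s * z)).measurable.mul
          measurable_kernelDiff).aestronglyMeasurable
      · rw [norm_mul, Real.norm_eq_abs, Real.norm_eq_abs]
        gcongr
        exact hf.abs_le _
      · refine Tendsto.mul_const _ ?_
        have hc := hf.continuous
        have : Continuous fun s => f (x - s * z) := by fun_prop
        have := this.tendsto 0
        rw [zero_mul, sub_zero] at this
        exact this.mono_left nhdsWithin_le_nhds
    rw [integral_const_mul, integral_kernelDiff, mul_zero] at this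
    simpa using this.const_mul (1 / Real.pi)
  have h3 := h1.add h2
  rw [add_zero] at h3
  refine h3.congr' ?_
  filter_upwards [self_mem_nhdsWithin] with s hs
  have hs : 0 < s := hs
  have hset : MeasurableSet {y : ℝ | s < |x - y|} := measurableSet_lt measurable_const (by fun_prop)
  have hint := integrableOn_truncatedHilbert hf2 x hs
  have e1 : ∫ z, f (x - s * z) * kernelDiff z = ∫ y, f y * (s⁻¹ * kernelDiff ((x - y) / s)) := by
    have h5 := integral_comp_affine (fun z => f (x - s * z) * kernelDiff z) 0 hs
    have h6 := integral_sub_left_eq_self (fun y => f y * (s⁻¹ * kernelDiff ((x - y) / s))) volume x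
    rw [← h6]
    have : ∀ z, f (x - z) * (s⁻¹ * kernelDiff ((x - (x - z)) / s)) =
        s⁻¹ * (f (x - s * ((z - 0) / s)) * kernelDiff ((z - 0) / s)) := by
      intro z
      rw [sub_zero, sub_sub_cancel, mul_div_cancel₀ _ hs.ne']; ring
    simp_rw [this]
    rw [integral_const_mul, h5]
    field_simp
  have hk : Integrable fun y => f y * (s⁻¹ * kernelDiff ((x - y) / s)) := by
    have h7 : Integrable fun y => s⁻¹ * kernelDiff ((x - y) / s) :=
      ((integrable_kernelDiff.comp_div hs.ne').comp_sub_left x).const_mul _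
    exact h7.bdd_mul (c := M) hf.continuous.aestronglyMeasurable
      (Eventually.of_forall hf.abs_le)
  rw [e1, truncatedHilbert, conjPoisson, ← mul_add, ← integral_indicator hset,
    ← integral_add ((integrable_indicator_iff hset).2 hint) hk]
  congr 2
  ext y
  have h8 : (1 < |(x - y) / s|) ↔ s < |x - y| := by
    rw [abs_div, abs_of_pos hs, one_lt_div hs]
  have h9 : (x - y) / s / (((x - y) / s) ^ 2 + 1) = s * ((x - y) / ((x - y) ^ 2 + s ^ 2)) := by
    have : (x - y) ^ 2 + s ^ 2 ≠ 0 := by positivity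
    have : ((x - y) / s) ^ 2 + 1 ≠ 0 := by positivity
    field_simp
  simp only [kernelDiff, h8, h9, indicator_apply, mem_ofPred_eq]
  split_ifs with h
  · have : x - y ≠ 0 := by
      intro h0; rw [h0, abs_zero] at h; linarith
    field_simp; ring
  · field_simp; ring

theorem holderC1_hilbertTransform (hf : HolderC1 δ M f) (hf2 : L2Le M f) (hδ0 : 0 < δ)
    (hδ1 : δ < 1) : HolderC1 δ (hilbertBound δ M) (hilbertTransform f) := by
  refine (HolderC1.of_tendsto (l := 𝓝[>] (0 : ℝ)) (F := fun s => conjPoisson s f) hδ0 ?_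
    (tendsto_conjPoisson hf hf2.1)).1
  filter_upwards [Ioc_mem_nhdsGT zero_lt_one] with s hs
  exact holderC1_conjPoisson hf hf2 hδ0 hδ1 hs.1 hs.2

theorem hilbertTransform_sub {δ' M' : ℝ} {g : ℝ → ℝ} (hf : HolderC1 δ M f)
    (hf2 : MemLp f 2 volume) (hg : HolderC1 δ' M' g) (hg2 : MemLp g 2 volume) (x : ℝ) :
    hilbertTransform (fun y => f y - g y) x = hilbertTransform f x - hilbertTransform g x := by
  have h1 := tendsto_truncatedHilbert hf2 hf.lipschitzWith x
  have h2 := tendsto_truncatedHilbert hg2 hg.lipschitzWith x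
  have h3 := tendsto_truncatedHilbert (hf2.sub hg2) (hf.lipschitzWith.sub hg.lipschitzWith) x
  refine tendsto_nhds_unique h3 ((h1.sub h2).congr' ?_)
  filter_upwards [self_mem_nhdsWithin] with ε hε
  rw [truncatedHilbert, truncatedHilbert, truncatedHilbert, ← mul_sub,
    ← integral_sub (integrableOn_truncatedHilbert hf2 x hε) (integrableOn_truncatedHilbert hg2 x hε)]
  simp only [Pi.sub_apply, sub_div]

end

/-! ### Conjugate Poisson integrals in L²: antisymmetry, composition, contraction. -/

section

/-- Cauchy–Schwarz. -/
theorem abs_integral_mul_le {f g : ℝ → ℝ} (hf : MemLp f 2 volume) (hg : MemLp g 2 volume) :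
    |∫ x, f x * g x| ≤ √(∫ x, f x ^ 2) * √(∫ x, g x ^ 2) := by
  have h1 : |∫ x, f x * g x| ≤ ∫ x, ‖f x‖ * ‖g x‖ := by
    refine (abs_integral_le_integral_abs).trans_eq ?_
    simp only [abs_mul, Real.norm_eq_abs]
  have h2 := integral_mul_norm_le_Lp_mul_Lq (μ := volume) (f := f) (g := g)
    Real.HolderConjugate.two_two (by simpa using hf) (by simpa using hg)
  refine h1.trans (h2.trans_eq ?_)
  rw [Real.sqrt_eq_rpow, Real.sqrt_eq_rpow]
  norm_num

theorem integrable_mul_of_memLp_two {f g : ℝ → ℝ} (hf : MemLp f 2 volume) (hg : MemLp g 2 volume) :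
    Integrable (fun x => f x * g x) :=
  hf.integrable_mul hg

theorem abs_mul_le_sq_add_sq (a b : ℝ) : |a * b| ≤ a ^ 2 + b ^ 2 := by
  rw [abs_le]; constructor <;> nlinarith [sq_nonneg (a - b), sq_nonneg (a + b), sq_nonneg a, sq_nonneg b]

/-- The conjugate Poisson kernel (without the factor `1/π`). -/
def conjKernel (ε z : ℝ) : ℝ := z / (z ^ 2 + ε ^ 2)

theorem continuous_conjKernel {ε : ℝ} (hε : 0 < ε) : Continuous (conjKernel ε) := by
  unfold conjKernel
  exact Continuous.div (by fun_prop) (by fun_prop) (fun z => by positivity)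

theorem conjKernel_sq_le {ε : ℝ} (hε : 0 < ε) (z : ℝ) :
    conjKernel ε z ^ 2 ≤ (z ^ 2 + ε ^ 2)⁻¹ := by
  have h : 0 < z ^ 2 + ε ^ 2 := by positivity
  rw [conjKernel, div_pow, inv_eq_one_div, div_le_div_iff₀ (by positivity) h]
  nlinarith [sq_nonneg ε, sq_nonneg z]

theorem integrable_inv_sq {ε : ℝ} (hε : 0 < ε) : Integrable fun z : ℝ => (z ^ 2 + ε ^ 2)⁻¹ := by
  simpa using integrable_inv_sq_add_sq 0 hε

theorem integral_inv_sq {ε : ℝ} (hε : 0 < ε) : ∫ z : ℝ, (z ^ 2 + ε ^ 2)⁻¹ = Real.pi / ε := by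
  simpa using integral_inv_sq_add_sq 0 hε

theorem memLp_conjKernel {ε : ℝ} (hε : 0 < ε) : MemLp (conjKernel ε) 2 volume := by
  rw [memLp_two_iff_integrable_sq (continuous_conjKernel hε).aestronglyMeasurable]
  refine (integrable_inv_sq hε).mono' ((continuous_conjKernel hε).pow 2).aestronglyMeasurable
    (Eventually.of_forall fun z => ?_)
  rw [Real.norm_eq_abs, abs_of_nonneg (sq_nonneg _)]
  exact conjKernel_sq_le hε z

theorem integral_conjKernel_sq_le {ε : ℝ} (hε : 0 < ε) :
    ∫ z, conjKernel ε z ^ 2 ≤ Real.pi / ε := by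
  rw [← integral_inv_sq hε]
  exact integral_mono (memLp_conjKernel hε).integrable_sq (integrable_inv_sq hε)
    (conjKernel_sq_le hε)

theorem memLp_conjKernel_sub {ε : ℝ} (hε : 0 < ε) (x : ℝ) :
    MemLp (fun y => conjKernel ε (x - y)) 2 volume :=
  (memLp_conjKernel hε).comp_measurePreserving (Measure.measurePreserving_sub_left volume x)

theorem conjPoisson_eq (ε : ℝ) (f : ℝ → ℝ) (x : ℝ) :
    conjPoisson ε f x = (1 / Real.pi) * ∫ y, f y * conjKernel ε (x - y) := rfl

/-- The quotient of the two arguments is 1 plus terms that vanish at infinity. This kills the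
boundary terms in the partial fraction computation below. -/
theorem tendsto_log_ratio {l : Filter ℝ} (hl : Tendsto (fun z : ℝ => |z|) l atTop) (a : ℝ)
    {ε η : ℝ} (hε : 0 < ε) (hη : 0 < η) :
    Tendsto (fun t => Real.log (t ^ 2 + ε ^ 2) - Real.log ((t - a) ^ 2 + η ^ 2)) l (𝓝 0) := by
  have h0 : Tendsto (fun t : ℝ => |t - a|⁻¹) l (𝓝 0) := by
    refine tendsto_inv_atTop_zero.comp (tendsto_atTop_mono (fun z => ?_)
      (tendsto_atTop_add_const_right _ (-|a|) hl))
    have := abs_sub_abs_le_abs_sub z a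
    linarith
  have hq : Tendsto (fun t : ℝ => conjKernel η (t - a)) l (𝓝 0) := by
    refine squeeze_zero_norm (fun t => ?_) h0
    rw [conjKernel, Real.norm_eq_abs, abs_div, abs_of_pos (a := (t - a) ^ 2 + η ^ 2) (by positivity)]
    rcases eq_or_ne (t - a) 0 with h | h
    · simp [h]
    · rw [div_le_iff₀ (by positivity), ← sq_abs (t - a), mul_add, sq, inv_mul_cancel_left₀ (abs_ne_zero.2 h)]
      have : 0 ≤ |t - a|⁻¹ * η ^ 2 := by positivity
      linarith
  have hr : Tendsto (fun t : ℝ => ((t - a) ^ 2 + η ^ 2)⁻¹) l (𝓝 0) := by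
    have h00 : Tendsto (fun t : ℝ => |t - a|⁻¹ ^ 2) l (𝓝 0) := by simpa using h0.pow 2
    have hev : ∀ᶠ t in l, |t - a|⁻¹ < 1 := h0.eventually (gt_mem_nhds zero_lt_one)
    have hev2 : ∀ᶠ t in l, 0 < |t| - |a| :=
      (tendsto_atTop_add_const_right _ (-|a|) hl).eventually (eventually_gt_atTop 0)
    refine squeeze_zero' (Eventually.of_forall fun t => by positivity) ?_ h00
    filter_upwards [hev2] with t ht
    have h1 : 0 < |t - a| := ht.trans_le (abs_sub_abs_le_abs_sub t a)
    rw [inv_pow, sq_abs]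
    have : 0 < (t - a) ^ 2 := by rw [← sq_abs]; positivity
    exact inv_anti₀ this (by nlinarith [sq_nonneg η])
  have h1 : Tendsto (fun t => 1 + 2 * a * conjKernel η (t - a) +
      (a ^ 2 + ε ^ 2 - η ^ 2) * ((t - a) ^ 2 + η ^ 2)⁻¹) l (𝓝 1) := by
    simpa using ((hq.const_mul (2 * a)).const_add 1).add (hr.const_mul (a ^ 2 + ε ^ 2 - η ^ 2))
  have h2 := (Real.continuousAt_log one_ne_zero).tendsto.comp h1
  rw [Real.log_one] at h2
  refine h2.congr fun t => ?_
  have e1 : t ^ 2 + ε ^ 2 ≠ 0 := by positivity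
  have e2 : (t - a) ^ 2 + η ^ 2 ≠ 0 := by positivity
  rw [← Real.log_div e1 e2, Function.comp, conjKernel]
  congr 1
  field_simp
  ring

theorem integral_conjKernel_mul {ε η a : ℝ} (hε : 0 < ε) (hη : 0 < η) (ha : a ≠ 0) :
    ∫ t, conjKernel ε t * conjKernel η (t - a) =
      Real.pi * ((ε + η) / (a ^ 2 + (ε + η) ^ 2)) := by
  have hsub : MemLp (fun t => conjKernel η (t - a)) 2 volume :=
    (memLp_conjKernel hη).comp_measurePreserving (measurePreserving_sub_right volume a)
  have hi : Integrable fun t => conjKernel ε t * conjKernel η (t - a) :=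
    (memLp_conjKernel hε).integrable_mul hsub
  -- Partial fractions: β and γ are the coefficients of the two Poisson-type terms, and α multiplies
  -- a difference of logarithmic derivatives, which integrates to zero. The condition a ≠ 0 keeps D
  -- away from zero when ε = η.
  set D := (a ^ 2 + (ε + η) ^ 2) * (a ^ 2 + (ε - η) ^ 2) with hD
  have hD0 : D ≠ 0 := by positivity
  set α := -a * (a ^ 2 + η ^ 2 + ε ^ 2) / (2 * D) with hα
  set β := ε ^ 2 * (a ^ 2 - η ^ 2 + ε ^ 2) / D with hβ
  set γ := η ^ 2 * (a ^ 2 - ε ^ 2 + η ^ 2) / D with hγ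
  have hr1 := (integrable_inv_sq hε).const_mul β
  have hr2 := (integrable_inv_sq_add_sq a hη).const_mul γ
  have key : ∀ t, conjKernel ε t * conjKernel η (t - a) - β * (t ^ 2 + ε ^ 2)⁻¹ -
      γ * ((t - a) ^ 2 + η ^ 2)⁻¹ =
      α * (2 * t / (t ^ 2 + ε ^ 2) - 2 * (t - a) / ((t - a) ^ 2 + η ^ 2)) := by
    intro t
    have e1 : t ^ 2 + ε ^ 2 ≠ 0 := by positivity
    have e2 : (t - a) ^ 2 + η ^ 2 ≠ 0 := by positivity
    rw [conjKernel, conjKernel, hα, hβ, hγ]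
    field_simp
    rw [hD]
    ring
  have hi2 : Integrable fun t => conjKernel ε t * conjKernel η (t - a) - β * (t ^ 2 + ε ^ 2)⁻¹ :=
    hi.sub hr1
  have hi3 : Integrable fun t => conjKernel ε t * conjKernel η (t - a) - β * (t ^ 2 + ε ^ 2)⁻¹ -
      γ * ((t - a) ^ 2 + η ^ 2)⁻¹ := hi2.sub hr2
  have h0 : ∫ t, (conjKernel ε t * conjKernel η (t - a) - β * (t ^ 2 + ε ^ 2)⁻¹ -
      γ * ((t - a) ^ 2 + η ^ 2)⁻¹) = 0 := by
    have hd : ∀ t, HasDerivAt (fun t => α * (Real.log (t ^ 2 + ε ^ 2) - Real.log ((t - a) ^ 2 + η ^ 2)))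
        (conjKernel ε t * conjKernel η (t - a) - β * (t ^ 2 + ε ^ 2)⁻¹ -
          γ * ((t - a) ^ 2 + η ^ 2)⁻¹) t := by
      intro t
      have e1 : t ^ 2 + ε ^ 2 ≠ 0 := by positivity
      have e2 : (t - a) ^ 2 + η ^ 2 ≠ 0 := by positivity
      rw [key t]
      have d1 : HasDerivAt (fun t : ℝ => t ^ 2 + ε ^ 2) (2 * t) t := by
        simpa using (hasDerivAt_pow 2 t).add_const (ε ^ 2)
      have d2 : HasDerivAt (fun t : ℝ => (t - a) ^ 2 + η ^ 2) (2 * (t - a)) t := by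
        simpa using (((hasDerivAt_id t).sub_const a).pow 2).add_const (η ^ 2)
      exact ((d1.log e1).sub (d2.log e2)).const_mul α
    have := integral_of_hasDerivAt_of_tendsto hd hi3
      ((tendsto_log_ratio tendsto_abs_atBot_atTop a hε hη).const_mul α)
      ((tendsto_log_ratio tendsto_abs_atTop_atTop a hε hη).const_mul α)
    simpa using this
  rw [integral_sub hi2 hr2, integral_sub hi hr1, integral_const_mul, integral_const_mul,
    integral_inv_sq hε, integral_inv_sq_add_sq a hη] at h0
  have h1 : ∫ t, conjKernel ε t * conjKernel η (t - a) = β * (Real.pi / ε) + γ * (Real.pi / η) := by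
    linarith
  rw [h1, hβ, hγ]
  have e3 : a ^ 2 + (ε + η) ^ 2 ≠ 0 := by positivity
  field_simp
  rw [hD]
  ring

theorem integral_conjKernel_conv {ε η x y : ℝ} (hε : 0 < ε) (hη : 0 < η) (hxy : x ≠ y) :
    ∫ z, conjKernel η (z - y) * conjKernel ε (x - z) =
      -(Real.pi * ((ε + η) / ((x - y) ^ 2 + (ε + η) ^ 2))) := by
  rw [← integral_conjKernel_mul hε hη (sub_ne_zero.2 hxy), ← integral_neg,
    ← integral_sub_left_eq_self _ volume x]
  congr 1
  ext t
  have : x - t - y = -(t - (x - y)) := by ring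
  rw [this, sub_sub_cancel, conjKernel, conjKernel, conjKernel, neg_sq, neg_div]
  ring

/-- Convolution with the Poisson kernel at height `s`. -/
def poissonInt (s : ℝ) (f : ℝ → ℝ) (x : ℝ) : ℝ :=
  (1 / Real.pi) * ∫ y, f y * (s / ((x - y) ^ 2 + s ^ 2))

theorem integrable_prod_conv {f : ℝ → ℝ} (hf : Integrable f) {g : ℝ → ℝ} (hg : Integrable g) :
    Integrable (fun p : ℝ × ℝ => f p.2 * g (p.1 - p.2)) (volume.prod volume) :=
  hf.convolution_integrand (ContinuousLinearMap.mul ℝ ℝ) hg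

/-- The kernel is square integrable but not integrable, so Fubini is justified by |K g| ≤ K² + g²:
the term f K² is a convolution of integrable functions and f g² is a product of functions of
separate variables. -/
theorem integrable_prod_conv_kernel {f g : ℝ → ℝ} (hf : Integrable f) (hg : MemLp g 2 volume)
    {ε : ℝ} (hε : 0 < ε) :
    Integrable (fun p : ℝ × ℝ => f p.2 * conjKernel ε (p.1 - p.2) * g p.1)
      (volume.prod volume) := by
  have h1 := integrable_prod_conv hf.norm (integrable_inv_sq hε)
  have h2 : Integrable (fun p : ℝ × ℝ => g p.1 ^ 2 * ‖f p.2‖) (volume.prod volume) :=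
    hg.integrable_sq.mul_prod hf.norm
  refine (h1.add h2).mono' ?_ (Eventually.of_forall fun p => ?_)
  · refine (hf.1.comp_snd.mul ?_).mul hg.1.comp_fst
    exact ((continuous_conjKernel hε).comp (by fun_prop)).aestronglyMeasurable
  · simp only [Pi.add_apply, norm_mul]
    have h3 := abs_mul_le_sq_add_sq (conjKernel ε (p.1 - p.2)) (g p.1)
    have h4 := conjKernel_sq_le hε (p.1 - p.2)
    rw [mul_assoc, ← norm_mul, mul_comm (g p.1 ^ 2), ← mul_add, Real.norm_eq_abs (_ * _)]
    gcongr
    linarith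

/-- A regularized H² = -1. After Fubini it is the convolution identity for the kernels; that
identity was proved off the diagonal only, and a single point y = x is negligible. -/
theorem conjPoisson_conjPoisson {f : ℝ → ℝ} (hf : Integrable f) {ε η : ℝ} (hε : 0 < ε)
    (hη : 0 < η) (x : ℝ) :
    conjPoisson ε (conjPoisson η f) x = -poissonInt (ε + η) f x := by
  have hint := integrable_prod_conv_kernel hf (memLp_conjKernel_sub hε x) hη
  have hswap := integral_integral_swap
    (f := fun z y => f y * conjKernel η (z - y) * conjKernel ε (x - z)) hint
  rw [conjPoisson_eq, poissonInt]
  have e1 : ∀ z, conjPoisson η f z * conjKernel ε (x - z) =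
      (1 / Real.pi) * ∫ y, f y * conjKernel η (z - y) * conjKernel ε (x - z) := by
    intro z
    rw [conjPoisson_eq, integral_mul_const, mul_assoc]
  simp_rw [e1]
  rw [integral_const_mul, hswap, ← mul_neg]
  congr 1
  rw [← integral_neg, ← integral_const_mul]
  refine integral_congr_ae ?_
  filter_upwards [compl_mem_ae_iff.2 (measure_singleton x)] with y hy
  have hy : x ≠ y := fun h => hy h.symm
  simp_rw [mul_assoc]
  rw [integral_const_mul, integral_conjKernel_conv hε hη hy]
  have := Real.pi_pos
  field_simp

theorem integral_mul_conjPoisson {f g : ℝ → ℝ} (hf : Integrable f) (hg : MemLp g 2 volume)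
    {ε : ℝ} (hε : 0 < ε) :
    ∫ x, g x * conjPoisson ε f x = -∫ y, f y * conjPoisson ε g y := by
  have hswap := integral_integral_swap
    (f := fun x y => f y * conjKernel ε (x - y) * g x) (integrable_prod_conv_kernel hf hg hε)
  have e1 : ∀ x, g x * conjPoisson ε f x =
      (1 / Real.pi) * ∫ y, f y * conjKernel ε (x - y) * g x := by
    intro x
    rw [conjPoisson_eq, integral_mul_const]; ring
  have e2 : ∀ y, f y * conjPoisson ε g y =
      -((1 / Real.pi) * ∫ x, f y * conjKernel ε (x - y) * g x) := by
    intro y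
    have : ∀ x, f y * conjKernel ε (x - y) * g x = -(f y * (g x * conjKernel ε (y - x))) := by
      intro x
      rw [conjKernel, conjKernel, ← neg_sub y x, neg_sq, neg_div]; ring
    simp_rw [this]
    rw [conjPoisson_eq, integral_neg, integral_const_mul]; ring
  simp_rw [e1, e2]
  rw [integral_neg, neg_neg, integral_const_mul, integral_const_mul, hswap]

theorem aestronglyMeasurable_conjPoisson_of_integrable {f : ℝ → ℝ} (hf : Integrable f) {ε : ℝ} (hε : 0 < ε) :
    AEStronglyMeasurable (conjPoisson ε f) volume := by
  have hm : AEStronglyMeasurable (fun p : ℝ × ℝ => f p.2 * conjKernel ε (p.1 - p.2))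
      (volume.prod volume) :=
    hf.1.comp_snd.mul ((continuous_conjKernel hε).comp (by fun_prop)).aestronglyMeasurable
  exact hm.integral_prod_right'.const_mul _

/-- Young's inequality for L¹ against L²: Cauchy–Schwarz with weight |f| gives |f * K|² ≤ ‖f‖₁ (|f|
* K²), and K² has an integrable majorant. -/
theorem memLp_conjPoisson_of_integrable {f : ℝ → ℝ} (hf : Integrable f) {ε : ℝ} (hε : 0 < ε) :
    MemLp (conjPoisson ε f) 2 volume := by
  have hm := aestronglyMeasurable_conjPoisson_of_integrable hf hε
  rw [memLp_two_iff_integrable_sq hm]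
  have h1 := integrable_prod_conv hf.norm (integrable_inv_sq hε)
  have h2 := h1.integral_prod_left
  have hs : MemLp (fun y => √‖f y‖) 2 volume := by
    rw [memLp_two_iff_integrable_sq (Real.continuous_sqrt.comp_aestronglyMeasurable hf.1.norm)]
    simpa [Real.sq_sqrt] using hf.norm
  have h4 := (h2.const_mul ((1 / Real.pi) ^ 2 * ∫ y, ‖f y‖))
  refine h4.mono' (hm.pow 2) ?_
  filter_upwards [h1.prod_right_ae] with x hx
  rw [Real.norm_eq_abs, abs_of_nonneg (sq_nonneg _), conjPoisson_eq, mul_pow, mul_assoc]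
  gcongr
  have hx2 : Integrable fun y => ‖f y‖ * conjKernel ε (x - y) ^ 2 := by
    refine hx.mono' ?_ (Eventually.of_forall fun y => ?_)
    · exact hf.1.norm.mul (((continuous_conjKernel hε).comp (by fun_prop)).pow 2).aestronglyMeasurable
    · rw [norm_mul, norm_norm, Real.norm_eq_abs (_ ^ 2), abs_of_nonneg (sq_nonneg _)]
      gcongr
      exact conjKernel_sq_le hε _
  have hg : MemLp (fun y => √‖f y‖ * |conjKernel ε (x - y)|) 2 volume := by
    rw [memLp_two_iff_integrable_sq]
    · refine hx2.congr (Eventually.of_forall fun y => ?_)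
      simp only [mul_pow, sq_abs]; rw [Real.sq_sqrt (norm_nonneg _)]
    · exact hs.1.mul (((continuous_conjKernel hε).comp (by fun_prop)).abs).aestronglyMeasurable
  have hcs := abs_integral_mul_le hs hg
  have e1 : ∀ y, √‖f y‖ * (√‖f y‖ * |conjKernel ε (x - y)|) = ‖f y * conjKernel ε (x - y)‖ := by
    intro y
    rw [← mul_assoc, Real.mul_self_sqrt (norm_nonneg _), norm_mul, Real.norm_eq_abs (conjKernel _ _)]
  have e2 : ∀ y, (√‖f y‖ * |conjKernel ε (x - y)|) ^ 2 = ‖f y‖ * conjKernel ε (x - y) ^ 2 := by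
    intro y
    rw [mul_pow, Real.sq_sqrt (norm_nonneg _), sq_abs]
  simp_rw [e1, e2, Real.sq_sqrt (norm_nonneg _)] at hcs
  rw [abs_of_nonneg (integral_nonneg fun y => norm_nonneg _)] at hcs
  have h5 : |∫ y, f y * conjKernel ε (x - y)| ≤ ∫ y, ‖f y * conjKernel ε (x - y)‖ :=
    norm_integral_le_integral_norm (fun y => f y * conjKernel ε (x - y))
  have h6 := h5.trans hcs
  calc (∫ y, f y * conjKernel ε (x - y)) ^ 2 = |∫ y, f y * conjKernel ε (x - y)| ^ 2 := (sq_abs _).symm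
    _ ≤ (√(∫ y, ‖f y‖) * √(∫ y, ‖f y‖ * conjKernel ε (x - y) ^ 2)) ^ 2 := by gcongr
    _ = (∫ y, ‖f y‖) * ∫ y, ‖f y‖ * conjKernel ε (x - y) ^ 2 := by
      rw [mul_pow, Real.sq_sqrt (integral_nonneg fun y => norm_nonneg _),
        Real.sq_sqrt (integral_nonneg fun y => by positivity)]
    _ ≤ (∫ y, ‖f y‖) * ∫ y, ‖f y‖ * ((x - y) ^ 2 + ε ^ 2)⁻¹ := by
      refine mul_le_mul_of_nonneg_left (integral_mono hx2 hx fun y => ?_)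
        (integral_nonneg fun y => norm_nonneg _)
      exact mul_le_mul_of_nonneg_left (conjKernel_sq_le hε _) (norm_nonneg _)

theorem integrable_poissonKernel {s : ℝ} (hs : 0 < s) :
    Integrable fun z : ℝ => s / (z ^ 2 + s ^ 2) := by
  simpa [div_eq_mul_inv] using (integrable_inv_sq hs).const_mul s

theorem integral_poissonKernel {s : ℝ} (hs : 0 < s) : ∫ z : ℝ, s / (z ^ 2 + s ^ 2) = Real.pi := by
  simp_rw [div_eq_mul_inv]
  rw [integral_const_mul, integral_inv_sq hs, mul_div_cancel₀ _ hs.ne']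

/-- Apply f(x) f(y) ≤ (f(x)² + f(y)²) / 2 under the double integral; the Poisson kernel has total
mass π in either variable. -/
theorem integral_mul_poissonInt_le {f : ℝ → ℝ} (hf2 : MemLp f 2 volume)
    {s : ℝ} (hs : 0 < s) : ∫ x, f x * poissonInt s f x ≤ ∫ x, f x ^ 2 := by
  have hp := integrable_poissonKernel hs
  have hc := integrable_prod_conv hf2.integrable_sq hp
  have hswap := integral_integral_swap (f := fun x y => f y ^ 2 * (s / ((x - y) ^ 2 + s ^ 2))) hc
  have hp1 : ∀ y, ∫ x, s / ((x - y) ^ 2 + s ^ 2) = Real.pi := fun y => by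
    rw [integral_sub_right_eq_self (fun z => s / (z ^ 2 + s ^ 2)) y, integral_poissonKernel hs]
  have hp2 : ∀ x, ∫ y, s / ((x - y) ^ 2 + s ^ 2) = Real.pi := fun y => by
    rw [integral_sub_left_eq_self (fun z => s / (z ^ 2 + s ^ 2)) volume y, integral_poissonKernel hs]
  simp_rw [integral_const_mul, hp1] at hswap
  rw [integral_mul_const] at hswap
  have hi : Integrable fun x => ∫ y, f y ^ 2 * (s / ((x - y) ^ 2 + s ^ 2)) := hc.integral_prod_left
  have hle : ∀ᵐ x, f x * poissonInt s f x ≤ f x ^ 2 / 2 +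
      (1 / (2 * Real.pi)) * ∫ y, f y ^ 2 * (s / ((x - y) ^ 2 + s ^ 2)) := by
    filter_upwards [hc.prod_right_ae] with x hx
    have hpx : Integrable fun y => s / ((x - y) ^ 2 + s ^ 2) := hp.comp_sub_left x
    have h1 : Integrable fun y => f x * (f y * (s / ((x - y) ^ 2 + s ^ 2))) := by
      refine ((hpx.const_mul (f x ^ 2)).add hx).mono' ?_ (Eventually.of_forall fun y => ?_)
      · exact (hf2.1.mul hpx.1).const_mul _
      · have h0 : 0 ≤ s / ((x - y) ^ 2 + s ^ 2) := by positivity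
        rw [← mul_assoc, norm_mul, Real.norm_eq_abs, Real.norm_eq_abs, abs_of_nonneg h0]
        simp only [Pi.add_apply, ← add_mul]
        exact mul_le_mul_of_nonneg_right (abs_mul_le_sq_add_sq _ _) h0
    have h2 : f x * ∫ y, f y * (s / ((x - y) ^ 2 + s ^ 2)) ≤
        ∫ y, ((f x ^ 2 / 2) * (s / ((x - y) ^ 2 + s ^ 2)) +
          (1 / 2) * (f y ^ 2 * (s / ((x - y) ^ 2 + s ^ 2)))) := by
      rw [← integral_const_mul]
      refine integral_mono h1 ((hpx.const_mul _).add (hx.const_mul _)) fun y => ?_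
      have h0 : 0 ≤ s / ((x - y) ^ 2 + s ^ 2) := by positivity
      have : f x * f y ≤ f x ^ 2 / 2 + 1 / 2 * f y ^ 2 := by nlinarith [sq_nonneg (f x - f y)]
      have := mul_le_mul_of_nonneg_right this h0
      linarith
    rw [integral_add (hpx.const_mul _) (hx.const_mul _), integral_const_mul, integral_const_mul,
      hp2] at h2
    rw [poissonInt]
    have hpi := Real.pi_pos
    have h3 := mul_le_mul_of_nonneg_left h2 (by positivity : 0 ≤ 1 / Real.pi)
    have e : 1 / Real.pi * (f x ^ 2 / 2 * Real.pi +
      1 / 2 * ∫ y, f y ^ 2 * (s / ((x - y) ^ 2 + s ^ 2))) = f x ^ 2 / 2 +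
      (1 / (2 * Real.pi)) * ∫ y, f y ^ 2 * (s / ((x - y) ^ 2 + s ^ 2)) := by
      generalize ∫ y, f y ^ 2 * (s / ((x - y) ^ 2 + s ^ 2)) = A
      field_simp
    rw [e] at h3
    linarith
  -- If the product were not integrable, its integral would be 0 by convention and the inequality
  -- trivial, so integrability need not be proved.
  by_cases hint : Integrable fun x => f x * poissonInt s f x
  · refine (integral_mono_ae hint ((hf2.integrable_sq.div_const 2).add (hi.const_mul _)) hle).trans_eq ?_
    simp only [Pi.add_apply]
    rw [integral_add (hf2.integrable_sq.div_const 2) (hi.const_mul _), integral_const_mul, hswap,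
      integral_div]
    have := Real.pi_pos
    field_simp; ring
  · rw [integral_undef hint]
    exact integral_nonneg fun x => sq_nonneg _

/-- With Q for the conjugate Poisson operator, antisymmetry and composition give ∫ (Qf)² = -∫ f
Q(Qf), which is the pairing of f with its Poisson integral at height 2ε. -/
theorem integral_conjPoisson_sq_le {f : ℝ → ℝ} (hf : Integrable f) (hf2 : MemLp f 2 volume)
    {ε : ℝ} (hε : 0 < ε) : ∫ x, conjPoisson ε f x ^ 2 ≤ ∫ x, f x ^ 2 := by
  have h := integral_mul_conjPoisson hf (memLp_conjPoisson_of_integrable hf hε) hε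
  simp_rw [conjPoisson_conjPoisson hf hε hε, mul_neg] at h
  rw [integral_neg, neg_neg] at h
  simp_rw [sq (conjPoisson ε f _)]
  rw [h]
  exact integral_mul_poissonInt_le hf2 (by positivity)

end

/-! ### Passage to L² data and to the limit: antisymmetry of H and H² = -1. -/

section

variable {δ M N : ℝ} {f g : ℝ → ℝ}

/-- Truncation to the interval `[-n, n]`. -/
def truncation (f : ℝ → ℝ) (n : ℕ) : ℝ → ℝ := (Icc (-(n : ℝ)) n).indicator f

theorem abs_truncation_le (f : ℝ → ℝ) (n : ℕ) (x : ℝ) : |truncation f n x| ≤ |f x| := by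
  rw [truncation, indicator_apply]; split_ifs <;> simp

theorem tendsto_truncation (f : ℝ → ℝ) (x : ℝ) :
    Tendsto (fun n => truncation f n x) atTop (𝓝 (f x)) := by
  refine tendsto_const_nhds.congr' ?_
  obtain ⟨n, hn⟩ := exists_nat_ge |x|
  filter_upwards [eventually_ge_atTop n] with m hm
  have : |x| ≤ m := hn.trans (by exact_mod_cast hm)
  rw [truncation, indicator_of_mem (mem_Icc.2 (abs_le.1 this))]

theorem memLp_truncation (hf : MemLp f 2 volume) (n : ℕ) : MemLp (truncation f n) 2 volume :=
  hf.indicator measurableSet_Icc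

theorem l2Le_truncation (hf : L2Le N f) (n : ℕ) : L2Le N (truncation f n) :=
  hf.of_abs_le (memLp_truncation hf.1 n).1 (abs_truncation_le f n)

theorem integrable_truncation (hf : MemLp f 2 volume) (n : ℕ) : Integrable (truncation f n) := by
  rw [truncation, integrable_indicator_iff measurableSet_Icc]
  exact (hf.restrict _).integrable (by norm_num)

theorem tendsto_integral_sq_truncation (hg : MemLp g 2 volume) :
    Tendsto (fun n => ∫ x, (g x - truncation g n x) ^ 2) atTop (𝓝 0) := by
  have : Tendsto (fun n => ∫ x, (g x - truncation g n x) ^ 2) atTop (𝓝 (∫ _x : ℝ, (0 : ℝ))) := by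
    refine tendsto_integral_of_dominated_convergence (fun x => g x ^ 2) (fun n => ?_)
      hg.integrable_sq (fun n => Eventually.of_forall fun x => ?_) (Eventually.of_forall fun x => ?_)
    · exact (hg.1.sub (memLp_truncation hg n).1).pow 2
    · rw [Real.norm_eq_abs, abs_of_nonneg (sq_nonneg _), truncation, indicator_apply]
      split_ifs
      · simpa using sq_nonneg (g x)
      · simp
    · simpa using ((tendsto_truncation g x).const_sub (g x)).pow 2
  simpa using this

theorem tendsto_integral_truncation_mul (hf : MemLp f 2 volume) (hg : MemLp g 2 volume) :
    Tendsto (fun n => ∫ x, truncation f n x * g x) atTop (𝓝 (∫ x, f x * g x)) := by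
  refine tendsto_integral_of_dominated_convergence (fun x => |f x| * |g x|)
    (fun n => (memLp_truncation hf n).1.mul hg.1)
    (integrable_mul_of_memLp_two hf.norm hg.norm)
    (fun n => Eventually.of_forall fun y => ?_)
    (Eventually.of_forall fun y => (tendsto_truncation f y).mul_const _)
  simp only [norm_mul, Real.norm_eq_abs]
  exact mul_le_mul_of_nonneg_right (abs_truncation_le f n y) (abs_nonneg _)

/-- A pointwise limit of functions bounded in `L²` and in `L^∞` is a weak limit. -/
theorem tendsto_integral_mul {ι : Type*} {l : Filter ι} [l.NeBot] [l.IsCountablyGenerated] {B : ℝ}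
    {φ : ι → ℝ → ℝ} {ψ : ℝ → ℝ} (hg : MemLp g 2 volume) (hN : 0 ≤ N)
    (hφ : ∀ᶠ i in l, L2Le N (φ i)) (hB : ∀ᶠ i in l, ∀ x, |φ i x| ≤ B)
    (hlim : ∀ x, Tendsto (fun i => φ i x) l (𝓝 (ψ x))) :
    Tendsto (fun i => ∫ x, g x * φ i x) l (𝓝 (∫ x, g x * ψ x)) := by
  have hψ : L2Le N ψ := L2Le.of_tendsto hφ hlim
  have hψB : ∀ x, |ψ x| ≤ B := fun x => le_of_tendsto (hlim x).abs (hB.mono fun i hi => hi x)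
  rw [Metric.tendsto_nhds]
  intro ε hε
  -- Split g into a truncation and a tail. The tail is small in L² and pairs with differences of
  -- norm at most 2N; against the truncation, which is integrable, the bound B allows dominated
  -- convergence.
  have hsq : Tendsto (fun n => √(∫ x, (g x - truncation g n x) ^ 2) * (2 * N)) atTop (𝓝 0) := by
    simpa using (tendsto_integral_sq_truncation hg).sqrt.mul_const (2 * N)
  obtain ⟨n, hn⟩ := (hsq.eventually (gt_mem_nhds (show (0 : ℝ) < ε / 2 by positivity))).exists
  have h1 : Tendsto (fun i => ∫ x, truncation g n x * (φ i x - ψ x)) l (𝓝 (∫ _x : ℝ, (0 : ℝ))) := by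
    refine tendsto_integral_filter_of_dominated_convergence (fun x => |truncation g n x| * (B + B)) ?_ ?_
      ((integrable_truncation hg n).norm.mul_const _) (Eventually.of_forall fun x => ?_)
    · filter_upwards [hφ] with i hi
      exact (memLp_truncation hg n).1.mul (hi.1.1.sub hψ.1.1)
    · filter_upwards [hB] with i hi
      refine Eventually.of_forall fun x => ?_
      rw [norm_mul, Real.norm_eq_abs, Real.norm_eq_abs]
      gcongr
      exact (abs_sub _ _).trans (add_le_add (hi x) (hψB x))
    · simpa using ((hlim x).sub_const (ψ x)).const_mul (truncation g n x)
  rw [integral_zero] at h1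
  filter_upwards [hφ, (Metric.tendsto_nhds.1 h1) (ε / 2) (by positivity)] with i hi h2
  have hsub := hi.sub hψ hN hN
  have hgt : MemLp (fun x => g x - truncation g n x) 2 volume := hg.sub (memLp_truncation hg n)
  have e : (∫ x, g x * φ i x) - ∫ x, g x * ψ x =
      (∫ x, truncation g n x * (φ i x - ψ x)) + ∫ x, (g x - truncation g n x) * (φ i x - ψ x) := by
    rw [← integral_sub (integrable_mul_of_memLp_two hg hi.1) (integrable_mul_of_memLp_two hg hψ.1),
      ← integral_add (integrable_mul_of_memLp_two (memLp_truncation hg n) hsub.1)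
        (integrable_mul_of_memLp_two hgt hsub.1)]
    congr 1; ext x; ring
  have h3 := abs_integral_mul_le hgt hsub.1
  have h4 : √(∫ x, (φ i x - ψ x) ^ 2) ≤ 2 * N := by
    rw [Real.sqrt_le_left (by positivity)]
    have := hsub.integral_sq_le (by positivity)
    rwa [← two_mul] at this
  have h5 := h3.trans (mul_le_mul_of_nonneg_left h4 (Real.sqrt_nonneg _))
  rw [Real.dist_eq, sub_zero] at h2
  rw [Real.dist_eq, e]
  exact (abs_add_le _ _).trans_lt (by linarith)

theorem abs_conjPoisson_le (hf : L2Le N f) (hN : 0 ≤ N) {ε : ℝ} (hε : 0 < ε) (x : ℝ) :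
    |conjPoisson ε f x| ≤ (1 / Real.pi) * (N * √(Real.pi / ε)) := by
  have hpi := Real.pi_pos
  rw [conjPoisson_eq, abs_mul, abs_of_pos (a := 1 / Real.pi) (by positivity)]
  refine mul_le_mul_of_nonneg_left ?_ (by positivity)
  refine (abs_integral_mul_le hf.1 (memLp_conjKernel_sub hε x)).trans ?_
  rw [integral_sub_left_eq_self (fun z => conjKernel ε z ^ 2) volume x]
  gcongr
  · exact (Real.sqrt_le_left hN).2 (hf.integral_sq_le hN)
  · exact integral_conjKernel_sq_le hε

theorem tendsto_conjPoisson_truncation (hf : MemLp f 2 volume) {ε : ℝ} (hε : 0 < ε) (x : ℝ) :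
    Tendsto (fun n => conjPoisson ε (truncation f n) x) atTop (𝓝 (conjPoisson ε f x)) := by
  simp_rw [conjPoisson_eq]
  exact (tendsto_integral_truncation_mul hf (memLp_conjKernel_sub hε x)).const_mul _

theorem l2Le_conjPoisson_truncation (hf : L2Le N f) (hN : 0 ≤ N) {ε : ℝ} (hε : 0 < ε) (n : ℕ) :
    L2Le N (conjPoisson ε (truncation f n)) := by
  have hi := integrable_truncation hf.1 n
  exact l2Le_of_integral_sq_le (memLp_conjPoisson_of_integrable hi hε) hN
    ((integral_conjPoisson_sq_le hi (memLp_truncation hf.1 n) hε).trans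
      ((l2Le_truncation hf n).integral_sq_le hN))

theorem l2Le_conjPoisson (hf : L2Le N f) (hN : 0 ≤ N) {ε : ℝ} (hε : 0 < ε) :
    L2Le N (conjPoisson ε f) :=
  L2Le.of_tendsto (Eventually.of_forall fun n => l2Le_conjPoisson_truncation hf hN hε n)
    (tendsto_conjPoisson_truncation hf.1 hε)

theorem l2Le_self (hf : MemLp f 2 volume) : L2Le (eLpNorm f 2 volume).toReal f :=
  ⟨hf, (ENNReal.ofReal_toReal hf.2.ne).ge⟩

/-- Antisymmetry is known when one factor is integrable, so truncate only one: ∫ f Q(f_n) = -∫ f_n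
Q(f). Both sides converge and the limit equals its own negative. -/
theorem integral_mul_conjPoisson_self (hf : MemLp f 2 volume) {ε : ℝ} (hε : 0 < ε) :
    ∫ x, f x * conjPoisson ε f x = 0 := by
  have hf' := l2Le_self hf
  have h0 : 0 ≤ (eLpNorm f 2 volume).toReal := ENNReal.toReal_nonneg
  have h1 := tendsto_integral_mul hf h0
    (Eventually.of_forall fun n => l2Le_conjPoisson_truncation hf' h0 hε n)
    (Eventually.of_forall fun n x => abs_conjPoisson_le (l2Le_truncation hf' n) h0 hε x)
    (tendsto_conjPoisson_truncation hf hε)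
  have hQ := (l2Le_conjPoisson hf' h0 hε).1
  have h2 := tendsto_integral_truncation_mul hf hQ
  have h3 : ∀ n, ∫ x, f x * conjPoisson ε (truncation f n) x =
      -∫ x, truncation f n x * conjPoisson ε f x := fun n =>
    integral_mul_conjPoisson (integrable_truncation hf n) hf hε
  simp_rw [h3] at h1
  have := tendsto_nhds_unique h1 h2.neg
  linarith

theorem l2Le_hilbertTransform (hf : HolderC1 δ M f) (hf2 : L2Le N f) (hN : 0 ≤ N) :
    L2Le N (hilbertTransform f) := by
  refine L2Le.of_tendsto (l := 𝓝[>] (0 : ℝ)) ?_ (tendsto_conjPoisson hf hf2.1)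
  filter_upwards [self_mem_nhdsWithin] with ε hε using l2Le_conjPoisson hf2 hN hε

theorem tendsto_integral_mul_conjPoisson (hf : HolderC1 δ M f) (hf2 : MemLp f 2 volume)
    (hδ0 : 0 < δ) (hδ1 : δ < 1) (hg : MemLp g 2 volume) :
    Tendsto (fun s => ∫ x, g x * conjPoisson s f x) (𝓝[>] (0 : ℝ))
      (𝓝 (∫ x, g x * hilbertTransform f x)) := by
  set K := max M (eLpNorm f 2 volume).toReal
  have hK : 0 ≤ K := hf.nonneg.trans (le_max_left _ _)
  have hfK := hf.mono (le_max_left M (eLpNorm f 2 volume).toReal)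
  have hf2K : L2Le K f := (l2Le_self hf2).mono (le_max_right _ _)
  refine tendsto_integral_mul (N := K) (B := hilbertBound δ K) hg hK ?_ ?_
    (tendsto_conjPoisson hf hf2)
  · filter_upwards [self_mem_nhdsWithin] with ε hε using l2Le_conjPoisson hf2K hK hε
  · filter_upwards [Ioc_mem_nhdsGT zero_lt_one] with s hs
    exact (holderC1_conjPoisson hfK hf2K hδ0 hδ1 hs.1 hs.2).abs_le

/-- The Hilbert transform is antisymmetric. -/
theorem integral_mul_hilbertTransform_self (hf : HolderC1 δ M f) (hf2 : MemLp f 2 volume)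
    (hδ0 : 0 < δ) (hδ1 : δ < 1) : ∫ x, f x * hilbertTransform f x = 0 := by
  refine tendsto_nhds_unique (tendsto_integral_mul_conjPoisson hf hf2 hδ0 hδ1 hf2)
    (tendsto_const_nhds.congr' ?_)
  filter_upwards [self_mem_nhdsWithin] with ε hε using
    (integral_mul_conjPoisson_self hf2 hε).symm

theorem conjPoisson_conjPoisson_of_memLp (hf : MemLp f 2 volume) {ε η : ℝ} (hε : 0 < ε)
    (hη : 0 < η) (x : ℝ) : conjPoisson ε (conjPoisson η f) x = -poissonInt (ε + η) f x := by
  have hf' := l2Le_self hf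
  have h0 : 0 ≤ (eLpNorm f 2 volume).toReal := ENNReal.toReal_nonneg
  have h1 := (tendsto_integral_mul (memLp_conjKernel_sub hε x) h0
    (Eventually.of_forall fun n => l2Le_conjPoisson_truncation hf' h0 hη n)
    (Eventually.of_forall fun n x => abs_conjPoisson_le (l2Le_truncation hf' n) h0 hη x)
    (tendsto_conjPoisson_truncation hf hη)).const_mul (1 / Real.pi)
  have hεη : 0 < ε + η := by positivity
  have hp : MemLp (fun y => (ε + η) / ((x - y) ^ 2 + (ε + η) ^ 2)) 2 volume := by
    have hc : Continuous fun y : ℝ => (ε + η) / ((x - y) ^ 2 + (ε + η) ^ 2) :=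
      Continuous.div (by fun_prop) (by fun_prop) (fun z => by positivity)
    rw [memLp_two_iff_integrable_sq hc.aestronglyMeasurable]
    refine ((integrable_inv_sq hεη).comp_sub_left x).mono' (hc.pow 2).aestronglyMeasurable
      (Eventually.of_forall fun y => ?_)
    have h : 0 < (x - y) ^ 2 + (ε + η) ^ 2 := by positivity
    rw [Real.norm_eq_abs, abs_of_nonneg (sq_nonneg _), div_pow, inv_eq_one_div,
      div_le_div_iff₀ (by positivity) h]
    nlinarith [sq_nonneg (x - y), sq_nonneg (ε + η)]
  have h2 : Tendsto (fun n => -poissonInt (ε + η) (truncation f n) x) atTop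
      (𝓝 (-poissonInt (ε + η) f x)) := by
    exact ((tendsto_integral_truncation_mul hf hp).const_mul _).neg
  have h3 : ∀ n, (1 / Real.pi) * ∫ z, conjKernel ε (x - z) * conjPoisson η (truncation f n) z =
      -poissonInt (ε + η) (truncation f n) x := fun n => by
    rw [← conjPoisson_conjPoisson (integrable_truncation hf n) hε hη, conjPoisson_eq]
    congr 2; ext y; ring
  simp_rw [h3] at h1
  rw [← tendsto_nhds_unique h1 h2, conjPoisson_eq]
  congr 2; ext y; ring

/-- The regularized form of `H² = -1`. -/
theorem conjPoisson_hilbertTransform (hf : HolderC1 δ M f) (hf2 : MemLp f 2 volume)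
    (hδ0 : 0 < δ) (hδ1 : δ < 1) {ε : ℝ} (hε : 0 < ε) (x : ℝ) :
    conjPoisson ε (hilbertTransform f) x = -poissonInt ε f x := by
  -- Let η → 0 in the composition law at heights ε and η: the inner operator tends to H, weakly
  -- against the kernel at height ε, while the Poisson integral is continuous in its height.
  have h1 := (tendsto_integral_mul_conjPoisson hf hf2 hδ0 hδ1
    (memLp_conjKernel_sub hε x)).const_mul (1 / Real.pi)
  have h2 : Tendsto (fun η => -poissonInt (ε + η) f x) (𝓝[>] 0) (𝓝 (-poissonInt ε f x)) := by
    have hi := (((integrable_inv_sq hε).comp_sub_left x).const_mul (ε + 1)).const_mul M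
    refine ((tendsto_integral_filter_of_dominated_convergence _ ?_ ?_ hi
      (Eventually.of_forall fun y => ?_)).const_mul _).neg
    · filter_upwards [self_mem_nhdsWithin] with η hη
      have hη : 0 < η := hη
      refine (hf.continuous.mul (Continuous.div (by fun_prop) (by fun_prop) fun y => ?_)).aestronglyMeasurable
      positivity
    · filter_upwards [Ioc_mem_nhdsGT zero_lt_one] with η hη
      have h0 := hη.1
      refine Eventually.of_forall fun y => ?_
      rw [norm_mul, Real.norm_eq_abs, norm_div, Real.norm_of_nonneg (by positivity : 0 ≤ ε + η),
        Real.norm_of_nonneg (by positivity : 0 ≤ (x - y) ^ 2 + (ε + η) ^ 2), div_eq_mul_inv]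
      have := hf.nonneg
      gcongr
      · exact hf.abs_le y
      · exact hη.2
      · linarith
    · refine Tendsto.mono_left ?_ nhdsWithin_le_nhds
      have hc : ContinuousAt (fun η => f y * ((ε + η) / ((x - y) ^ 2 + (ε + η) ^ 2))) 0 := by
        refine continuousAt_const.mul (ContinuousAt.div (by fun_prop) (by fun_prop) ?_)
        rw [add_zero]; positivity
      simpa [ContinuousAt] using hc
  have h3 : Tendsto (fun η => (1 / Real.pi) * ∫ z, conjKernel ε (x - z) * conjPoisson η f z)
      (𝓝[>] 0) (𝓝 (-poissonInt ε f x)) := by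
    refine h2.congr' ?_
    filter_upwards [self_mem_nhdsWithin] with η hη
    rw [← conjPoisson_conjPoisson_of_memLp hf2 hε hη, conjPoisson_eq]
    congr 2; ext y; ring
  have h4 := tendsto_nhds_unique h1 h3
  rw [← h4, conjPoisson_eq]
  congr 2; ext y; ring

theorem tendsto_poissonInt (hf : HolderC1 δ M f) (x : ℝ) :
    Tendsto (fun s => poissonInt s f x) (𝓝[>] 0) (𝓝 (f x)) := by
  have h2 : Tendsto (fun s => (1 / Real.pi) * ∫ z, f (x - s * z) * (1 + z ^ 2)⁻¹) (𝓝[>] 0)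
      (𝓝 (f x)) := by
    have : Tendsto (fun s => ∫ z, f (x - s * z) * (1 + z ^ 2)⁻¹) (𝓝[>] 0)
        (𝓝 (∫ z, f x * (1 + z ^ 2)⁻¹)) := by
      refine tendsto_integral_filter_of_dominated_convergence (fun z => M * (1 + z ^ 2)⁻¹)
        (Eventually.of_forall fun s => ?_) (Eventually.of_forall fun s => Eventually.of_forall
        fun z => ?_) (integrable_inv_one_add_sq.const_mul M) (Eventually.of_forall fun z => ?_)
      · have := hf.continuous
        exact ((by fun_prop : Continuous fun z => f (x - s * z)).measurable.mul
          (by fun_prop)).aestronglyMeasurable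
      · rw [norm_mul, Real.norm_eq_abs, Real.norm_of_nonneg (by positivity : 0 ≤ (1 + z ^ 2)⁻¹)]
        gcongr
        exact hf.abs_le _
      · refine Tendsto.mul_const _ ?_
        have hc := hf.continuous
        have : Continuous fun s => f (x - s * z) := by fun_prop
        have := this.tendsto 0
        rw [zero_mul, sub_zero] at this
        exact this.mono_left nhdsWithin_le_nhds
    rw [integral_const_mul, integral_univ_inv_one_add_sq] at this
    have h := this.const_mul (1 / Real.pi)
    have hpi := Real.pi_ne_zero
    rwa [show 1 / Real.pi * (f x * Real.pi) = f x by field_simp] at h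
  refine h2.congr' ?_
  filter_upwards [self_mem_nhdsWithin] with s hs
  have hs : 0 < s := hs
  rw [poissonInt]
  congr 1
  have h5 := integral_comp_affine (fun z => f (x - s * z) * (1 + z ^ 2)⁻¹) 0 hs
  rw [← integral_sub_left_eq_self (fun y => f y * (s / ((x - y) ^ 2 + s ^ 2))) volume x]
  have : ∀ z, f (x - z) * (s / ((x - (x - z)) ^ 2 + s ^ 2)) =
      s⁻¹ * (f (x - s * ((z - 0) / s)) * (1 + ((z - 0) / s) ^ 2)⁻¹) := by
    intro z
    rw [sub_zero, sub_sub_cancel, mul_div_cancel₀ _ hs.ne']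
    have : z ^ 2 + s ^ 2 ≠ 0 := by positivity
    have : 1 + (z / s) ^ 2 ≠ 0 := by positivity
    field_simp
    ring
  simp_rw [this]
  rw [integral_const_mul, h5]
  field_simp

end

/-! ### Lagrangian coordinates. -/

section

/-- The map `a ↦ a + ξ(a)` with displacement `ξ`. -/
def flowMap (ξ : ℝ → ℝ) (a : ℝ) : ℝ := a + ξ a

/-- The inverse of `flowMap ξ`. -/
def flowInv (ξ : ℝ → ℝ) : ℝ → ℝ := Function.invFun (flowMap ξ)

section Flow

variable {δ : ℝ} {ξ : ℝ → ℝ}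

theorem hasDerivAt_flowMap (hξ : HolderC1 δ (1 / 2) ξ) (a : ℝ) :
    HasDerivAt (flowMap ξ) (1 + deriv ξ a) a :=
  (hasDerivAt_id a).add (hξ.differentiable a).hasDerivAt

/-- The bound 1/2 on the displacement serves to keep the Jacobian between 1/2 and 3/2, so that the
flow map is a diffeomorphism with absolute constants. -/
theorem half_le_one_add_deriv (hξ : HolderC1 δ (1 / 2) ξ) (a : ℝ) : 1 / 2 ≤ 1 + deriv ξ a := by
  linarith [(abs_le.1 (hξ.abs_deriv_le a)).1]

theorem one_add_deriv_le (hξ : HolderC1 δ (1 / 2) ξ) (a : ℝ) : 1 + deriv ξ a ≤ 3 / 2 := by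
  linarith [(abs_le.1 (hξ.abs_deriv_le a)).2]

theorem abs_sub_le_flowMap (hξ : HolderC1 δ (1 / 2) ξ) (a b : ℝ) :
    |a - b| ≤ 2 * |flowMap ξ a - flowMap ξ b| := by
  have h1 := hξ.abs_sub_le a b
  have h2 : flowMap ξ a - flowMap ξ b = (a - b) - (ξ b - ξ a) := by simp only [flowMap]; ring
  have h3 := abs_sub_abs_le_abs_sub (a - b) (ξ b - ξ a)
  rw [abs_sub_comm (ξ b)] at h3
  rw [h2]; linarith

theorem abs_flowMap_sub_le (hξ : HolderC1 δ (1 / 2) ξ) (a b : ℝ) :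
    |flowMap ξ a - flowMap ξ b| ≤ 3 / 2 * |a - b| := by
  have h1 := hξ.abs_sub_le a b
  have h2 : flowMap ξ a - flowMap ξ b = (a - b) + (ξ a - ξ b) := by simp only [flowMap]; ring
  have h3 := abs_add_le (a - b) (ξ a - ξ b)
  rw [h2]; linarith

theorem injective_flowMap (hξ : HolderC1 δ (1 / 2) ξ) : Function.Injective (flowMap ξ) := by
  intro a b h
  have := abs_sub_le_flowMap hξ a b
  rw [h, sub_self, abs_zero, mul_zero] at this
  exact sub_eq_zero.1 (abs_eq_zero.1 (le_antisymm this (abs_nonneg _)))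

theorem continuous_flowMap (hξ : HolderC1 δ (1 / 2) ξ) : Continuous (flowMap ξ) :=
  continuous_id.add hξ.continuous

theorem surjective_flowMap (hξ : HolderC1 δ (1 / 2) ξ) : Function.Surjective (flowMap ξ) := by
  refine (continuous_flowMap hξ).surjective ?_ ?_
  · exact tendsto_atTop_mono (fun a => by
      have := (abs_le.1 (hξ.abs_le a)).1; simp only [flowMap, id]; linarith)
      (tendsto_atTop_add_const_right _ (-(1 / 2) : ℝ) tendsto_id)
  · exact tendsto_atBot_mono (fun a => by
      have := (abs_le.1 (hξ.abs_le a)).2; simp only [flowMap, id]; linarith)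
      (tendsto_atBot_add_const_right _ ((1 / 2) : ℝ) tendsto_id)

theorem flowInv_flowMap (hξ : HolderC1 δ (1 / 2) ξ) (a : ℝ) : flowInv ξ (flowMap ξ a) = a :=
  Function.leftInverse_invFun (injective_flowMap hξ) a

theorem flowMap_flowInv (hξ : HolderC1 δ (1 / 2) ξ) (x : ℝ) : flowMap ξ (flowInv ξ x) = x :=
  Function.rightInverse_invFun (surjective_flowMap hξ) x

theorem abs_flowInv_sub_le (hξ : HolderC1 δ (1 / 2) ξ) (x y : ℝ) :
    |flowInv ξ x - flowInv ξ y| ≤ 2 * |x - y| := by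
  have := abs_sub_le_flowMap hξ (flowInv ξ x) (flowInv ξ y)
  rwa [flowMap_flowInv hξ, flowMap_flowInv hξ] at this

theorem continuous_flowInv (hξ : HolderC1 δ (1 / 2) ξ) : Continuous (flowInv ξ) :=
  (LipschitzWith.of_dist_le_mul (K := 2) fun x y => by
    rw [Real.dist_eq, Real.dist_eq]; exact abs_flowInv_sub_le hξ x y).continuous

theorem hasDerivAt_flowInv (hξ : HolderC1 δ (1 / 2) ξ) (x : ℝ) :
    HasDerivAt (flowInv ξ) (1 + deriv ξ (flowInv ξ x))⁻¹ x :=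
  HasDerivAt.of_local_left_inverse (continuous_flowInv hξ).continuousAt
    (hasDerivAt_flowMap hξ _) (by linarith [half_le_one_add_deriv hξ (flowInv ξ x)])
    (Eventually.of_forall (flowMap_flowInv hξ))

/-- The Eulerian field with Lagrangian values `U`. -/
def eulerian (ξ U : ℝ → ℝ) (x : ℝ) : ℝ := U (flowInv ξ x)

/-- The Hilbert transform of the Eulerian field, in Lagrangian coordinates. -/
def lagHilbert (ξ U : ℝ → ℝ) (a : ℝ) : ℝ := hilbertTransform (eulerian ξ U) (flowMap ξ a)

variable {M : ℝ} {U : ℝ → ℝ}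

theorem eulerian_flowMap (hξ : HolderC1 δ (1 / 2) ξ) (U : ℝ → ℝ) (a : ℝ) :
    eulerian ξ U (flowMap ξ a) = U a := by
  rw [eulerian, flowInv_flowMap hξ]

theorem rpow_const_mul_le {c t : ℝ} (hc : 1 ≤ c) (ht : 0 ≤ t) (hδ1 : δ < 1) :
    (c * t) ^ δ ≤ c * t ^ δ := by
  rw [Real.mul_rpow (by linarith) ht]
  gcongr
  calc c ^ δ ≤ c ^ (1 : ℝ) := Real.rpow_le_rpow_of_exponent_le hc hδ1.le
    _ = c := Real.rpow_one c

/-- The constant comes from the Hölder quotient: two inverse Jacobians contribute 2 · 2, the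
numerator (1/2 + 3/2) M, and the inverse flow map another 2. -/
theorem holderC1_eulerian (hξ : HolderC1 δ (1 / 2) ξ) (hU : HolderC1 δ M U) (hδ0 : 0 < δ)
    (hδ1 : δ < 1) : HolderC1 δ (16 * M) (eulerian ξ U) := by
  have hM := hU.nonneg
  have hd : ∀ x, HasDerivAt (eulerian ξ U)
      (deriv U (flowInv ξ x) * (1 + deriv ξ (flowInv ξ x))⁻¹) x := fun x =>
    (hU.differentiable _).hasDerivAt.comp x (hasDerivAt_flowInv hξ x)
  have hd' : ∀ x, deriv (eulerian ξ U) x =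
    deriv U (flowInv ξ x) * (1 + deriv ξ (flowInv ξ x))⁻¹ := fun x => (hd x).deriv
  have hinv : ∀ a, |(1 + deriv ξ a)⁻¹| ≤ 2 := fun a => by
    have := half_le_one_add_deriv hξ a
    rw [abs_of_pos (by positivity)]
    calc (1 + deriv ξ a)⁻¹ ≤ (1 / 2)⁻¹ := inv_anti₀ (by norm_num) this
      _ = 2 := by norm_num
  refine ⟨fun x => (hd x).differentiableAt, fun x => ?_, fun x => ?_, fun x y => ?_⟩
  · exact (hU.abs_le _).trans (by linarith)
  · rw [hd', abs_mul]
    have := mul_le_mul (hU.abs_deriv_le (flowInv ξ x)) (hinv (flowInv ξ x)) (abs_nonneg _) hM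
    linarith
  · rw [hd', hd']
    set a := flowInv ξ x
    set b := flowInv ξ y
    have hab : |a - b| ^ δ ≤ 2 * |x - y| ^ δ :=
      (Real.rpow_le_rpow (abs_nonneg _) (abs_flowInv_sub_le hξ x y) hδ0.le).trans
        (rpow_const_mul_le (by norm_num) (abs_nonneg _) hδ1)
    have ha := half_le_one_add_deriv hξ a
    have hb := half_le_one_add_deriv hξ b
    have e : deriv U a * (1 + deriv ξ a)⁻¹ - deriv U b * (1 + deriv ξ b)⁻¹ =
        ((1 + deriv ξ a)⁻¹ * (1 + deriv ξ b)⁻¹) *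
        (deriv U a * (deriv ξ b - deriv ξ a) + (1 + deriv ξ a) * (deriv U a - deriv U b)) := by
      have h1 : 1 + deriv ξ a ≠ 0 := by positivity
      have h2 : 1 + deriv ξ b ≠ 0 := by positivity
      field_simp; ring
    rw [e, abs_mul, abs_mul]
    have h1 : |deriv U a * (deriv ξ b - deriv ξ a)| ≤ M * (1 / 2 * |a - b| ^ δ) := by
      rw [abs_mul, abs_sub_comm (deriv ξ b)]
      exact mul_le_mul (hU.abs_deriv_le a) (hξ.holder a b) (abs_nonneg _) hM
    have h2 : |(1 + deriv ξ a) * (deriv U a - deriv U b)| ≤ 3 / 2 * (M * |a - b| ^ δ) := by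
      rw [abs_mul, abs_of_pos (by linarith)]
      exact mul_le_mul (one_add_deriv_le hξ a) (hU.holder a b) (abs_nonneg _) (by norm_num)
    have h3 := (abs_add_le _ _).trans (add_le_add h1 h2)
    have h4 : |(1 + deriv ξ a)⁻¹| * |(1 + deriv ξ b)⁻¹| ≤ 2 * 2 :=
      mul_le_mul (hinv a) (hinv b) (abs_nonneg _) (by norm_num)
    refine (mul_le_mul h4 h3 (abs_nonneg _) (by norm_num)).trans ?_
    have := mul_le_mul_of_nonneg_left hab hM
    linarith

/-- The Hölder quotient gives (3/2)² + 1/2 ≤ 3, the two terms coming from the product rule. -/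
theorem holderC1_comp_flowMap (hξ : HolderC1 δ (1 / 2) ξ) (hU : HolderC1 δ M U) (hδ0 : 0 < δ)
    (hδ1 : δ < 1) : HolderC1 δ (3 * M) (fun a => U (flowMap ξ a)) := by
  have hM := hU.nonneg
  have hd : ∀ a, HasDerivAt (fun a => U (flowMap ξ a)) (deriv U (flowMap ξ a) * (1 + deriv ξ a)) a :=
    fun a => (hU.differentiable _).hasDerivAt.comp a (hasDerivAt_flowMap hξ a)
  have hd' : ∀ a, deriv (fun a => U (flowMap ξ a)) a = deriv U (flowMap ξ a) * (1 + deriv ξ a) :=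
    fun x => (hd x).deriv
  have hab' : ∀ a, |1 + deriv ξ a| ≤ 3 / 2 := fun a => by
    rw [abs_of_pos (by linarith [half_le_one_add_deriv hξ a])]; exact one_add_deriv_le hξ a
  refine ⟨fun x => (hd x).differentiableAt, fun x => ?_, fun x => ?_, fun a b => ?_⟩
  · exact (hU.abs_le _).trans (by linarith)
  · rw [hd', abs_mul]
    have := mul_le_mul (hU.abs_deriv_le (flowMap ξ x)) (hab' x) (abs_nonneg _) hM
    linarith
  · rw [hd', hd']
    have hab : |flowMap ξ a - flowMap ξ b| ^ δ ≤ 3 / 2 * |a - b| ^ δ :=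
      (Real.rpow_le_rpow (abs_nonneg _) (abs_flowMap_sub_le hξ a b) hδ0.le).trans
        (rpow_const_mul_le (by norm_num) (abs_nonneg _) hδ1)
    have e : deriv U (flowMap ξ a) * (1 + deriv ξ a) - deriv U (flowMap ξ b) * (1 + deriv ξ b) =
        (deriv U (flowMap ξ a) - deriv U (flowMap ξ b)) * (1 + deriv ξ a) +
          deriv U (flowMap ξ b) * (deriv ξ a - deriv ξ b) := by ring
    rw [e]
    have h1 := mul_le_mul (hU.holder (flowMap ξ a) (flowMap ξ b)) (hab' a) (abs_nonneg _)
      (by positivity)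
    have h2 := mul_le_mul (hU.abs_deriv_le (flowMap ξ b)) (hξ.holder a b) (abs_nonneg _) hM
    rw [← abs_mul] at h1 h2
    refine ((abs_add_le _ _).trans (add_le_add h1 h2)).trans ?_
    have h3 := mul_le_mul_of_nonneg_left hab hM
    have h4 : 0 ≤ M * |a - b| ^ δ := by positivity
    nlinarith

theorem integrable_sq_iff_flowMap (hξ : HolderC1 δ (1 / 2) ξ) (F : ℝ → ℝ) :
    Integrable (fun x => F x ^ 2) ↔ Integrable (fun a => |1 + deriv ξ a| • F (flowMap ξ a) ^ 2) := by
  have := integrableOn_image_iff_integrableOn_abs_deriv_smul (s := univ) MeasurableSet.univ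
    (fun x _ => (hasDerivAt_flowMap hξ x).hasDerivWithinAt) (injective_flowMap hξ).injOn
    (fun x => F x ^ 2)
  rwa [image_univ, (surjective_flowMap hξ).range_eq, integrableOn_univ, integrableOn_univ] at this

theorem integral_sq_eq_flowMap (hξ : HolderC1 δ (1 / 2) ξ) (F : ℝ → ℝ) :
    ∫ x, F x ^ 2 = ∫ a, |1 + deriv ξ a| • F (flowMap ξ a) ^ 2 := by
  have := integral_image_eq_integral_abs_deriv_smul (s := univ) MeasurableSet.univ
    (fun x _ => (hasDerivAt_flowMap hξ x).hasDerivWithinAt) (injective_flowMap hξ).injOn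
    (fun x => F x ^ 2)
  rwa [image_univ, (surjective_flowMap hξ).range_eq, setIntegral_univ, setIntegral_univ] at this

theorem L2Le.comp_flowMap {N : ℝ} {F : ℝ → ℝ} (hF : L2Le N F) (hFc : Continuous F) (hN : 0 ≤ N)
    (hξ : HolderC1 δ (1 / 2) ξ) : L2Le (2 * N) (fun a => F (flowMap ξ a)) := by
  have hc : Continuous fun a => F (flowMap ξ a) := hFc.comp (continuous_flowMap hξ)
  have h1 := (integrable_sq_iff_flowMap hξ F).1 hF.1.integrable_sq
  have hle : ∀ a, F (flowMap ξ a) ^ 2 ≤ 2 * (|1 + deriv ξ a| • F (flowMap ξ a) ^ 2) := fun a => by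
    have := half_le_one_add_deriv hξ a
    rw [abs_of_pos (by linarith), smul_eq_mul]
    nlinarith [sq_nonneg (F (flowMap ξ a))]
  have h2 : MemLp (fun a => F (flowMap ξ a)) 2 volume := by
    rw [memLp_two_iff_integrable_sq hc.aestronglyMeasurable]
    refine (h1.const_mul 2).mono' (hc.pow 2).aestronglyMeasurable (Eventually.of_forall fun a => ?_)
    rw [Real.norm_of_nonneg (sq_nonneg _)]; exact hle a
  refine l2Le_of_integral_sq_le h2 (by positivity) ?_
  calc _ ≤ ∫ a, 2 * (|1 + deriv ξ a| • F (flowMap ξ a) ^ 2) :=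
        integral_mono h2.integrable_sq (h1.const_mul 2) hle
    _ = 2 * ∫ x, F x ^ 2 := by rw [integral_const_mul, ← integral_sq_eq_flowMap hξ]
    _ ≤ 2 * N ^ 2 := by gcongr; exact hF.integral_sq_le hN
    _ ≤ (2 * N) ^ 2 := by nlinarith [sq_nonneg N]

theorem l2Le_of_comp_flowMap {N : ℝ} {F : ℝ → ℝ} (hδ : 0 < δ) (hFc : Continuous F) (hN : 0 ≤ N)
    (hξ : HolderC1 δ (1 / 2) ξ) (hF : L2Le N (fun a => F (flowMap ξ a))) : L2Le (2 * N) F := by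
  have hle : ∀ a, |1 + deriv ξ a| • F (flowMap ξ a) ^ 2 ≤ 2 * F (flowMap ξ a) ^ 2 := fun a => by
    have := half_le_one_add_deriv hξ a
    have := one_add_deriv_le hξ a
    rw [abs_of_pos (by linarith), smul_eq_mul]
    nlinarith [sq_nonneg (F (flowMap ξ a))]
  have h1 : Integrable (fun a => |1 + deriv ξ a| • F (flowMap ξ a) ^ 2) := by
    have hcd := hξ.continuous_deriv hδ
    have hc : Continuous fun a => |1 + deriv ξ a| • F (flowMap ξ a) ^ 2 :=
      (continuous_const.add hcd).abs.smul ((hFc.comp (continuous_flowMap hξ)).pow 2)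
    refine (hF.1.integrable_sq.const_mul 2).mono' hc.aestronglyMeasurable
      (Eventually.of_forall fun a => ?_)
    rw [Real.norm_of_nonneg (by rw [smul_eq_mul]; positivity)]; exact hle a
  have h2 : MemLp F 2 volume := by
    rw [memLp_two_iff_integrable_sq hFc.aestronglyMeasurable]
    exact (integrable_sq_iff_flowMap hξ F).2 h1
  refine l2Le_of_integral_sq_le h2 (by positivity) ?_
  calc _ = ∫ a, |1 + deriv ξ a| • F (flowMap ξ a) ^ 2 := integral_sq_eq_flowMap hξ F
    _ ≤ ∫ a, 2 * F (flowMap ξ a) ^ 2 := integral_mono h1 (hF.1.integrable_sq.const_mul 2) hle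
    _ = 2 * ∫ a, F (flowMap ξ a) ^ 2 := integral_const_mul _ _
    _ ≤ 2 * N ^ 2 := by gcongr; exact hF.integral_sq_le hN
    _ ≤ (2 * N) ^ 2 := by nlinarith [sq_nonneg N]

theorem l2Le_eulerian (hδ : 0 < δ) (hξ : HolderC1 δ (1 / 2) ξ) (hUc : Continuous U)
    (hU2 : L2Le M U) (hM : 0 ≤ M) : L2Le (2 * M) (eulerian ξ U) := by
  refine l2Le_of_comp_flowMap hδ (hUc.comp (continuous_flowInv hξ)) hM hξ ?_
  simpa only [eulerian_flowMap hξ] using hU2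

theorem l2Le_eulerian' (hδ : 0 < δ) (hξ : HolderC1 δ (1 / 2) ξ) (hU : HolderC1 δ M U)
    (hU2 : L2Le M U) : L2Le (16 * M) (eulerian ξ U) :=
  (l2Le_eulerian hδ hξ hU.continuous hU2 hU.nonneg).mono (by linarith [hU.nonneg])

/-- No derivative is lost: the acceleration is as regular as the velocity. This is what makes the
equation an ordinary differential equation in Lagrangian coordinates. -/
theorem holderC1_lagHilbert (hξ : HolderC1 δ (1 / 2) ξ) (hU : HolderC1 δ M U) (hU2 : L2Le M U)
    (hδ0 : 0 < δ) (hδ1 : δ < 1) :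
    HolderC1 δ (3 * hilbertBound δ (16 * M)) (lagHilbert ξ U) :=
  holderC1_comp_flowMap hξ (holderC1_hilbertTransform (holderC1_eulerian hξ hU hδ0 hδ1)
    (l2Le_eulerian' hδ0 hξ hU hU2) hδ0 hδ1) hδ0 hδ1

theorem l2Le_lagHilbert (hξ : HolderC1 δ (1 / 2) ξ) (hU : HolderC1 δ M U) (hU2 : L2Le M U)
    (hδ0 : 0 < δ) (hδ1 : δ < 1) : L2Le (2 * (2 * M)) (lagHilbert ξ U) := by
  have hM := hU.nonneg
  have hu := holderC1_eulerian hξ hU hδ0 hδ1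
  exact (l2Le_hilbertTransform hu (l2Le_eulerian hδ0 hξ hU.continuous hU2 hM)
    (by positivity)).comp_flowMap (holderC1_hilbertTransform hu (l2Le_eulerian' hδ0 hξ hU hU2)
      hδ0 hδ1).continuous (by positivity) hξ

variable {ξ₁ ξ₂ U₁ U₂ : ℝ → ℝ} {d e : ℝ}

/-- Lipschitz dependence of the Eulerian field on the Lagrangian variables, in `L²`. -/
theorem l2Le_eulerian_sub (hδ0 : 0 < δ) (hδ1 : δ < 1) (hξ₁ : HolderC1 δ (1 / 2) ξ₁)
    (hξ₂ : HolderC1 δ (1 / 2) ξ₂) (hU₁ : HolderC1 δ M U₁) (hU₂ : HolderC1 δ M U₂)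
    (hd : 0 ≤ d) (he : 0 ≤ e)
    (hξ : L2Le d (fun a => ξ₁ a - ξ₂ a)) (hU : L2Le e (fun a => U₁ a - U₂ a)) :
    L2Le (2 * (e + 16 * M * d)) (fun x => eulerian ξ₁ U₁ x - eulerian ξ₂ U₂ x) := by
  have hM := hU₁.nonneg
  have h1 := holderC1_eulerian hξ₁ hU₁ hδ0 hδ1
  have h2 := holderC1_eulerian hξ₂ hU₂ hδ0 hδ1
  refine l2Le_of_comp_flowMap hδ0 (h1.continuous.sub h2.continuous) (by positivity) hξ₁ ?_
  -- At the point X₁(a) the difference is U₁ - U₂ plus u₂(X₂(a)) - u₂(X₁(a)), and the latter is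
  -- controlled by the Lipschitz constant 16M of u₂.
  have h3 : L2Le (16 * M * d) (fun a => eulerian ξ₂ U₂ (flowMap ξ₂ a) -
      eulerian ξ₂ U₂ (flowMap ξ₁ a)) := by
    have h5 := hξ.const_mul (16 * M)
    rw [abs_of_nonneg (by positivity)] at h5
    refine h5.of_abs_le ?_ fun a => ?_
    · exact ((h2.continuous.comp (continuous_flowMap hξ₂)).sub
        (h2.continuous.comp (continuous_flowMap hξ₁))).aestronglyMeasurable
    · rw [abs_mul, abs_of_nonneg (by positivity : 0 ≤ 16 * M), abs_sub_comm (ξ₁ a)]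
      refine (h2.abs_sub_le _ _).trans_eq ?_
      simp only [flowMap, add_sub_add_left_eq_sub]
  convert hU.add h3 he (by positivity) using 2 with a
  rw [eulerian_flowMap hξ₁, eulerian_flowMap hξ₂]; ring

/-- A Lipschitz constant for the Hilbert transform in Lagrangian coordinates. -/
def lagConst (δ M : ℝ) : ℝ := 4 * (1 + 16 * M) + hilbertBound δ (16 * M)

/-- Split into H(u₁ - u₂) evaluated along the first flow, where H is an L² contraction, and Hu₂
evaluated along two flows, where its Lipschitz bound applies. Differences are measured in L² only,
with no derivatives of u₁ - u₂. -/
theorem l2Le_lagHilbert_sub (hδ0 : 0 < δ) (hδ1 : δ < 1) (hξ₁ : HolderC1 δ (1 / 2) ξ₁)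
    (hξ₂ : HolderC1 δ (1 / 2) ξ₂) (hU₁ : HolderC1 δ M U₁) (hU₂ : HolderC1 δ M U₂)
    (hU₁' : L2Le M U₁) (hU₂' : L2Le M U₂) (hd : 0 ≤ d) (he : 0 ≤ e)
    (hξ : L2Le d (fun a => ξ₁ a - ξ₂ a)) (hU : L2Le e (fun a => U₁ a - U₂ a)) :
    L2Le (lagConst δ M * (d + e)) (fun a => lagHilbert ξ₁ U₁ a - lagHilbert ξ₂ U₂ a) := by
  have hM := hU₁.nonneg
  have h1 := holderC1_eulerian hξ₁ hU₁ hδ0 hδ1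
  have h2 := holderC1_eulerian hξ₂ hU₂ hδ0 hδ1
  have h1' := l2Le_eulerian' hδ0 hξ₁ hU₁ hU₁'
  have h2' := l2Le_eulerian' hδ0 hξ₂ hU₂ hU₂'
  have hH := holderC1_hilbertTransform h2 h2' hδ0 hδ1
  have hH1 := holderC1_hilbertTransform h1 h1' hδ0 hδ1
  have hK := hH.nonneg
  have hs := l2Le_eulerian_sub hδ0 hδ1 hξ₁ hξ₂ hU₁ hU₂ hd he hξ hU
  have h3 := l2Le_hilbertTransform (h1.sub h2) hs (by positivity)
  have hHe := fun x => hilbertTransform_sub h1 h1'.1 h2 h2'.1 x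
  have h4 : L2Le (2 * (2 * (e + 16 * M * d))) (fun a =>
      hilbertTransform (eulerian ξ₁ U₁) (flowMap ξ₁ a) -
      hilbertTransform (eulerian ξ₂ U₂) (flowMap ξ₁ a)) := by
    rw [funext hHe] at h3
    exact h3.comp_flowMap (hH1.continuous.sub hH.continuous) (by positivity) hξ₁
  have h5 : L2Le (hilbertBound δ (16 * M) * d) (fun a =>
      hilbertTransform (eulerian ξ₂ U₂) (flowMap ξ₁ a) -
      hilbertTransform (eulerian ξ₂ U₂) (flowMap ξ₂ a)) := by
    have h5 := hξ.const_mul (hilbertBound δ (16 * M))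
    rw [abs_of_nonneg hK] at h5
    refine h5.of_abs_le ?_ fun a => ?_
    · exact ((hH.continuous.comp (continuous_flowMap hξ₁)).sub
        (hH.continuous.comp (continuous_flowMap hξ₂))).aestronglyMeasurable
    · rw [abs_mul, abs_of_nonneg hK]
      refine (hH.abs_sub_le _ _).trans_eq ?_
      simp only [flowMap, add_sub_add_left_eq_sub]
  have h6 := h4.add h5 (by positivity) (by positivity)
  have h7 : (fun a => lagHilbert ξ₁ U₁ a - lagHilbert ξ₂ U₂ a) = fun a =>
      hilbertTransform (eulerian ξ₁ U₁) (flowMap ξ₁ a) -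
      hilbertTransform (eulerian ξ₂ U₂) (flowMap ξ₁ a) +
      (hilbertTransform (eulerian ξ₂ U₂) (flowMap ξ₁ a) -
      hilbertTransform (eulerian ξ₂ U₂) (flowMap ξ₂ a)) := by
    ext a; simp only [lagHilbert]; ring
  rw [h7]
  refine h6.mono ?_
  rw [lagConst]
  have h8 : 0 ≤ M * e := by positivity
  have h9 : 0 ≤ hilbertBound δ (16 * M) * e := by positivity
  nlinarith

end Flow

end

/-! ### Paths of functions in time and their time integrals. -/

section

/-- A path of functions, bounded in `C^{1+δ}` and in `L²`, and Lipschitz in time with values in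
`L²`. -/
structure LipPath (δ B N L : ℝ) (g : ℝ → ℝ → ℝ) : Prop where
  holder : ∀ t, HolderC1 δ B (g t)
  l2 : ∀ t, L2Le N (g t)
  lip : ∀ t s, L2Le (L * |t - s|) (fun a => g t a - g s a)

variable {δ B N L : ℝ} {g : ℝ → ℝ → ℝ}

theorem tendsto_eLpNorm_of_l2Le {l : Filter ℝ} {t : ℝ} {c : ℝ → ℝ} (hc : Tendsto c l (𝓝 0))
    (h : ∀ᶠ s in l, L2Le (c s) (fun a => g s a - g t a)) :
    Tendsto (fun s => eLpNorm (g s - g t) 2 volume) l (𝓝 0) := by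
  have h1 : Tendsto (fun s => ENNReal.ofReal (c s)) l (𝓝 0) := by
    have := (ENNReal.continuous_ofReal.tendsto 0).comp hc
    rwa [ENNReal.ofReal_zero] at this
  refine tendsto_of_tendsto_of_tendsto_of_le_of_le' tendsto_const_nhds h1
    (Eventually.of_forall fun _ => zero_le) ?_
  filter_upwards [h] with s hs using hs.2

theorem tendsto_const_mul_abs_sub (L t : ℝ) : Tendsto (fun s => L * |s - t|) (𝓝 t) (𝓝 0) := by
  have : Continuous fun s => L * |s - t| := by fun_prop
  simpa using this.tendsto t

namespace LipPath

theorem continuous_time (h : LipPath δ B N L g) (a : ℝ) : Continuous fun s => g s a := by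
  refine continuous_iff_continuousAt.2 fun t => ?_
  exact tendsto_of_eLpNorm_tendsto (Eventually.of_forall h.holder) (h.holder t)
    (Eventually.of_forall fun s => (h.l2 s).1) (h.l2 t).1
    (tendsto_eLpNorm_of_l2Le (tendsto_const_mul_abs_sub L t) (Eventually.of_forall fun s =>
      h.lip s t)) a

theorem continuous_deriv_time (h : LipPath δ B N L g) (hδ : 0 < δ) (a : ℝ) :
    Continuous fun s => deriv (g s) a := by
  refine continuous_iff_continuousAt.2 fun t => ?_
  exact (HolderC1.of_tendsto hδ (Eventually.of_forall h.holder)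
    fun x => (h.continuous_time x).tendsto t).2 a

end LipPath

theorem continuous_uncurry_of_lipschitz (hB : 0 ≤ B)
    (h : ∀ s x y, |g s x - g s y| ≤ B * |x - y|) (hc : ∀ a, Continuous fun s => g s a) :
    Continuous (Function.uncurry g) :=
  continuous_prod_of_continuous_lipschitzWith' (Function.uncurry g) B.toNNReal
    (fun s => LipschitzWith.of_dist_le_mul fun x y => by
      rw [Real.dist_eq, Real.dist_eq, Real.coe_toNNReal _ hB]; exact h s x y) hc

theorem LipPath.continuous_uncurry (h : LipPath δ B N L g) : Continuous (Function.uncurry g) :=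
  continuous_uncurry_of_lipschitz (h.holder 0).nonneg (fun s => (h.holder s).abs_sub_le)
    h.continuous_time

theorem LipPath.holderC1_integral (h : LipPath δ B N L g) (hδ : 0 < δ) {t : ℝ} (ht : 0 ≤ t) :
    HolderC1 δ (t * B) (fun a => ∫ s in (0 : ℝ)..t, g s a) := by
  have hd : ∀ a, HasDerivAt (fun a => ∫ s in (0 : ℝ)..t, g s a)
      (∫ s in (0 : ℝ)..t, deriv (g s) a) a := by
    intro a
    exact (intervalIntegral.hasDerivAt_integral_of_dominated_loc_of_deriv_le (𝕜 := ℝ)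
      (F := fun a s => g s a) (F' := fun a s => deriv (g s) a) (bound := fun _ => B) (s := univ)
      univ_mem
      (Eventually.of_forall fun a => (h.continuous_time a).aestronglyMeasurable)
      ((h.continuous_time a).intervalIntegrable _ _)
      (h.continuous_deriv_time hδ a).aestronglyMeasurable
      (Eventually.of_forall fun s _ a _ => (h.holder s).abs_deriv_le a)
      (continuous_const.intervalIntegrable _ _)
      (Eventually.of_forall fun s _ a _ => ((h.holder s).differentiable a).hasDerivAt)).2
  have hb : ∀ φ : ℝ → ℝ, ∀ C, (∀ s, |φ s| ≤ C) → |∫ s in (0 : ℝ)..t, φ s| ≤ t * C := by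
    intro φ C hφ
    have := intervalIntegral.norm_integral_le_of_norm_le_const (a := 0) (b := t) (C := C) (f := φ)
      (fun s _ => hφ s)
    rw [sub_zero, abs_of_nonneg ht, mul_comm] at this
    exact this
  refine ⟨fun a => (hd a).differentiableAt, fun a => hb _ _ fun s => (h.holder s).abs_le a,
    fun a => ?_, fun a b => ?_⟩
  · rw [(hd a).deriv]; exact hb _ _ fun s => (h.holder s).abs_deriv_le a
  · rw [(hd a).deriv, (hd b).deriv, ← intervalIntegral.integral_sub
      ((h.continuous_deriv_time hδ a).intervalIntegrable _ _)
      ((h.continuous_deriv_time hδ b).intervalIntegrable _ _), mul_assoc]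
    exact hb _ _ fun s => (h.holder s).holder a b

/-- Expand the nonnegative integral of (φ - m)², where m is the mean of φ. -/
theorem sq_intervalIntegral_le {φ : ℝ → ℝ} (hφ : Continuous φ) {r t : ℝ} (hrt : r ≤ t) :
    (∫ s in r..t, φ s) ^ 2 ≤ (t - r) * ∫ s in r..t, φ s ^ 2 := by
  rcases hrt.eq_or_lt with rfl | hlt
  · simp
  have hpos : 0 < t - r := sub_pos.2 hlt
  set m := (∫ s in r..t, φ s) / (t - r) with hm
  have h1 : 0 ≤ ∫ s in r..t, (φ s - m) ^ 2 :=
    intervalIntegral.integral_nonneg hrt fun s _ => sq_nonneg _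
  have e : ∀ s, (φ s - m) ^ 2 = φ s ^ 2 - 2 * m * φ s + m ^ 2 := fun s => by ring
  simp_rw [e] at h1
  have i1 : IntervalIntegrable (fun s => φ s ^ 2) volume r t := (hφ.pow 2).intervalIntegrable _ _
  have i2 : IntervalIntegrable (fun s => 2 * m * φ s) volume r t :=
    (continuous_const.mul hφ).intervalIntegrable _ _
  rw [intervalIntegral.integral_add (i1.sub i2) (by simp), intervalIntegral.integral_sub i1 i2,
    intervalIntegral.integral_const_mul, intervalIntegral.integral_const, smul_eq_mul] at h1
  have e2 : ∫ s in r..t, φ s = m * (t - r) := by rw [hm]; field_simp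
  rw [e2] at h1 ⊢
  nlinarith

/-- Minkowski's integral inequality in `L²`. -/
theorem l2Le_intervalIntegral {d : ℝ} (hd : 0 ≤ d) (hc : Continuous (Function.uncurry g))
    (hg : ∀ s, L2Le d (g s)) (r t : ℝ) : L2Le (d * |t - r|) (fun a => ∫ s in r..t, g s a) := by
  wlog hrt : r ≤ t generalizing r t
  · have := this t r (le_of_not_ge hrt)
    rw [abs_sub_comm] at this
    refine this.of_abs_le ?_ fun a => ?_
    · have h2 := this.1.1.neg
      refine h2.congr (Eventually.of_forall fun a => ?_)
      simp only [Pi.neg_apply]; exact (intervalIntegral.integral_symm t r).symm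
    · rw [intervalIntegral.integral_symm, abs_neg]
  rw [abs_of_nonneg (sub_nonneg.2 hrt)]
  have hcont : Continuous fun a => ∫ s in r..t, g s a := by
    have : Continuous (Function.uncurry fun a s => g s a) := hc.comp continuous_swap
    exact intervalIntegral.continuous_parametric_intervalIntegral_of_continuous' this r t
  have hct : ∀ a, Continuous fun s => g s a := fun a =>
    hc.comp (continuous_id.prodMk continuous_const)
  have hint : Integrable (fun p : ℝ × ℝ => g p.1 p.2 ^ 2)
      ((volume.restrict (Ioc r t)).prod volume) := by
    have hm : AEStronglyMeasurable (fun p : ℝ × ℝ => g p.1 p.2 ^ 2)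
      ((volume.restrict (Ioc r t)).prod volume) := (hc.pow 2).aestronglyMeasurable
    rw [integrable_prod_iff hm]
    refine ⟨Eventually.of_forall fun s => (hg s).1.integrable_sq, ?_⟩
    refine Integrable.mono' (g := fun _ => d ^ 2) (by simp) hm.norm.integral_prod_right'
      (Eventually.of_forall fun s => ?_)
    rw [Real.norm_of_nonneg (integral_nonneg fun a => norm_nonneg _)]
    simpa only [norm_pow, Real.norm_eq_abs, sq_abs] using (hg s).integral_sq_le hd
  have hswap := integral_integral_swap (f := fun s a => g s a ^ 2) hint
  have hint2 : Integrable fun a => ∫ s in r..t, g s a ^ 2 := by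
    simpa only [intervalIntegral.integral_of_le hrt] using hint.integral_prod_right
  -- Cauchy–Schwarz in time at each point, followed by Fubini; one factor t - r comes from each,
  -- which gives exactly the claimed constant.
  have hle : ∀ a, (∫ s in r..t, g s a) ^ 2 ≤ (t - r) * ∫ s in r..t, g s a ^ 2 := fun a =>
    sq_intervalIntegral_le (hct a) hrt
  have hmem : MemLp (fun a => ∫ s in r..t, g s a) 2 volume := by
    rw [memLp_two_iff_integrable_sq hcont.aestronglyMeasurable]
    refine (hint2.const_mul (t - r)).mono' (hcont.pow 2).aestronglyMeasurable
      (Eventually.of_forall fun a => ?_)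
    rw [Real.norm_of_nonneg (sq_nonneg _)]; exact hle a
  refine l2Le_of_integral_sq_le hmem (mul_nonneg hd (sub_nonneg.2 hrt)) ?_
  calc _ ≤ ∫ a, (t - r) * ∫ s in r..t, g s a ^ 2 :=
        integral_mono hmem.integrable_sq (hint2.const_mul _) hle
    _ = (t - r) * ∫ s in Ioc r t, ∫ a, g s a ^ 2 := by
        rw [integral_const_mul, hswap]
        simp only [intervalIntegral.integral_of_le hrt]
    _ ≤ (t - r) * ∫ s in Ioc r t, d ^ 2 := by
        refine mul_le_mul_of_nonneg_left (integral_mono hint.integral_prod_left (by simp)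
          fun s => (hg s).integral_sq_le hd) (sub_nonneg.2 hrt)
    _ = (d * (t - r)) ^ 2 := by
        rw [setIntegral_const, Measure.real, Real.volume_Ioc, ENNReal.toReal_ofReal (by linarith),
          smul_eq_mul]
        ring

end

/-! ### Picard iteration and local existence. -/

section

/-- Projection of time to `[0, τ]`. -/
def clampTime (τ t : ℝ) : ℝ := max 0 (min t τ)

theorem clampTime_nonneg (τ t : ℝ) : 0 ≤ clampTime τ t := le_max_left _ _

theorem clampTime_le {τ : ℝ} (hτ : 0 ≤ τ) (t : ℝ) : clampTime τ t ≤ τ :=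
  max_le hτ (min_le_right _ _)

theorem clampTime_of_mem {τ t : ℝ} (h0 : 0 ≤ t) (h1 : t ≤ τ) : clampTime τ t = t := by
  rw [clampTime, min_eq_left h1, max_eq_right h0]

theorem abs_clampTime_sub_le (τ t s : ℝ) : |clampTime τ t - clampTime τ s| ≤ |t - s| := by
  rw [clampTime, clampTime]
  refine (abs_max_sub_max_le_max 0 (min t τ) 0 (min s τ)).trans ?_
  rw [sub_self, abs_zero]
  refine max_le (abs_nonneg _) ((abs_min_sub_min_le_max t τ s τ).trans ?_)
  rw [sub_self, abs_zero]
  exact max_le le_rfl (abs_nonneg _)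

/-- The displacement of the particles moving with Lagrangian velocity `U`. -/
def displacement (τ : ℝ) (U : ℝ → ℝ → ℝ) (t a : ℝ) : ℝ := ∫ s in (0 : ℝ)..clampTime τ t, U s a

/-- The acceleration of the particles. -/
def acceleration (τ : ℝ) (U : ℝ → ℝ → ℝ) (t : ℝ) : ℝ → ℝ := lagHilbert (displacement τ U t) (U t)

/-- The Picard map for the Lagrangian velocity. -/
def picardMap (τ : ℝ) (u₀ : ℝ → ℝ) (U : ℝ → ℝ → ℝ) (t a : ℝ) : ℝ :=
  u₀ a + ∫ s in (0 : ℝ)..clampTime τ t, acceleration τ U s a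

/-- The bound for the acceleration. -/
def accBound (δ M : ℝ) : ℝ := max (3 * hilbertBound δ (16 * (2 * M))) (2 * (2 * (2 * M)))

/-- The smallness conditions on the time step. -/
structure SmallTime (δ M τ : ℝ) : Prop where
  δ_pos : 0 < δ
  δ_lt_one : δ < 1
  M_pos : 0 < M
  τ_pos : 0 < τ
  τ_le_one : τ ≤ 1
  disp_le : τ * (2 * M) ≤ 1 / 2
  acc_le : τ * accBound δ M ≤ M
  contraction : τ * (lagConst δ (2 * M) * 2) ≤ 1 / 2

theorem hilbertBound_nonneg {δ M : ℝ} (hδ : 0 < δ) (hM : 0 ≤ M) : 0 ≤ hilbertBound δ M := by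
  have := holderConst_nonneg δ
  have := Real.pi_pos
  unfold hilbertBound; positivity

theorem lagConst_nonneg {δ M : ℝ} (hδ : 0 < δ) (hM : 0 ≤ M) : 0 ≤ lagConst δ M := by
  have := hilbertBound_nonneg hδ (by positivity : 0 ≤ 16 * M)
  unfold lagConst; positivity

theorem exists_smallTime {δ M : ℝ} (hδ0 : 0 < δ) (hδ1 : δ < 1) (hM : 0 < M) :
    ∃ τ, SmallTime δ M τ := by
  have hev : ∀ c b : ℝ, 0 < b → ∀ᶠ τ in 𝓝[>] (0 : ℝ), τ * c ≤ b := fun c b hb => by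
    have : Tendsto (fun τ : ℝ => τ * c) (𝓝[>] 0) (𝓝 0) := by
      have hc : Continuous fun τ : ℝ => τ * c := by fun_prop
      have := hc.tendsto 0
      rw [zero_mul] at this
      exact this.mono_left nhdsWithin_le_nhds
    exact this.eventually (ge_mem_nhds hb)
  obtain ⟨τ, h0, h1, h2, h3, h4⟩ := ((eventually_mem_nhdsWithin (a := (0 : ℝ)) (s := Ioi 0)).and
    ((hev 1 1 one_pos).and ((hev (2 * M) (1 / 2) (by norm_num)).and ((hev (accBound δ M) M hM).and
      (hev (lagConst δ (2 * M) * 2) (1 / 2) (by norm_num)))))).exists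
  exact ⟨τ, hδ0, hδ1, hM, h0, by simpa using h1, h2, h3, h4⟩

variable {δ M τ : ℝ} {U V : ℝ → ℝ → ℝ} {u₀ : ℝ → ℝ}

/-- The class of paths in which the Picard iteration takes place. -/
abbrev VelocityPath (δ M : ℝ) (U : ℝ → ℝ → ℝ) : Prop := LipPath δ (2 * M) (2 * M) (accBound δ M) U

theorem accBound_nonneg (hτ : SmallTime δ M τ) : 0 ≤ accBound δ M :=
  le_max_of_le_right (by have := hτ.M_pos; positivity)

theorem holderC1_displacement (hτ : SmallTime δ M τ) (hU : VelocityPath δ M U) (t : ℝ) :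
    HolderC1 δ (1 / 2) (displacement τ U t) := by
  refine (hU.holderC1_integral hτ.δ_pos (clampTime_nonneg τ t)).mono (le_trans ?_ hτ.disp_le)
  have := hτ.M_pos
  gcongr
  exact clampTime_le hτ.τ_pos.le t

theorem displacement_sub (hU : VelocityPath δ M U) (t s a : ℝ) :
    displacement τ U t a - displacement τ U s a = ∫ r in clampTime τ s..clampTime τ t, U r a := by
  have hc := hU.continuous_time a
  exact intervalIntegral.integral_interval_sub_left (hc.intervalIntegrable _ _)
    (hc.intervalIntegrable _ _)

theorem l2Le_displacement_sub (hτ : SmallTime δ M τ) (hU : VelocityPath δ M U) (t s : ℝ) :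
    L2Le (2 * M * |t - s|) (fun a => displacement τ U t a - displacement τ U s a) := by
  have hM := hτ.M_pos
  simp_rw [displacement_sub hU]
  refine (l2Le_intervalIntegral (by positivity) hU.continuous_uncurry hU.l2 _ _).mono ?_
  exact mul_le_mul_of_nonneg_left (abs_clampTime_sub_le τ t s) (by positivity)

theorem lipPath_acceleration (hτ : SmallTime δ M τ) (hU : VelocityPath δ M U) :
    LipPath δ (accBound δ M) (accBound δ M) (lagConst δ (2 * M) * (2 * M + accBound δ M))
      (acceleration τ U) where
  holder t := (holderC1_lagHilbert (holderC1_displacement hτ hU t) (hU.holder t) (hU.l2 t)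
    hτ.δ_pos hτ.δ_lt_one).mono (le_max_left _ _)
  l2 t := (l2Le_lagHilbert (holderC1_displacement hτ hU t) (hU.holder t) (hU.l2 t)
    hτ.δ_pos hτ.δ_lt_one).mono (le_max_right _ _)
  lip t s := by
    have hM := hτ.M_pos
    have hA := accBound_nonneg hτ
    refine (l2Le_lagHilbert_sub hτ.δ_pos hτ.δ_lt_one (holderC1_displacement hτ hU t)
      (holderC1_displacement hτ hU s) (hU.holder t) (hU.holder s) (hU.l2 t) (hU.l2 s)
      (by positivity) (by positivity) (l2Le_displacement_sub hτ hU t s) (hU.lip t s)).mono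
      (le_of_eq (by ring))

theorem picardMap_sub (hτ : SmallTime δ M τ) (hU : VelocityPath δ M U) (t s a : ℝ) :
    picardMap τ u₀ U t a - picardMap τ u₀ U s a =
      ∫ r in clampTime τ s..clampTime τ t, acceleration τ U r a := by
  have hc := (lipPath_acceleration hτ hU).continuous_time a
  rw [picardMap, picardMap, add_sub_add_left_eq_sub]
  exact intervalIntegral.integral_interval_sub_left (hc.intervalIntegrable _ _)
    (hc.intervalIntegrable _ _)

/-- Data of size M leave room M in a class of size 2M, and `acc_le` keeps the integrated
acceleration within it. The Lipschitz constant in time is the bound on the acceleration itself. -/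
theorem velocityPath_picardMap (hτ : SmallTime δ M τ) (hu₀ : HolderC1 δ M u₀) (hu₀' : L2Le M u₀)
    (hU : VelocityPath δ M U) : VelocityPath δ M (picardMap τ u₀ U) := by
  have hM := hτ.M_pos
  have hA := accBound_nonneg hτ
  have hacc := lipPath_acceleration hτ hU
  have hle : ∀ t, clampTime τ t * accBound δ M ≤ M := fun t =>
    (mul_le_mul_of_nonneg_right (clampTime_le hτ.τ_pos.le t) hA).trans hτ.acc_le
  refine ⟨fun t => ?_, fun t => ?_, fun t s => ?_⟩
  · refine (hu₀.add (hacc.holderC1_integral hτ.δ_pos (clampTime_nonneg τ t))).mono ?_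
    linarith [hle t]
  · have h1 := l2Le_intervalIntegral hA hacc.continuous_uncurry hacc.l2 0 (clampTime τ t)
    rw [sub_zero, abs_of_nonneg (clampTime_nonneg τ t), mul_comm] at h1
    refine (hu₀'.add h1 hM.le (mul_nonneg (clampTime_nonneg τ t) hA)).mono ?_
    linarith [hle t]
  · simp_rw [picardMap_sub hτ hU]
    refine (l2Le_intervalIntegral hA hacc.continuous_uncurry hacc.l2 _ _).mono ?_
    exact mul_le_mul_of_nonneg_left (abs_clampTime_sub_le τ t s) hA

/-- The Picard map is a contraction in `L²`, uniformly in time. -/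
theorem l2Le_picardMap_sub (hτ : SmallTime δ M τ) (hU : VelocityPath δ M U)
    (hV : VelocityPath δ M V) {d : ℝ} (hd : 0 ≤ d) (h : ∀ t, L2Le d (fun a => U t a - V t a))
    (t : ℝ) : L2Le (d / 2) (fun a => picardMap τ u₀ U t a - picardMap τ u₀ V t a) := by
  have hM := hτ.M_pos
  have hcl := clampTime_nonneg τ
  have hL := lagConst_nonneg hτ.δ_pos (by positivity : 0 ≤ 2 * M)
  have hdisp : ∀ t, L2Le d (fun a => displacement τ U t a - displacement τ V t a) := by
    intro t
    have hcont : Continuous (Function.uncurry fun s a => U s a - V s a) :=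
      hU.continuous_uncurry.sub hV.continuous_uncurry
    have h1 := l2Le_intervalIntegral hd hcont h 0 (clampTime τ t)
    rw [sub_zero, abs_of_nonneg (hcl t)] at h1
    have h2 : ∀ a, displacement τ U t a - displacement τ V t a =
        ∫ s in (0 : ℝ)..clampTime τ t, (U s a - V s a) := fun a =>
      (intervalIntegral.integral_sub ((hU.continuous_time a).intervalIntegrable _ _)
        ((hV.continuous_time a).intervalIntegrable _ _)).symm
    simp_rw [h2]
    refine h1.mono ?_
    have := (clampTime_le hτ.τ_pos.le t).trans hτ.τ_le_one
    nlinarith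
  have haU := lipPath_acceleration hτ hU
  have haV := lipPath_acceleration hτ hV
  have hacc : ∀ t, L2Le (lagConst δ (2 * M) * (d + d))
      (fun a => acceleration τ U t a - acceleration τ V t a) := fun t =>
    l2Le_lagHilbert_sub hτ.δ_pos hτ.δ_lt_one (holderC1_displacement hτ hU t)
      (holderC1_displacement hτ hV t) (hU.holder t) (hV.holder t) (hU.l2 t) (hV.l2 t) hd hd
      (hdisp t) (h t)
  have hcont : Continuous (Function.uncurry fun s a => acceleration τ U s a - acceleration τ V s a) :=
    haU.continuous_uncurry.sub haV.continuous_uncurry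
  have h1 := l2Le_intervalIntegral (by positivity) hcont hacc 0 (clampTime τ t)
  rw [sub_zero, abs_of_nonneg (hcl t)] at h1
  have h2 : ∀ a, picardMap τ u₀ U t a - picardMap τ u₀ V t a =
      ∫ s in (0 : ℝ)..clampTime τ t, (acceleration τ U s a - acceleration τ V s a) := fun a => by
    rw [picardMap, picardMap, add_sub_add_left_eq_sub]
    exact (intervalIntegral.integral_sub ((haU.continuous_time a).intervalIntegrable _ _)
        ((haV.continuous_time a).intervalIntegrable _ _)).symm
  simp_rw [h2]
  refine h1.mono ?_
  -- Since τ ≤ 1, the displacements too differ by at most d, whence the 2d; `contraction` was set up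
  -- to bring the product below d / 2.
  calc lagConst δ (2 * M) * (d + d) * clampTime τ t ≤ lagConst δ (2 * M) * (d + d) * τ := by
        gcongr; exact clampTime_le hτ.τ_pos.le t
    _ = τ * (lagConst δ (2 * M) * 2) * d := by ring
    _ ≤ 1 / 2 * d := by gcongr; exact hτ.contraction
    _ = d / 2 := by ring

/-- The Picard iterates. -/
def picardIter (τ : ℝ) (u₀ : ℝ → ℝ) : ℕ → ℝ → ℝ → ℝ
  | 0 => fun _ => u₀
  | n + 1 => picardMap τ u₀ (picardIter τ u₀ n)

theorem velocityPath_picardIter (hτ : SmallTime δ M τ) (hu₀ : HolderC1 δ M u₀) (hu₀' : L2Le M u₀)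
    (n : ℕ) : VelocityPath δ M (picardIter τ u₀ n) := by
  induction n with
  | zero =>
    refine ⟨fun t => hu₀.mono (by linarith [hτ.M_pos]), fun t => hu₀'.mono (by linarith [hτ.M_pos]),
      fun t s => ?_⟩
    simp only [picardIter, sub_self]
    exact ⟨MemLp.zero', by simp⟩
  | succ n ih => exact velocityPath_picardMap hτ hu₀ hu₀' ih

theorem l2Le_picardIter_succ_sub (hτ : SmallTime δ M τ) (hu₀ : HolderC1 δ M u₀)
    (hu₀' : L2Le M u₀) (n : ℕ) (t : ℝ) :
    L2Le (4 * M * (1 / 2) ^ n) (fun a => picardIter τ u₀ (n + 1) t a - picardIter τ u₀ n t a) := by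
  have hM := hτ.M_pos
  have hp := velocityPath_picardIter hτ hu₀ hu₀'
  induction n generalizing t with
  | zero =>
    exact (((hp 1).l2 t).sub ((hp 0).l2 t) (by positivity) (by positivity)).mono (by norm_num; linarith)
  | succ n ih =>
    exact (l2Le_picardMap_sub hτ (hp (n + 1)) (hp n) (by positivity) ih t).mono
      (le_of_eq (by rw [pow_succ]; ring))

theorem l2Le_picardIter_sub (hτ : SmallTime δ M τ) (hu₀ : HolderC1 δ M u₀)
    (hu₀' : L2Le M u₀) (n k : ℕ) (t : ℝ) :
    L2Le (8 * M * (1 / 2) ^ n) (fun a => picardIter τ u₀ (n + k) t a - picardIter τ u₀ n t a) := by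
  have hM := hτ.M_pos
  -- The factor 1 - 2^{-k} is the exact partial geometric sum, which the induction on k needs.
  suffices h : L2Le (8 * M * (1 / 2) ^ n * (1 - (1 / 2) ^ k))
      (fun a => picardIter τ u₀ (n + k) t a - picardIter τ u₀ n t a) by
    refine h.mono ?_
    have : 0 ≤ 8 * M * (1 / 2 : ℝ) ^ n * (1 / 2) ^ k := by positivity
    linarith
  induction k with
  | zero =>
    simp only [Nat.add_zero, sub_self]
    exact ⟨MemLp.zero', by simp⟩
  | succ k ih =>
    have h1 : (1 / 2 : ℝ) ^ k ≤ 1 := pow_le_one₀ (by norm_num) (by norm_num)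
    have h := (l2Le_picardIter_succ_sub hτ hu₀ hu₀' (n + k) t).add ih (by positivity)
      (mul_nonneg (by positivity) (by linarith))
    simp only [sub_add_sub_cancel] at h
    exact h.mono (le_of_eq (by rw [pow_succ, pow_add]; ring))

/-- The interpolation inequality bounds the cube of the supremum by the Lipschitz constant times the
squared L² norm, a multiple of 4^{-n}. The ratio 2/3 is a convenient number whose cube, 8/27,
exceeds 1/4. -/
theorem abs_picardIter_sub_le (hτ : SmallTime δ M τ) (hu₀ : HolderC1 δ M u₀)
    (hu₀' : L2Le M u₀) (n : ℕ) (t a : ℝ) :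
    |picardIter τ u₀ n t a - picardIter τ u₀ (n + 1) t a| ≤ 8 * M * (2 / 3) ^ n := by
  have hM := hτ.M_pos
  have hp := velocityPath_picardIter hτ hu₀ hu₀'
  have hd := l2Le_picardIter_succ_sub hτ hu₀ hu₀' n t
  have h1 := abs_pow_three_le (K := 2 * M + 2 * M) (by positivity) hd.1
    (((hp (n + 1)).holder t).sub ((hp n).holder t)).abs_sub_le a
  have h2 := hd.integral_sq_le (by positivity)
  rw [abs_sub_comm]
  refine le_of_pow_le_pow_left₀ (n := 3) (by norm_num) (by positivity) (h1.trans ?_)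
  calc _ ≤ 4 * (2 * M + 2 * M) * (4 * M * (1 / 2) ^ n) ^ 2 := by gcongr
    _ = 256 * M ^ 3 * (1 / 4) ^ n := by
      rw [mul_pow, ← pow_mul, mul_comm n 2, pow_mul]; norm_num; ring
    _ ≤ 512 * M ^ 3 * (8 / 27) ^ n := by
      have h3 : (1 / 4 : ℝ) ^ n ≤ (8 / 27) ^ n :=
        pow_le_pow_left₀ (by norm_num) (by norm_num) n
      gcongr
      norm_num
    _ = (8 * M * (2 / 3) ^ n) ^ 3 := by
      rw [mul_pow, ← pow_mul, mul_comm n 3, pow_mul]; norm_num; ring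

/-- The Picard iteration converges: the Lagrangian form of the equation has a solution. -/
theorem exists_velocityPath (hτ : SmallTime δ M τ) (hu₀ : HolderC1 δ M u₀) (hu₀' : L2Le M u₀) :
    ∃ U, VelocityPath δ M U ∧ ∀ t a, U t a = picardMap τ u₀ U t a := by
  have hM := hτ.M_pos
  have hp := velocityPath_picardIter hτ hu₀ hu₀'
  have hex : ∀ t a, ∃ L, Tendsto (fun n => picardIter τ u₀ n t a) atTop (𝓝 L) := fun t a =>
    cauchySeq_tendsto_of_complete (cauchySeq_of_le_geometric (2 / 3) (8 * M) (by norm_num)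
      fun n => by rw [Real.dist_eq]; exact abs_picardIter_sub_le hτ hu₀ hu₀' n t a)
  choose U hU using hex
  -- All bounds defining the class are closed under pointwise limits, so the limit belongs to it
  -- although convergence holds only in weaker norms.
  have hUp : VelocityPath δ M U := by
    refine ⟨fun t => ?_, fun t => ?_, fun t s => ?_⟩
    · exact (HolderC1.of_tendsto hτ.δ_pos (Eventually.of_forall fun n => (hp n).holder t) (hU t)).1
    · exact L2Le.of_tendsto (Eventually.of_forall fun n => (hp n).l2 t) (hU t)
    · exact L2Le.of_tendsto (Eventually.of_forall fun n => (hp n).lip t s)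
        fun a => (hU t a).sub (hU s a)
  refine ⟨U, hUp, fun t a => ?_⟩
  have hdiff : ∀ n t, L2Le (8 * M * (1 / 2) ^ n) (fun a => U t a - picardIter τ u₀ n t a) := by
    intro n t
    refine L2Le.of_tendsto (l := atTop) (Eventually.of_forall fun k =>
      l2Le_picardIter_sub hτ hu₀ hu₀' n k t) fun a => ?_
    refine Tendsto.sub_const ?_ _
    have := (hU t a).comp (tendsto_add_atTop_nat n)
    refine this.congr fun k => ?_
    simp only [Function.comp, add_comm k n]
  -- Compare U with iterate n + 1, and the image of iterate n with the image of U. The defect in the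
  -- fixed point equation is thus O(2^{-n}) in L² for every n; interpolation then makes it zero
  -- pointwise.
  have hfin : ∀ n, L2Le (8 * M * (1 / 2) ^ n + 8 * M * (1 / 2) ^ n)
      (fun a => U t a - picardMap τ u₀ U t a) := by
    intro n
    have h1 := l2Le_picardMap_sub (u₀ := u₀) hτ (hp n) hUp (d := 8 * M * (1 / 2) ^ n) (by positivity)
      (fun t => (hdiff n t).of_abs_le
        (((hp n).holder t).continuous.sub (hUp.holder t).continuous).aestronglyMeasurable
        fun a => (abs_sub_comm _ _).le) t
    have h2 := (hdiff (n + 1) t).add h1 (by positivity) (by positivity)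
    simp only [picardIter, sub_add_sub_cancel] at h2
    refine h2.mono ?_
    have : 0 ≤ 8 * M * (1 / 2 : ℝ) ^ n := by positivity
    rw [pow_succ]; linarith
  have hsub := ((hUp.holder t).sub ((velocityPath_picardMap hτ hu₀ hu₀' hUp).holder t)).abs_sub_le
  have h3 : ∀ n : ℕ, |U t a - picardMap τ u₀ U t a| ^ 3 ≤
      4 * (2 * M + 2 * M) * (8 * M * (1 / 2) ^ n + 8 * M * (1 / 2) ^ n) ^ 2 := fun n =>
    (abs_pow_three_le (by positivity) (hfin n).1 hsub a).trans
      (by gcongr; exact (hfin n).integral_sq_le (by positivity))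
  have h4 : Tendsto (fun n : ℕ => 4 * (2 * M + 2 * M) *
      (8 * M * (1 / 2 : ℝ) ^ n + 8 * M * (1 / 2) ^ n) ^ 2) atTop (𝓝 0) := by
    have h5 := (tendsto_pow_atTop_nhds_zero_of_lt_one (r := (1 / 2 : ℝ)) (by norm_num)
      (by norm_num)).const_mul (8 * M)
    simpa using ((h5.add h5).pow 2).const_mul (4 * (2 * M + 2 * M))
  have h5 : |U t a - picardMap τ u₀ U t a| ^ 3 ≤ 0 := ge_of_tendsto' h4 h3
  have h6 := pow_eq_zero_iff (n := 3) (by norm_num) |>.1 (le_antisymm h5 (by positivity))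
  exact sub_eq_zero.1 (abs_eq_zero.1 h6)

/-- Local existence, with a time of existence depending only on the size of the data. -/
theorem exists_isSolution {δ : ℝ≥0} {M τ : ℝ} {u₀ : ℝ → ℝ} (hτ : SmallTime δ M τ)
    (hu₀ : HolderC1 δ M u₀) (hu₀' : L2Le M u₀) : ∃ u, IsSolution δ u₀ τ u := by
  have hM := hτ.M_pos
  have hδ0 := hτ.δ_pos
  have hδ1 := hτ.δ_lt_one
  obtain ⟨U, hU, hfix⟩ := exists_velocityPath hτ hu₀ hu₀'
  have hξ := holderC1_displacement hτ hU
  have hacc := lipPath_acceleration hτ hU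
  set u : ℝ → ℝ → ℝ := fun t => eulerian (displacement τ U t) (U t) with hu
  have huC : ∀ t, HolderC1 δ (16 * (2 * M)) (u t) := fun t =>
    holderC1_eulerian (hξ t) (hU.holder t) hδ0 hδ1
  have huL : ∀ t, L2Le (2 * (2 * M)) (u t) := fun t =>
    l2Le_eulerian hδ0 (hξ t) (hU.holder t).continuous (hU.l2 t) (by positivity)
  set C := 2 * (accBound δ M + 16 * (2 * M) * (2 * M)) with hC
  have hA := accBound_nonneg hτ
  have hulip : ∀ t s, L2Le (C * |t - s|) (fun x => u t x - u s x) := fun t s =>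
    (l2Le_eulerian_sub hδ0 hδ1 (hξ t) (hξ s) (hU.holder t) (hU.holder s) (by positivity)
      (by positivity) (l2Le_displacement_sub hτ hU t s) (hU.lip t s)).mono
      (le_of_eq (by rw [hC]; ring))
  have hup : LipPath δ (16 * (2 * M)) (2 * (2 * M)) C u := ⟨huC, huL, hulip⟩
  have hδ : (0 : ℝ≥0) < δ := by exact_mod_cast hδ0
  refine ⟨u, ?_, fun t _ => (huL t).1, fun s _ => ?_, fun t _ =>
    (memC1Holder_of_holderC1 hδ (huC t)).2, fun S _ => ⟨(3 * (16 * (2 * M))).toNNReal, fun t _ =>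
    (memC1Holder_of_holderC1 hδ (huC t)).1⟩, fun t ht x => ?_⟩
  · have h0 : displacement τ U 0 = fun _ => 0 := by
      ext a; simp [displacement, clampTime_of_mem le_rfl hτ.τ_pos.le]
    ext x
    have hx : flowInv (displacement τ U 0) x = x := by
      have := flowInv_flowMap (hξ 0) x
      simpa only [flowMap, h0, add_zero] using this
    simp only [hu, eulerian, hx]
    rw [hfix, picardMap, clampTime_of_mem le_rfl hτ.τ_pos.le]
    simp
  · exact (tendsto_eLpNorm_of_l2Le (tendsto_const_mul_abs_sub C s)
      (Eventually.of_forall fun t => hulip t s)).mono_left nhdsWithin_le_nhds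
  · set a := flowInv (displacement τ U t) x with ha
    have hcl : ∀ s ∈ Ico 0 τ, clampTime τ s = s := fun s hs => clampTime_of_mem hs.1 hs.2.le
    have hXt : flowMap (displacement τ U t) a = x := flowMap_flowInv (hξ t) x
    have hX : HasDerivWithinAt (fun s => flowMap (displacement τ U s) a) (U t a) (Ico 0 τ) t := by
      have h1 : HasDerivAt (fun s => a + ∫ r in (0 : ℝ)..s, U r a) (U t a) t :=
        ((hU.continuous_time a).integral_hasStrictDerivAt 0 t).hasDerivAt.const_add a
      refine h1.hasDerivWithinAt.congr_of_mem (fun s hs => ?_) ht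
      simp only [flowMap, displacement, hcl s hs]
    have hUt : HasDerivWithinAt (fun s => U s a) (acceleration τ U t a) (Ico 0 τ) t := by
      have h1 : HasDerivAt (fun s => u₀ a + ∫ r in (0 : ℝ)..s, acceleration τ U r a)
          (acceleration τ U t a) t :=
        ((hacc.continuous_time a).integral_hasStrictDerivAt 0 t).hasDerivAt.const_add _
      refine h1.hasDerivWithinAt.congr_of_mem (fun s hs => ?_) ht
      rw [hfix, picardMap, hcl s hs]
    -- The time derivative at the fixed point x is obtained as a difference: u_s(x) = u_s(X_s) -
    -- (u_s(X_s) - u_s(x)). The first term is U, with derivative the acceleration; the second is the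
    -- transport part, with derivative u u_x.
    have htr := hasDerivWithinAt_transport hδ0 ht (f := u)
      (X := fun s => flowMap (displacement τ U s) a) (fun s _ => huC s)
      (fun y => ((hup.continuous_time y).tendsto t).mono_left nhdsWithin_le_nhds) hX
    simp only [hXt] at htr
    have hus : ∀ s, u s (flowMap (displacement τ U s) a) = U s a := fun s =>
      eulerian_flowMap (hξ s) (U s) a
    have hG : acceleration τ U t a = hilbertTransform (u t) x := by
      rw [acceleration, lagHilbert, hXt]
    have hUx : U t a = u t x := rfl
    have := hUt.sub htr
    rw [hG, hUx, mul_comm (deriv (u t) x)] at this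
    refine this.congr_of_mem (fun s _ => ?_) ht
    simp only [Pi.sub_apply, hus, sub_sub_cancel]

end

/-! ### Solutions as continuous paths, and the L² energy identity. -/

section

variable {δ M : ℝ} {g : ℝ → ℝ → ℝ}

/-- A path of functions, bounded in `C^{1+δ}` and in `L²`, and continuous in time with values in
`L²`. -/
structure ContPath (δ M : ℝ) (g : ℝ → ℝ → ℝ) : Prop where
  holder : ∀ t, HolderC1 δ M (g t)
  l2 : ∀ t, L2Le M (g t)
  cont : ∀ s, Tendsto (fun t => eLpNorm (g t - g s) 2 volume) (𝓝 s) (𝓝 0)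

namespace ContPath

theorem nonneg (h : ContPath δ M g) : 0 ≤ M := (h.holder 0).nonneg

theorem continuous_time (h : ContPath δ M g) (a : ℝ) : Continuous fun s => g s a :=
  continuous_iff_continuousAt.2 fun t =>
    tendsto_of_eLpNorm_tendsto (Eventually.of_forall h.holder) (h.holder t)
      (Eventually.of_forall fun s => (h.l2 s).1) (h.l2 t).1 (h.cont t) a

theorem continuous_uncurry (h : ContPath δ M g) : Continuous (Function.uncurry g) :=
  continuous_uncurry_of_lipschitz h.nonneg (fun s => (h.holder s).abs_sub_le) h.continuous_time

theorem continuous_deriv_time (h : ContPath δ M g) (hδ : 0 < δ) (a : ℝ) :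
    Continuous fun s => deriv (g s) a :=
  continuous_iff_continuousAt.2 fun t =>
    (HolderC1.of_tendsto hδ (Eventually.of_forall h.holder)
      fun x => (h.continuous_time x).tendsto t).2 a

theorem continuous_uncurry_deriv (h : ContPath δ M g) (hδ : 0 < δ) :
    Continuous (Function.uncurry fun s x => deriv (g s) x) := by
  refine continuous_iff_continuousAt.2 fun p => ?_
  obtain ⟨s, x⟩ := p
  rw [ContinuousAt, tendsto_iff_dist_tendsto_zero]
  have h1 : Continuous fun q : ℝ × ℝ => M * |q.2 - x| ^ δ + |deriv (g q.1) x - deriv (g s) x| := by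
    refine (continuous_const.mul (Continuous.rpow_const (by fun_prop) fun _ => Or.inr hδ.le)).add ?_
    exact (((h.continuous_deriv_time hδ x).comp continuous_fst).sub continuous_const).abs
  have h2 := h1.tendsto (s, x)
  simp only [sub_self, abs_zero, Real.zero_rpow hδ.ne', mul_zero, add_zero] at h2
  refine squeeze_zero (fun _ => dist_nonneg) (fun q => ?_) h2
  simp only [Function.uncurry, Real.dist_eq]
  refine (abs_sub_le _ (deriv (g q.1) x) _).trans ?_
  gcongr
  exact (h.holder q.1).holder q.2 x

/-- Continuity in time with values in L² is inherited because H is linear and an L² contraction. -/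
theorem hilbert (h : ContPath δ M g) (hδ0 : 0 < δ) (hδ1 : δ < 1) :
    ContPath δ (hilbertBound δ M) (fun t => hilbertTransform (g t)) where
  holder t := holderC1_hilbertTransform (h.holder t) (h.l2 t) hδ0 hδ1
  l2 t := by
    have hM := h.nonneg
    refine (l2Le_hilbertTransform (h.holder t) (h.l2 t) hM).mono ?_
    have h1 := holderConst_nonneg δ
    have h2 : 0 ≤ 2 * M * holderConst δ / δ := by positivity
    have h3 : 0 ≤ 2 * M * holderConst δ * (2 / δ + 1) := by positivity
    have h4 := Real.pi_gt_three
    unfold hilbertBound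
    nlinarith [sq_nonneg M]
  cont s := by
    refine tendsto_of_tendsto_of_tendsto_of_le_of_le tendsto_const_nhds (h.cont s)
      (fun _ => zero_le) fun t => ?_
    have hmem : MemLp (fun x => g t x - g s x) 2 volume := (h.l2 t).1.sub (h.l2 s).1
    have h1 := l2Le_hilbertTransform ((h.holder t).sub (h.holder s)) (l2Le_self hmem)
      ENNReal.toReal_nonneg
    have h2 := h1.2
    rw [ENNReal.ofReal_toReal hmem.2.ne] at h2
    have h3 : (hilbertTransform fun x => g t x - g s x) =
        hilbertTransform (g t) - hilbertTransform (g s) := funext fun x =>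
      hilbertTransform_sub (h.holder t) (h.l2 t).1 (h.holder s) (h.l2 s).1 x
    rw [h3] at h2
    exact h2

end ContPath

/-- Continuity of the `L²` norm from continuity in `L²`. -/
theorem continuous_toReal_eLpNorm {g : ℝ → ℝ → ℝ} (hg : ∀ t, MemLp (g t) 2 volume)
    (hc : ∀ s, Tendsto (fun t => eLpNorm (g t - g s) 2 volume) (𝓝 s) (𝓝 0)) :
    Continuous fun t => (eLpNorm (g t) 2 volume).toReal := by
  refine continuous_iff_continuousAt.2 fun s => ?_
  rw [ContinuousAt, tendsto_iff_dist_tendsto_zero]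
  have h1 : Tendsto (fun t => (eLpNorm (g t - g s) 2 volume).toReal) (𝓝 s) (𝓝 0) := by
    have := (ENNReal.tendsto_toReal ENNReal.zero_ne_top).comp (hc s)
    rwa [ENNReal.toReal_zero] at this
  refine squeeze_zero (fun _ => dist_nonneg) (fun t => ?_) h1
  have tri : ∀ f h : ℝ → ℝ, MemLp f 2 volume → MemLp h 2 volume →
      (eLpNorm f 2 volume).toReal ≤ (eLpNorm h 2 volume).toReal +
        (eLpNorm (f - h) 2 volume).toReal := by
    intro f h hf hh
    rw [← ENNReal.toReal_add hh.2.ne (hf.sub hh).2.ne]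
    refine ENNReal.toReal_mono (ENNReal.add_ne_top.2 ⟨hh.2.ne, (hf.sub hh).2.ne⟩) ?_
    have := eLpNorm_add_le hh.1 (hf.sub hh).1 (p := 2) (by norm_num)
    rwa [add_sub_cancel] at this
  have h2 := tri _ _ (hg t) (hg s)
  have h3 := tri _ _ (hg s) (hg t)
  rw [eLpNorm_sub_comm] at h3
  rw [Real.dist_eq, abs_le]
  constructor <;> linarith

namespace IsSolution

variable {δ : ℝ≥0} {u₀ : ℝ → ℝ} {T : ℝ} {u : ℝ → ℝ → ℝ}

/-- On a compact time interval a solution is a bounded continuous path. -/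
theorem exists_contPath (h : IsSolution δ u₀ T u) {S : ℝ} (hS : S ∈ Ico 0 T) :
    ∃ M, ContPath δ M (fun t => u (clampTime S t)) := by
  obtain ⟨M, hM⟩ := h.locallyBounded S hS
  have hcl : ∀ t, clampTime S t ∈ Icc 0 S := fun t =>
    ⟨clampTime_nonneg S t, clampTime_le hS.1 t⟩
  have hclT : ∀ t, clampTime S t ∈ Ico 0 T := fun t => ⟨(hcl t).1, (hcl t).2.trans_lt hS.2⟩
  have hccl : Continuous (clampTime S) := by unfold clampTime; fun_prop
  have hcont : ∀ s, Tendsto (fun t => eLpNorm (u (clampTime S t) - u (clampTime S s)) 2 volume)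
      (𝓝 s) (𝓝 0) := fun s =>
    (h.continuous_L2 _ (hclT s)).comp (tendsto_nhdsWithin_iff.2
      ⟨hccl.tendsto s, Eventually.of_forall hclT⟩)
  have hn := continuous_toReal_eLpNorm (fun t => h.memLp _ (hclT t)) hcont
  -- The definition of a solution bounds only the C^{1+δ} norm; the L² bound comes from continuity
  -- on a compact time interval.
  obtain ⟨C, hC⟩ := isCompact_Icc.exists_bound_of_continuousOn (s := Icc 0 S) hn.continuousOn
  have hclcl : ∀ t, clampTime S (clampTime S t) = clampTime S t := fun t =>
    clampTime_of_mem (hcl t).1 (hcl t).2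
  refine ⟨max M C, fun t => ?_, fun t => ?_, hcont⟩
  · exact (holderC1_of_norm_le (h.memC1Holder _ (hclT t)) (hM _ (hcl t))).mono (le_max_left _ _)
  · refine (l2Le_self (h.memLp _ (hclT t))).mono ?_
    have := hC _ (hcl t)
    simp only [hclcl] at this
    exact (le_abs_self _).trans (this.trans (le_max_right _ _))

theorem hasDerivAt (h : IsSolution δ u₀ T u) {t : ℝ} (ht : t ∈ Ioo 0 T) (x : ℝ) :
    HasDerivAt (fun s => u s x) (hilbertTransform (u t) x - u t x * deriv (u t) x) t :=
  (h.equation t ⟨ht.1.le, ht.2⟩ x).hasDerivAt (Ico_mem_nhds ht.1 ht.2)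

theorem continuousOn_time (h : IsSolution δ u₀ T u) (x : ℝ) :
    ContinuousOn (fun s => u s x) (Ico 0 T) := fun t ht => (h.equation t ht x).continuousWithinAt

end IsSolution

/-- The fundamental theorem of calculus for integrals depending on time. -/
theorem integral_sub_eq_intervalIntegral {φ φ' : ℝ → ℝ → ℝ} {a b C : ℝ} (hab : a ≤ b)
    (hcont : ∀ x, ContinuousOn (fun s => φ s x) (Icc a b))
    (hderiv : ∀ x, ∀ r ∈ Ioo a b, HasDerivAt (fun s => φ s x) (φ' r x) r)
    (hφ' : Continuous (Function.uncurry φ')) (hint : ∀ r, Integrable (φ' r))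
    (hC : ∀ r, ∫ x, |φ' r x| ≤ C) (ha : Integrable (φ a)) (hb : Integrable (φ b)) :
    IntervalIntegrable (fun r => ∫ x, φ' r x) volume a b ∧
      (∫ x, φ b x) - ∫ x, φ a x = ∫ r in a..b, ∫ x, φ' r x := by
  have hprod : Integrable (fun p : ℝ × ℝ => φ' p.1 p.2) ((volume.restrict (Ioc a b)).prod volume) := by
    have hm : AEStronglyMeasurable (fun p : ℝ × ℝ => φ' p.1 p.2)
      ((volume.restrict (Ioc a b)).prod volume) := hφ'.aestronglyMeasurable
    rw [integrable_prod_iff hm]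
    refine ⟨Eventually.of_forall hint, ?_⟩
    refine Integrable.mono' (g := fun _ => C) (by simp) hm.norm.integral_prod_right'
      (Eventually.of_forall fun s => ?_)
    rw [Real.norm_of_nonneg (integral_nonneg fun a => norm_nonneg _)]
    exact hC s
  have hswap := integral_integral_swap (f := fun s x => φ' s x) hprod
  have hftc : ∀ x, ∫ r in Ioc a b, φ' r x = φ b x - φ a x := by
    intro x
    rw [← intervalIntegral.integral_of_le hab]
    refine intervalIntegral.integral_eq_sub_of_hasDerivAt_of_le hab (hcont x) (hderiv x) ?_
    exact (hφ'.comp (continuous_id.prodMk continuous_const)).intervalIntegrable _ _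
  refine ⟨(intervalIntegrable_iff_integrableOn_Ioc_of_le hab).2 hprod.integral_prod_left, ?_⟩
  rw [intervalIntegral.integral_of_le hab, hswap, ← integral_sub hb ha]
  simp_rw [hftc]

/-- The derivative of p w² integrates to zero. It serves twice: with p a solution and w a difference
for the energy identity, and with p = w for conservation of the L² norm. -/
theorem integral_deriv_mul_sq {δ' M' : ℝ} {p w : ℝ → ℝ} (hδ : 0 < δ) (hδ' : 0 < δ')
    (hp : HolderC1 δ M p) (hw : HolderC1 δ' M' w) (hw2 : MemLp w 2 volume)
    (hp2 : MemLp p 2 volume) :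
    Integrable (fun x => deriv p x * w x ^ 2) ∧ Integrable (fun x => p x * (w x * deriv w x)) ∧
    2 * ∫ x, p x * (w x * deriv w x) = -∫ x, deriv p x * w x ^ 2 := by
  have hsq := hw2.integrable_sq
  have h1 : Integrable (fun x => p x * w x ^ 2) :=
    hsq.bdd_mul (c := M) hp.continuous.aestronglyMeasurable (Eventually.of_forall hp.abs_le)
  have h2 : Integrable (fun x => deriv p x * w x ^ 2) :=
    hsq.bdd_mul (c := M) (hp.continuous_deriv hδ).aestronglyMeasurable
      (Eventually.of_forall hp.abs_deriv_le)
  have h3 : Integrable (fun x => p x * (w x * deriv w x)) := by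
    have : Integrable fun x => deriv w x * (p x * w x) :=
      (integrable_mul_of_memLp_two hp2 hw2).bdd_mul (c := M')
        (hw.continuous_deriv hδ').aestronglyMeasurable (Eventually.of_forall hw.abs_deriv_le)
    exact this.congr (Eventually.of_forall fun x => by simp only; ring)
  refine ⟨h2, h3, ?_⟩
  have hd : ∀ x, HasDerivAt (fun x => p x * w x ^ 2)
      (deriv p x * w x ^ 2 + 2 * (p x * (w x * deriv w x))) x := fun x => by
    have := (hp.differentiable x).hasDerivAt.mul ((hw.differentiable x).hasDerivAt.pow 2)
    refine this.congr_deriv ?_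
    simp only [Nat.cast_ofNat, Pi.pow_apply]
    ring
  have h0 := integral_eq_zero_of_hasDerivAt_of_integrable hd (h2.add (h3.const_mul 2)) h1
  rw [integral_add h2 (h3.const_mul 2), integral_const_mul] at h0
  linarith

theorem memLp_mul_deriv {δ : ℝ} (hδ : 0 < δ) {f h : ℝ → ℝ} (hf : L2Le M f) (hh : HolderC1 δ M h) :
    L2Le (M * M) (fun x => f x * deriv h x) := by
  have h1 := hf.const_mul M
  rw [abs_of_nonneg hh.nonneg] at h1
  refine h1.of_abs_le (hf.1.1.mul (hh.continuous_deriv hδ).aestronglyMeasurable) fun x => ?_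
  rw [abs_mul, abs_mul, mul_comm, abs_of_nonneg hh.nonneg]
  exact mul_le_mul_of_nonneg_right (hh.abs_deriv_le x) (abs_nonneg _)

/-- The right-hand side of the Burgers–Hilbert equation. -/
def burgersRHS (f : ℝ → ℝ) (x : ℝ) : ℝ := hilbertTransform f x - f x * deriv f x

theorem l2Le_burgersRHS (hδ0 : 0 < δ) {f : ℝ → ℝ} (hf : HolderC1 δ M f)
    (hf2 : L2Le M f) : L2Le (M + M * M) (burgersRHS f) :=
  (l2Le_hilbertTransform hf hf2 hf.nonneg).sub (memLp_mul_deriv hδ0 hf2 hf) hf.nonneg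
    (mul_nonneg hf.nonneg hf.nonneg)

/-- The energy identity for the difference of two solutions. -/
theorem integral_energy (hδ0 : 0 < δ) (hδ1 : δ < 1) {f h : ℝ → ℝ} (hf : HolderC1 δ M f)
    (hf2 : L2Le M f) (hh : HolderC1 δ M h) (hh2 : L2Le M h) :
    ∫ x, 2 * ((f x - h x) * (burgersRHS f x - burgersRHS h x)) =
      ∫ x, (deriv f x - 2 * deriv h x) * (f x - h x) ^ 2 := by
  have hw := hf.sub hh
  have hw2 := hf2.1.sub hh2.1
  have hdw : ∀ x, deriv (fun x => f x - h x) x = deriv f x - deriv h x := fun x =>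
    deriv_sub (hf.differentiable x) (hh.differentiable x)
  obtain ⟨i1, i2, i3⟩ := integral_deriv_mul_sq hδ0 hδ0 hf hw hw2 hf2.1
  obtain ⟨j1, -, -⟩ := integral_deriv_mul_sq hδ0 hδ0 hh hw hw2 hh2.1
  have hH := integral_mul_hilbertTransform_self hw hw2 hδ0 hδ1
  have hHi : Integrable fun x => (f x - h x) * hilbertTransform (fun y => f y - h y) x :=
    integrable_mul_of_memLp_two hw2 (l2Le_hilbertTransform hw (l2Le_self hw2)
      ENNReal.toReal_nonneg).1
  -- With w = f - h, the nonlinearity is split as f f' - h h' = f w' + h' w, so that the only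
  -- derivative of w appears as w w' and can be integrated by parts. The Hilbert term pairs w with
  -- Hw and vanishes.
  have e : ∀ x, 2 * ((f x - h x) * (burgersRHS f x - burgersRHS h x)) =
      2 * ((f x - h x) * hilbertTransform (fun y => f y - h y) x) -
      2 * (f x * ((f x - h x) * deriv (fun x => f x - h x) x)) -
      2 * (deriv h x * (f x - h x) ^ 2) := fun x => by
    rw [hilbertTransform_sub hf hf2.1 hh hh2.1, hdw, burgersRHS, burgersRHS]; ring
  have k1 : Integrable fun x => 2 * ((f x - h x) * hilbertTransform (fun y => f y - h y) x) -
      2 * (f x * ((f x - h x) * deriv (fun x => f x - h x) x)) :=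
    (hHi.const_mul 2).sub (i2.const_mul 2)
  simp_rw [e]
  rw [integral_sub k1 (j1.const_mul 2), integral_sub (hHi.const_mul 2) (i2.const_mul 2),
    integral_const_mul, integral_const_mul, hH, i3]
  simp_rw [sub_mul, mul_assoc (2 : ℝ)]
  rw [integral_sub i1 (j1.const_mul 2)]
  ring

/-- The evolution of the `L²` distance of two solutions. -/
theorem IsSolution.integral_sq_sub {δ : ℝ≥0} {M : ℝ} (hδ0 : 0 < δ) (hδ1 : δ < 1)
    {u₀ v₀ : ℝ → ℝ} {T T' : ℝ} {u v : ℝ → ℝ → ℝ} (hu : IsSolution δ u₀ T u)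
    (hv : IsSolution δ v₀ T' v) {S : ℝ} (hS : 0 ≤ S) (hST : S < T) (hST' : S < T')
    (hcu : ContPath δ M (fun t => u (clampTime S t)))
    (hcv : ContPath δ M (fun t => v (clampTime S t))) {t : ℝ} (ht : t ∈ Icc 0 S) :
    IntervalIntegrable (fun r => ∫ x, (deriv (u (clampTime S r)) x - 2 * deriv (v (clampTime S r)) x) *
        (u (clampTime S r) x - v (clampTime S r) x) ^ 2) volume 0 t ∧
    (∫ x, (u t x - v t x) ^ 2) - ∫ x, (u₀ x - v₀ x) ^ 2 =
      ∫ r in (0 : ℝ)..t, ∫ x, (deriv (u (clampTime S r)) x - 2 * deriv (v (clampTime S r)) x) *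
        (u (clampTime S r) x - v (clampTime S r) x) ^ 2 := by
  have hδ0' : (0 : ℝ) < δ := by exact_mod_cast hδ0
  have hδ1' : (δ : ℝ) < 1 := by exact_mod_cast hδ1
  have hM := hcu.nonneg
  have hHu := hcu.hilbert hδ0' hδ1'
  have hHv := hcv.hilbert hδ0' hδ1'
  have hcl : ∀ s ∈ Icc 0 S, clampTime S s = s := fun s hs => clampTime_of_mem hs.1 hs.2
  have htS : Icc 0 t ⊆ Icc 0 S := Icc_subset_Icc_right ht.2
  have hR : ∀ r, L2Le ((M + M * M) + (M + M * M)) (fun x => burgersRHS (u (clampTime S r)) x -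
      burgersRHS (v (clampTime S r)) x) := fun r =>
    (l2Le_burgersRHS hδ0' (hcu.holder r) (hcu.l2 r)).sub
      (l2Le_burgersRHS hδ0' (hcv.holder r) (hcv.l2 r)) (by positivity) (by positivity)
  have hW : ∀ r, L2Le (M + M) (fun x => u (clampTime S r) x - v (clampTime S r) x) := fun r =>
    (hcu.l2 r).sub (hcv.l2 r) hM hM
  have hint : ∀ r, Integrable fun x => 2 * ((u (clampTime S r) x - v (clampTime S r) x) *
      (burgersRHS (u (clampTime S r)) x - burgersRHS (v (clampTime S r)) x)) := fun r =>
    (integrable_mul_of_memLp_two (hW r).1 (hR r).1).const_mul 2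
  have h := integral_sub_eq_intervalIntegral (a := 0) (b := t)
    (φ := fun s x => (u s x - v s x) ^ 2)
    (φ' := fun r x => 2 * ((u (clampTime S r) x - v (clampTime S r) x) *
      (burgersRHS (u (clampTime S r)) x - burgersRHS (v (clampTime S r)) x)))
    (C := 2 * ((M + M) ^ 2 + ((M + M * M) + (M + M * M)) ^ 2)) ht.1 ?_ ?_ ?_ hint ?_ ?_ ?_
  · simp_rw [fun r => integral_energy hδ0' hδ1' (hcu.holder r) (hcu.l2 r) (hcv.holder r) (hcv.l2 r)]
      at h
    rwa [hu.initial, hv.initial] at h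
  · intro x
    have h1 := (hu.continuousOn_time x).mono
      (fun s (hs : s ∈ Icc 0 t) => ⟨hs.1, (htS hs).2.trans_lt hST⟩)
    have h2 := (hv.continuousOn_time x).mono
      (fun s (hs : s ∈ Icc 0 t) => ⟨hs.1, (htS hs).2.trans_lt hST'⟩)
    exact (h1.sub h2).pow 2
  · intro x r hr
    have h1 := hu.hasDerivAt (t := r) ⟨hr.1, (hr.2.trans_le ht.2).trans hST⟩ x
    have h2 := hv.hasDerivAt (t := r) ⟨hr.1, (hr.2.trans_le ht.2).trans hST'⟩ x
    have h3 := (h1.sub h2).pow 2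
    refine h3.congr_deriv ?_
    rw [hcl r ⟨hr.1.le, hr.2.le.trans ht.2⟩]
    simp only [burgersRHS, Nat.cast_ofNat, Pi.sub_apply]
    ring
  · have c1 := hcu.continuous_uncurry
    have c2 := hcv.continuous_uncurry
    have c3 := hcu.continuous_uncurry_deriv hδ0'
    have c4 := hcv.continuous_uncurry_deriv hδ0'
    have c5 := hHu.continuous_uncurry
    have c6 := hHv.continuous_uncurry
    exact continuous_const.mul ((c1.sub c2).mul ((c5.sub (c1.mul c3)).sub (c6.sub (c2.mul c4))))
  · intro r
    have h1 : ∀ x, |2 * ((u (clampTime S r) x - v (clampTime S r) x) *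
      (burgersRHS (u (clampTime S r)) x - burgersRHS (v (clampTime S r)) x))| ≤
      2 * ((u (clampTime S r) x - v (clampTime S r) x) ^ 2 +
      (burgersRHS (u (clampTime S r)) x - burgersRHS (v (clampTime S r)) x) ^ 2) := fun x => by
      rw [abs_mul, abs_two]
      exact mul_le_mul_of_nonneg_left (abs_mul_le_sq_add_sq _ _) (by norm_num)
    refine (integral_mono (hint r).norm (((hW r).1.integrable_sq.add
      (hR r).1.integrable_sq).const_mul 2) h1).trans ?_
    rw [integral_const_mul]
    simp only [Pi.add_apply]
    rw [integral_add (hW r).1.integrable_sq (hR r).1.integrable_sq]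
    gcongr
    · exact (hW r).integral_sq_le (by positivity)
    · exact (hR r).integral_sq_le (by positivity)
  · have := (hW 0).1.integrable_sq
    rwa [hcl 0 ⟨le_rfl, hS⟩] at this
  · have := (hW t).1.integrable_sq
    rwa [hcl t ht] at this

end

/-! ### Uniqueness, conservation of the L² norm, continuation and the maximal solution. -/

section

theorem ContPath.mono {δ M N : ℝ} {g : ℝ → ℝ → ℝ} (h : ContPath δ M g) (hMN : M ≤ N) :
    ContPath δ N g :=
  ⟨fun t => (h.holder t).mono hMN, fun t => (h.l2 t).mono hMN, h.cont⟩

theorem ContPath.sub {δ M N : ℝ} {g k : ℝ → ℝ → ℝ} (hg : ContPath δ M g) (hk : ContPath δ N k) :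
    ContPath δ (M + N) (fun t x => g t x - k t x) where
  holder t := (hg.holder t).sub (hk.holder t)
  l2 t := (hg.l2 t).sub (hk.l2 t) hg.nonneg hk.nonneg
  cont s := by
    have h0 := (hg.cont s).add (hk.cont s)
    rw [add_zero] at h0
    refine tendsto_of_tendsto_of_tendsto_of_le_of_le tendsto_const_nhds h0
      (fun _ => zero_le) fun t => ?_
    have h1 := eLpNorm_sub_le ((hg.l2 t).1.sub (hg.l2 s).1).1 ((hk.l2 t).1.sub (hk.l2 s).1).1
      (p := 2) (by norm_num)
    refine le_trans (le_of_eq ?_) h1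
    congr 1; ext x; simp only [Pi.sub_apply]; ring

theorem ContPath.continuous_integral_sq {δ M : ℝ} {g : ℝ → ℝ → ℝ} (h : ContPath δ M g) :
    Continuous fun t => ∫ x, g t x ^ 2 := by
  have := (continuous_toReal_eLpNorm (fun t => (h.l2 t).1) h.cont).pow 2
  refine this.congr fun t => toReal_eLpNorm_two_sq (h.l2 t).1

namespace IsSolution

variable {δ : ℝ≥0} {u₀ : ℝ → ℝ} {T T' : ℝ} {u v : ℝ → ℝ → ℝ}

/-- Uniqueness of solutions. -/
theorem eq_of_isSolution (hδ0 : 0 < δ) (hδ1 : δ < 1) (hu : IsSolution δ u₀ T u)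
    (hv : IsSolution δ u₀ T' v) {t : ℝ} (h0 : 0 ≤ t) (hT : t < T) (hT' : t < T') : u t = v t := by
  obtain ⟨M₁, hcu⟩ := hu.exists_contPath (S := t) ⟨h0, hT⟩
  obtain ⟨M₂, hcv⟩ := hv.exists_contPath (S := t) ⟨h0, hT'⟩
  replace hcu := hcu.mono (le_max_left M₁ M₂)
  replace hcv := hcv.mono (le_max_right M₁ M₂)
  set M := max M₁ M₂
  have hM := hcu.nonneg
  have hw := hcu.sub hcv
  set E : ℝ → ℝ := fun s => ∫ x, (u (clampTime t s) x - v (clampTime t s) x) ^ 2 with hE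
  have hEc : Continuous E := hw.continuous_integral_sq
  have hE0 : ∀ s, 0 ≤ E s := fun s => integral_nonneg fun x => sq_nonneg _
  have hD : ∀ r, (∫ x, (deriv (u (clampTime t r)) x - 2 * deriv (v (clampTime t r)) x) *
        (u (clampTime t r) x - v (clampTime t r) x) ^ 2) ≤ 3 * M * E r := by
    intro r
    rw [hE, ← integral_const_mul]
    have hb : ∀ x, |deriv (u (clampTime t r)) x - 2 * deriv (v (clampTime t r)) x| ≤ 3 * M :=
      fun x => by
        have h1 := abs_le.1 ((hcu.holder r).abs_deriv_le x)
        have h2 := abs_le.1 ((hcv.holder r).abs_deriv_le x)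
        rw [abs_le]; constructor <;> linarith
    have hsq := (hw.l2 r).1.integrable_sq
    have hc : Continuous fun x =>
        deriv (u (clampTime t r)) x - 2 * deriv (v (clampTime t r)) x :=
      ((hcu.holder r).continuous_deriv hδ0).sub
        (continuous_const.mul ((hcv.holder r).continuous_deriv hδ0))
    refine integral_mono (hsq.bdd_mul (c := 3 * M) hc.aestronglyMeasurable
      (Eventually.of_forall hb)) (hsq.const_mul _) fun x => ?_
    exact mul_le_mul_of_nonneg_right ((le_abs_self _).trans (hb x)) (sq_nonneg _)
  have hEle : ∀ s ∈ Icc 0 t, E s ≤ 3 * M * ∫ r in (0 : ℝ)..s, E r := by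
    intro s hs
    obtain ⟨hi, h⟩ := integral_sq_sub hδ0 hδ1 hu hv h0 hT hT' hcu hcv hs
    have e1 : E s = ∫ x, (u s x - v s x) ^ 2 := by
      simp only [hE, clampTime_of_mem hs.1 hs.2]
    have e2 : ∫ x, (u₀ x - u₀ x) ^ 2 = 0 := by simp
    rw [e2, sub_zero] at h
    rw [e1, h, ← intervalIntegral.integral_const_mul]
    exact intervalIntegral.integral_mono_on hs.1 hi
      ((continuous_const.mul hEc).intervalIntegrable _ _) fun r _ => hD r
  -- Grönwall is applied to the primitive of E: the estimate on E is an integral inequality, and E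
  -- itself is only known to be continuous.
  have hF : ∀ s ∈ Icc 0 t, ∫ r in (0 : ℝ)..s, E r = 0 := by
    refine eq_zero_of_abs_deriv_le_mul_abs_self_of_eq_zero_right (f' := E) (K := 3 * M)
      (intervalIntegral.continuous_primitive (fun a b => hEc.intervalIntegrable a b) 0).continuousOn
      (fun s _ => (hEc.integral_hasStrictDerivAt 0 s).hasDerivAt.hasDerivWithinAt)
      intervalIntegral.integral_same fun s hs => ?_
    rw [Real.norm_of_nonneg (hE0 s), Real.norm_of_nonneg
      (intervalIntegral.integral_nonneg hs.1 fun r _ => hE0 r)]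
    exact hEle s ⟨hs.1, hs.2.le⟩
  have hEt := hEle t ⟨h0, le_rfl⟩
  rw [hF t ⟨h0, le_rfl⟩, mul_zero] at hEt
  have hcl : clampTime t t = t := clampTime_of_mem h0 le_rfl
  ext x
  have h3 := abs_pow_three_le (K := M + M + 1) (by positivity) (hw.l2 t).1 (fun a b =>
    ((hw.holder t).abs_sub_le a b).trans (mul_le_mul_of_nonneg_right (by linarith) (abs_nonneg _))) x
  have h4 : |u (clampTime t t) x - v (clampTime t t) x| ^ 3 ≤ 0 :=
    h3.trans (mul_nonpos_of_nonneg_of_nonpos (by positivity) hEt)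
  have h5 := pow_eq_zero_iff (n := 3) (by norm_num) |>.1 (le_antisymm h4 (by positivity))
  rw [hcl] at h5
  exact sub_eq_zero.1 (abs_eq_zero.1 h5)

end IsSolution

theorem holderC1_zero (δ : ℝ) : HolderC1 δ 0 (fun _ => 0) := by
  refine ⟨differentiable_const _, fun x => by simp, fun x => by simp, fun x y => by simp⟩

theorem hilbertTransform_zero (x : ℝ) : hilbertTransform (fun _ => 0) x = 0 := by
  have h := hilbertTransform_sub (holderC1_zero 1) MemLp.zero' (holderC1_zero 1) MemLp.zero' x
  simpa using h

theorem isSolution_zero {δ : ℝ≥0} (hδ : 0 < δ) (T : ℝ) :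
    IsSolution δ (fun _ => 0) T (fun _ _ => 0) where
  initial := rfl
  memLp _ _ := MemLp.zero'
  continuous_L2 _ _ := by simpa using tendsto_const_nhds
  memC1Holder _ _ := (memC1Holder_of_holderC1 hδ (holderC1_zero _)).2
  locallyBounded _ _ := ⟨0, fun _ _ => by
    simpa using (memC1Holder_of_holderC1 hδ (holderC1_zero δ)).1⟩
  equation t _ x := by
    simpa [hilbertTransform_zero] using hasDerivWithinAt_const t (Ico 0 T) (0 : ℝ)

namespace IsSolution

variable {δ : ℝ≥0} {u₀ : ℝ → ℝ} {T T' : ℝ} {u v : ℝ → ℝ → ℝ}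

/-- The `L²` norm is conserved. -/
theorem integral_sq_eq (hδ0 : 0 < δ) (hδ1 : δ < 1) (hu : IsSolution δ u₀ T u) {t : ℝ}
    (ht : t ∈ Ico 0 T) : ∫ x, u t x ^ 2 = ∫ x, u₀ x ^ 2 := by
  obtain ⟨M, hcu⟩ := hu.exists_contPath ht
  have hM := hcu.nonneg
  have hcv : ContPath δ M (fun _ _ => 0) :=
    ⟨fun _ => (holderC1_zero _).mono hM, fun _ => ⟨MemLp.zero', by simp⟩, fun s => by simp⟩
  obtain ⟨-, h⟩ := integral_sq_sub hδ0 hδ1 hu (isSolution_zero hδ0 T) ht.1 ht.2 ht.2 hcu hcv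
    (t := t) ⟨ht.1, le_rfl⟩
  have h0 : ∀ r, ∫ x, (deriv (u (clampTime t r)) x - 2 * deriv (fun _ : ℝ => (0 : ℝ)) x) *
        (u (clampTime t r) x - 0) ^ 2 = 0 := by
    intro r
    have hδ' : (0 : ℝ) < δ := by exact_mod_cast hδ0
    -- Against the zero solution the energy identity leaves ∫ u_x u². Integration by parts with p =
    -- w = u says that twice this integral equals its negative.
    obtain ⟨-, -, h3⟩ := integral_deriv_mul_sq hδ' hδ' (hcu.holder r) (hcu.holder r)
      (hcu.l2 r).1 (hcu.l2 r).1
    have e : ∀ x, u (clampTime t r) x * (u (clampTime t r) x * deriv (u (clampTime t r)) x) =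
      deriv (u (clampTime t r)) x * u (clampTime t r) x ^ 2 := fun x => by ring
    simp_rw [e] at h3
    simp only [deriv_const, mul_zero, sub_zero]
    linarith
  simp_rw [h0] at h
  simp only [sub_zero, intervalIntegral.integral_zero] at h
  linarith

/-- A function that locally coincides with solutions is a solution. -/
theorem of_forall_exists {w : ℝ → ℝ → ℝ} (hT : 0 < T)
    (h : ∀ t ∈ Ico 0 T, ∃ T' u, t < T' ∧ IsSolution δ u₀ T' u ∧ ∀ s ∈ Ico 0 T', s < T → w s = u s) :
    IsSolution δ u₀ T w := by
  refine ⟨?_, fun t ht => ?_, fun t ht => ?_, fun t ht => ?_, fun S hS => ?_, fun t ht x => ?_⟩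
  · obtain ⟨T', u, hT', hu, he⟩ := h 0 ⟨le_rfl, hT⟩
    rw [he 0 ⟨le_rfl, hT'⟩ hT, hu.initial]
  · obtain ⟨T', u, hT', hu, he⟩ := h t ht
    rw [he t ⟨ht.1, hT'⟩ ht.2]; exact hu.memLp t ⟨ht.1, hT'⟩
  · obtain ⟨T', u, hT', hu, he⟩ := h t ht
    have h1 : 𝓝[Ico 0 T] t ≤ 𝓝[Ico 0 T'] t :=
      nhdsWithin_le_iff.2 (mem_nhdsWithin.2 ⟨Iio T', isOpen_Iio, hT', fun s hs => ⟨hs.2.1, hs.1⟩⟩)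
    refine ((hu.continuous_L2 t ⟨ht.1, hT'⟩).mono_left h1).congr' ?_
    filter_upwards [self_mem_nhdsWithin, nhdsWithin_le_nhds (Iio_mem_nhds hT')] with s hs hs'
    rw [he s ⟨hs.1, hs'⟩ hs.2, he t ⟨ht.1, hT'⟩ ht.2]
  · obtain ⟨T', u, hT', hu, he⟩ := h t ht
    rw [he t ⟨ht.1, hT'⟩ ht.2]; exact hu.memC1Holder t ⟨ht.1, hT'⟩
  · obtain ⟨T', u, hT', hu, he⟩ := h S hS
    obtain ⟨M, hM⟩ := hu.locallyBounded S ⟨hS.1, hT'⟩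
    refine ⟨M, fun t ht => ?_⟩
    rw [he t ⟨ht.1, ht.2.trans_lt hT'⟩ (ht.2.trans_lt hS.2)]
    exact hM t ht
  · obtain ⟨T', u, hT', hu, he⟩ := h t ht
    have h1 : 𝓝[Ico 0 T] t ≤ 𝓝[Ico 0 T'] t :=
      nhdsWithin_le_iff.2 (mem_nhdsWithin.2 ⟨Iio T', isOpen_Iio, hT', fun s hs => ⟨hs.2.1, hs.1⟩⟩)
    have h2 : HasDerivWithinAt (fun s => u s x) (hilbertTransform (u t) x - u t x * deriv (u t) x)
        (Ico 0 T) t := (hu.equation t ⟨ht.1, hT'⟩ x).mono_of_mem_nhdsWithin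
          (nhdsWithin_le_iff.1 h1)
    rw [he t ⟨ht.1, hT'⟩ ht.2]
    refine h2.congr_of_eventuallyEq ?_ (by rw [he t ⟨ht.1, hT'⟩ ht.2])
    filter_upwards [self_mem_nhdsWithin, nhdsWithin_le_nhds (Iio_mem_nhds hT')] with s hs hs'
    rw [he s ⟨hs.1, hs'⟩ hs.2]

theorem hasDerivWithinAt_shift {f : ℝ → ℝ} {f' c t : ℝ} {A B : Set ℝ}
    (h : HasDerivWithinAt f f' A (t + c)) (hAB : MapsTo (fun s => s + c) B A) :
    HasDerivWithinAt (fun s => f (s + c)) f' B t := by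
  have h1 : HasDerivWithinAt (fun s => s + c) 1 B t := (hasDerivWithinAt_id t B).add_const c
  have h2 := HasDerivWithinAt.comp t h h1 hAB
  rw [mul_one] at h2
  exact h2

/-- A solution started at a later time. -/
theorem shift (hu : IsSolution δ u₀ T u) {t₀ : ℝ} (ht₀ : t₀ ∈ Ico 0 T) :
    IsSolution δ (u t₀) (T - t₀) (fun s => u (s + t₀)) := by
  have hmaps : MapsTo (fun s => s + t₀) (Ico 0 (T - t₀)) (Ico 0 T) := fun s hs =>
    ⟨add_nonneg hs.1 ht₀.1, by linarith [hs.2]⟩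
  refine ⟨by simp, fun t ht => hu.memLp _ (hmaps ht), fun t ht => ?_, fun t ht =>
    hu.memC1Holder _ (hmaps ht), fun S hS => ?_, fun t ht x => ?_⟩
  · refine (hu.continuous_L2 _ (hmaps ht)).comp (tendsto_nhdsWithin_iff.2 ⟨?_, ?_⟩)
    · exact ((continuous_id.add continuous_const).tendsto t).mono_left nhdsWithin_le_nhds
    · filter_upwards [self_mem_nhdsWithin] with s hs using hmaps hs
  · obtain ⟨M, hM⟩ := hu.locallyBounded _ (hmaps hS)
    exact ⟨M, fun t ht => hM _ ⟨add_nonneg ht.1 ht₀.1, by linarith [ht.2]⟩⟩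
  · exact hasDerivWithinAt_shift (hu.equation _ (hmaps ht) x) hmaps

/-- Continuation of a solution. -/
theorem concat (hδ0 : 0 < δ) (hδ1 : δ < 1) (hu : IsSolution δ u₀ T u) {t₀ τ : ℝ}
    (ht₀ : t₀ ∈ Ico 0 T) (hv : IsSolution δ (u t₀) τ v) (hτ : T < t₀ + τ) :
    ∃ w, IsSolution δ u₀ (t₀ + τ) w := by
  -- The second solution starts strictly before T, and by uniqueness the two agree on the overlap.
  -- Around each time one of them describes w alone, so no matching of derivatives at T is needed.
  have hagree : ∀ s ∈ Ico t₀ T, v (s - t₀) = u s := fun s hs => by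
    have := hv.eq_of_isSolution hδ0 hδ1 (hu.shift ht₀) (t := s - t₀) (by linarith [hs.1])
      (by linarith [hs.2]) (by linarith [hs.2])
    simpa using this
  set w : ℝ → ℝ → ℝ := fun t => if t < T then u t else v (t - t₀) with hw
  have hw1 : ∀ t, t < T → w t = u t := fun t ht => if_pos ht
  have hw2 : ∀ t, t₀ ≤ t → w t = v (t - t₀) := fun t ht => by
    by_cases h : t < T
    · rw [hw1 t h, hagree t ⟨ht, h⟩]
    · exact if_neg h
  have hnhd : ∀ t < T, 𝓝[Ico 0 (t₀ + τ)] t ≤ 𝓝[Ico 0 T] t := fun t ht =>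
    nhdsWithin_le_iff.2 (mem_nhdsWithin.2 ⟨Iio T, isOpen_Iio, ht, fun s hs => ⟨hs.2.1, hs.1⟩⟩)
  have hmem : ∀ t ∈ Ico 0 (t₀ + τ), ¬ t < T → t - t₀ ∈ Ico 0 τ := fun t ht h =>
    ⟨by linarith [ht₀.2], by linarith [ht.2]⟩
  refine ⟨w, ?_, fun t ht => ?_, fun t ht => ?_, fun t ht => ?_, fun S hS => ?_, fun t ht x => ?_⟩
  · rw [hw1 0 (ht₀.1.trans_lt ht₀.2), hu.initial]
  · by_cases h : t < T
    · rw [hw1 t h]; exact hu.memLp t ⟨ht.1, h⟩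
    · rw [hw2 t (by linarith [ht₀.2])]; exact hv.memLp _ (hmem t ht h)
  · by_cases h : t < T
    · refine ((hu.continuous_L2 t ⟨ht.1, h⟩).mono_left (hnhd t h)).congr' ?_
      filter_upwards [nhdsWithin_le_nhds (Iio_mem_nhds h)] with s hs
      rw [hw1 s hs, hw1 t h]
    · have ht0 : t₀ < t := by linarith [ht₀.2]
      have hlim : Tendsto (fun s => s - t₀) (𝓝[Ico 0 (t₀ + τ)] t) (𝓝[Ico 0 τ] (t - t₀)) := by
        refine tendsto_nhdsWithin_iff.2 ⟨((continuous_id.sub continuous_const).tendsto t).mono_left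
          nhdsWithin_le_nhds, ?_⟩
        filter_upwards [self_mem_nhdsWithin, nhdsWithin_le_nhds (Ioi_mem_nhds ht0)] with s hs hs'
        have hs' : t₀ < s := hs'
        exact ⟨by linarith, by linarith [hs.2]⟩
      refine ((hv.continuous_L2 _ (hmem t ht h)).comp hlim).congr' ?_
      filter_upwards [nhdsWithin_le_nhds (Ioi_mem_nhds ht0)] with s hs
      have hs : t₀ < s := hs
      rw [hw2 s hs.le, hw2 t ht0.le]; rfl
  · by_cases h : t < T
    · rw [hw1 t h]; exact hu.memC1Holder t ⟨ht.1, h⟩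
    · rw [hw2 t (by linarith [ht₀.2])]; exact hv.memC1Holder _ (hmem t ht h)
  · obtain ⟨M₁, hM₁⟩ := hu.locallyBounded t₀ ht₀
    obtain ⟨M₂, hM₂⟩ := hv.locallyBounded (max 0 (S - t₀))
      ⟨le_max_left _ _, max_lt (by linarith [ht₀.2]) (by linarith [hS.2])⟩
    refine ⟨max M₁ M₂, fun t ht => ?_⟩
    rcases le_total t t₀ with h | h
    · rw [hw1 t (h.trans_lt ht₀.2)]
      exact (hM₁ t ⟨ht.1, h⟩).trans (by exact_mod_cast le_max_left _ _)
    · rw [hw2 t h]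
      refine (hM₂ _ ⟨by linarith, ?_⟩).trans (by exact_mod_cast le_max_right _ _)
      exact le_max_of_le_right (by linarith [ht.2])
  · by_cases h : t < T
    · have h2 := (hu.equation t ⟨ht.1, h⟩ x).mono_of_mem_nhdsWithin (nhdsWithin_le_iff.1 (hnhd t h))
      rw [hw1 t h]
      refine h2.congr_of_eventuallyEq ?_ (by rw [hw1 t h])
      filter_upwards [nhdsWithin_le_nhds (Iio_mem_nhds h)] with s hs
      rw [hw1 s hs]
    · have ht0 : t₀ < t := by linarith [ht₀.2]
      have hm := hmem t ht h
      have h1 := hv.hasDerivAt (t := t - t₀) ⟨by linarith, hm.2⟩ x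
      have h2 : HasDerivAt (fun s => v (s - t₀) x) (hilbertTransform (v (t - t₀)) x -
        v (t - t₀) x * deriv (v (t - t₀)) x) t := by
        have h3 := HasDerivAt.comp t h1 ((hasDerivAt_id t).sub_const t₀)
        rw [mul_one] at h3
        exact h3
      rw [hw2 t ht0.le]
      refine (h2.congr_of_eventuallyEq ?_).hasDerivWithinAt
      filter_upwards [Ioi_mem_nhds ht0] with s hs
      have hs : t₀ < s := hs
      rw [hw2 s hs.le]

end IsSolution

/-- If the times of existence are bounded, there is a unique maximal solution, and its norm blows
up. -/
theorem exists_maximal {δ : ℝ≥0} (hδ0 : 0 < δ) (hδ1 : δ < 1) {u₀ : ℝ → ℝ}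
    (hL2 : MemLp u₀ 2 volume) (hC : MemC1Holder δ u₀) {Tmax : ℝ}
    (hbdd : ∀ T u, IsSolution δ u₀ T u → T ≤ Tmax) :
    ∃ T : ℝ, 0 < T ∧ ∃ u : ℝ → ℝ → ℝ, IsSolution δ u₀ T u ∧
      (∀ (T' : ℝ) (v : ℝ → ℝ → ℝ), IsSolution δ u₀ T' v →
        T' ≤ T ∧ ∀ t ∈ Ico 0 T', v t = u t) ∧
      Tendsto (fun t => c1HolderNorm δ (u t)) (𝓝[<] T) (𝓝 ∞) := by
  have hδ0' : (0 : ℝ) < δ := by exact_mod_cast hδ0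
  have hδ1' : (δ : ℝ) < 1 := by exact_mod_cast hδ1
  set N := (eLpNorm u₀ 2 volume).toReal with hN
  have hN0 : 0 ≤ N := ENNReal.toReal_nonneg
  -- One time step τ serves all data with L² norm at most N and C^{1+δ} norm at most x; this
  -- uniformity drives the blow-up criterion.
  have hloc : ∀ (x : ℝ≥0), ∃ τ, 0 < τ ∧ ∀ f, MemLp f 2 volume → (eLpNorm f 2 volume).toReal ≤ N →
      MemC1Holder δ f → c1HolderNorm δ f ≤ x → ∃ u, IsSolution δ f τ u := by
    intro x
    obtain ⟨τ, hτ⟩ := exists_smallTime hδ0' hδ1' (M := x + N + 1) (by positivity)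
    refine ⟨τ, hτ.τ_pos, fun f hf hfN hfC hfx => exists_isSolution hτ
      ((holderC1_of_norm_le hfC hfx).mono (by linarith)) ((l2Le_self hf).mono ?_)⟩
    have := x.2
    linarith [NNReal.coe_nonneg x]
  set 𝒯 : Set ℝ := {T | 0 < T ∧ ∃ u, IsSolution δ u₀ T u} with h𝒯
  have hne : 𝒯.Nonempty := by
    obtain ⟨τ, hτ0, hτ⟩ := hloc (c1HolderNorm δ u₀).toNNReal
    exact ⟨τ, hτ0, hτ u₀ hL2 le_rfl hC (ENNReal.coe_toNNReal hC.2.ne).ge⟩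
  have hba : BddAbove 𝒯 := ⟨Tmax, fun T hT => by obtain ⟨u, hu⟩ := hT.2; exact hbdd T u hu⟩
  set T := sSup 𝒯 with hTdef
  have hle : ∀ T' ∈ 𝒯, T' ≤ T := fun T' h => le_csSup hba h
  have hT0 : 0 < T := by obtain ⟨T', h⟩ := hne; exact h.1.trans_le (hle T' h)
  -- By uniqueness all solutions alive at time t have the same value there. Where none is alive the
  -- value 0 is arbitrary.
  have hex : ∀ t : ℝ, ∃ f : ℝ → ℝ, 0 ≤ t → ∀ T' u, IsSolution δ u₀ T' u → t < T' → f = u t := by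
    intro t
    by_cases h : ∃ T' u, IsSolution δ u₀ T' u ∧ t < T'
    · obtain ⟨T₁, u₁, h1, h2⟩ := h
      exact ⟨u₁ t, fun h0 T' u hu ht => h1.eq_of_isSolution hδ0 hδ1 hu h0 h2 ht⟩
    · push Not at h
      exact ⟨0, fun _ T' u hu ht => absurd ht (not_lt.2 (h T' u hu))⟩
  choose w hw using hex
  have hsol : IsSolution δ u₀ T w := by
    refine IsSolution.of_forall_exists hT0 fun t ht => ?_
    obtain ⟨T', hT', htT'⟩ := exists_lt_of_lt_csSup hne ht.2
    obtain ⟨u, hu⟩ := hT'.2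
    exact ⟨T', u, htT', hu, fun s hs _ => hw s hs.1 T' u hu hs.2⟩
  refine ⟨T, hT0, w, hsol, fun T' v hv => ⟨?_, fun t ht => (hw t ht.1 T' v hv ht.2).symm⟩, ?_⟩
  · rcases le_or_gt T' 0 with h | h
    · exact h.trans hT0.le
    · exact hle T' ⟨h, v, hv⟩
  · rw [ENNReal.tendsto_nhds_top_iff_nnreal]
    intro x
    -- If the norm failed to exceed x for t near T, there would be times t arbitrarily close to T
    -- with norm at most x. Restarting from one within τ of T, with the L² norm unchanged by
    -- conservation, would give a solution living beyond T.
    by_contra hcon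
    rw [not_eventually] at hcon
    obtain ⟨τ, hτ0, hτ⟩ := hloc x
    have hev : ∀ᶠ t in 𝓝[<] T, t ∈ Ioo (max 0 (T - τ)) T :=
      Ioo_mem_nhdsLT (max_lt hT0 (by linarith))
    obtain ⟨t, hx, ht⟩ := (hcon.and_eventually hev).exists
    have ht0 : 0 < t := (le_max_left _ _).trans_lt ht.1
    have htτ : T < t + τ := by linarith [(le_max_right 0 (T - τ)).trans_lt ht.1]
    have htI : t ∈ Ico 0 T := ⟨ht0.le, ht.2⟩
    have hwL := hsol.memLp t htI
    have hnorm : (eLpNorm (w t) 2 volume).toReal ≤ N := by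
      refine le_of_eq ((sq_eq_sq₀ ENNReal.toReal_nonneg hN0).1 ?_)
      rw [toReal_eLpNorm_two_sq hwL, hN, toReal_eLpNorm_two_sq hL2,
        hsol.integral_sq_eq hδ0 hδ1 htI]
    obtain ⟨v, hv⟩ := hτ (w t) hwL hnorm (hsol.memC1Holder t htI) (not_lt.1 hx)
    obtain ⟨z, hz⟩ := hsol.concat hδ0 hδ1 htI hv htτ
    have := hle (t + τ) ⟨by linarith, z, hz⟩
    linarith

end

/-! ### The regularized rate of change of Hu along a characteristic. -/

section

/-- The derivative of the conjugate Poisson kernel. -/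
def conjKernelDeriv (ε z : ℝ) : ℝ := (ε ^ 2 - z ^ 2) / (z ^ 2 + ε ^ 2) ^ 2

theorem hasDerivAt_conjKernel {ε : ℝ} (hε : 0 < ε) (z : ℝ) :
    HasDerivAt (conjKernel ε) (conjKernelDeriv ε z) z := by
  have hne : z ^ 2 + ε ^ 2 ≠ 0 := by positivity
  refine ((hasDerivAt_id z).div (((hasDerivAt_id z).pow 2).add_const (ε ^ 2)) hne).congr_deriv ?_
  simp only [conjKernelDeriv, id, Pi.pow_apply]
  congr 1
  push_cast
  ring

theorem continuous_conjKernelDeriv {ε : ℝ} (hε : 0 < ε) : Continuous (conjKernelDeriv ε) := by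
  unfold conjKernelDeriv
  exact Continuous.div (by fun_prop) (by fun_prop) (fun z => by positivity)

theorem abs_conjKernelDeriv_le {ε : ℝ} (hε : 0 < ε) (z : ℝ) :
    |conjKernelDeriv ε z| ≤ (z ^ 2 + ε ^ 2)⁻¹ := by
  have h : 0 < z ^ 2 + ε ^ 2 := by positivity
  rw [conjKernelDeriv, abs_div, abs_of_pos (a := (z ^ 2 + ε ^ 2) ^ 2) (by positivity),
    inv_eq_one_div, div_le_div_iff₀ (by positivity) h]
  have : |ε ^ 2 - z ^ 2| ≤ z ^ 2 + ε ^ 2 := by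
    rw [abs_le]; constructor <;> nlinarith [sq_nonneg z, sq_nonneg ε]
  nlinarith

theorem integrable_conjKernelDeriv {ε : ℝ} (hε : 0 < ε) : Integrable (conjKernelDeriv ε) :=
  (integrable_inv_sq hε).mono' (continuous_conjKernelDeriv hε).aestronglyMeasurable
    (Eventually.of_forall (abs_conjKernelDeriv_le hε))

theorem integral_conjKernelDeriv {ε : ℝ} (hε : 0 < ε) : ∫ z, conjKernelDeriv ε z = 0 := by
  have hlim : ∀ {l : Filter ℝ}, Tendsto (fun z : ℝ => |z|) l atTop →
      Tendsto (conjKernel ε) l (𝓝 0) := by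
    intro l hl
    refine squeeze_zero_norm (fun z => ?_) (tendsto_inv_atTop_zero.comp hl)
    rcases eq_or_ne z 0 with rfl | hz
    · simp [conjKernel]
    · have hz' : 0 < |z| := abs_pos.2 hz
      rw [conjKernel, Real.norm_eq_abs, abs_div, abs_of_pos (a := z ^ 2 + ε ^ 2) (by positivity),
        Function.comp_apply, inv_eq_one_div, div_le_div_iff₀ (by positivity) hz']
      nlinarith [sq_abs z, sq_nonneg ε]
  rw [integral_of_hasDerivAt_of_tendsto (hasDerivAt_conjKernel hε) (integrable_conjKernelDeriv hε)
    (hlim tendsto_abs_atBot_atTop) (hlim tendsto_abs_atTop_atTop), sub_zero]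

section

variable {δ M : ℝ} {f : ℝ → ℝ}

/-- The rate of change of `f y * conjKernel ε (x - y)` when `f` evolves by the Burgers–Hilbert
equation and `x` moves with the flow. -/
def kernelRate (ε : ℝ) (f : ℝ → ℝ) (x y : ℝ) : ℝ :=
  burgersRHS f y * conjKernel ε (x - y) + f y * (conjKernelDeriv ε (x - y) * f x)

theorem abs_kernelRate_le (hf : HolderC1 δ M f) {ε : ℝ} (hε : 0 < ε) (x y : ℝ) :
    |kernelRate ε f x y| ≤ burgersRHS f y ^ 2 + (1 + M * M) * ((x - y) ^ 2 + ε ^ 2)⁻¹ := by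
  have h1 := abs_mul_le_sq_add_sq (burgersRHS f y) (conjKernel ε (x - y))
  have h2 := conjKernel_sq_le hε (x - y)
  have h3 : |f y * (conjKernelDeriv ε (x - y) * f x)| ≤ M * (((x - y) ^ 2 + ε ^ 2)⁻¹ * M) := by
    rw [abs_mul, abs_mul]
    have hM := hf.nonneg
    gcongr
    exacts [hf.abs_le y, abs_conjKernelDeriv_le hε _, hf.abs_le x]
  rw [kernelRate]
  refine (abs_add_le _ _).trans ?_
  linarith

theorem integrable_kernelRate (hδ0 : 0 < δ) (hf : HolderC1 δ M f) (hf2 : MemLp f 2 volume)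
    {ε : ℝ} (hε : 0 < ε) (x : ℝ) : Integrable (kernelRate ε f x) := by
  have hK := hf.mono (le_max_left M (eLpNorm f 2 volume).toReal)
  have hK2 := (l2Le_self hf2).mono (le_max_right M (eLpNorm f 2 volume).toReal)
  refine (integrable_mul_of_memLp_two (l2Le_burgersRHS hδ0 hK hK2).1
    (memLp_conjKernel_sub hε x)).add ?_
  exact (((integrable_conjKernelDeriv hε).comp_sub_left x).mul_const (f x)).bdd_mul (c := M)
    hf.continuous.aestronglyMeasurable (Eventually.of_forall hf.abs_le)

/-- Integration by parts of f f' = (f²/2)'. The sign is positive because the kernel is evaluated at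
x - y. -/
theorem integral_mul_deriv_conjKernel (hδ0 : 0 < δ) (hf : HolderC1 δ M f) (hf2 : MemLp f 2 volume)
    {ε : ℝ} (hε : 0 < ε) (x : ℝ) :
    ∫ y, f y * deriv f y * conjKernel ε (x - y) =
      ∫ y, f y ^ 2 / 2 * conjKernelDeriv ε (x - y) := by
  have hd : ∀ y, HasDerivAt (fun y => f y ^ 2 / 2 * conjKernel ε (x - y))
      (f y * deriv f y * conjKernel ε (x - y) - f y ^ 2 / 2 * conjKernelDeriv ε (x - y)) y := by
    intro y
    have h1 := (((hf.differentiable y).hasDerivAt.pow 2).div_const 2)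
    have h2 := (hasDerivAt_conjKernel hε (x - y)).comp y ((hasDerivAt_id y).const_sub x)
    refine (h1.mul h2).congr_deriv ?_
    simp only [Pi.pow_apply, Function.comp_apply]
    push_cast
    ring
  have hK := hf.mono (le_max_left M (eLpNorm f 2 volume).toReal)
  have hK2 := (l2Le_self hf2).mono (le_max_right M (eLpNorm f 2 volume).toReal)
  have i1 : Integrable fun y => f y * deriv f y * conjKernel ε (x - y) :=
    integrable_mul_of_memLp_two (memLp_mul_deriv hδ0 hK2 hK).1 (memLp_conjKernel_sub hε x)
  have i2 : Integrable fun y => f y ^ 2 / 2 * conjKernelDeriv ε (x - y) := by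
    refine ((integrable_conjKernelDeriv hε).comp_sub_left x).bdd_mul (c := M ^ 2 / 2)
      ((hf.continuous.pow 2).div_const 2).aestronglyMeasurable (Eventually.of_forall fun y => ?_)
    rw [Real.norm_of_nonneg (by positivity)]
    have := pow_le_pow_left₀ (abs_nonneg _) (hf.abs_le y) 2
    rw [sq_abs] at this
    linarith
  have i3 : Integrable fun y => f y ^ 2 / 2 * conjKernel ε (x - y) := by
    refine (integrable_mul_of_memLp_two (f := fun y => f y / 2 * f y) ?_
      (memLp_conjKernel_sub hε x)).congr (Eventually.of_forall fun y => by simp only; ring)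
    refine hf2.of_le_mul (c := M / 2) ((hf.continuous.div_const 2).mul
      hf.continuous).aestronglyMeasurable (Eventually.of_forall fun y => ?_)
    rw [norm_mul, norm_div, Real.norm_two, Real.norm_eq_abs]
    gcongr
    exact hf.abs_le y
  have h0 := integral_eq_zero_of_hasDerivAt_of_integrable hd (i1.sub i2) i3
  rw [integral_sub i1 i2] at h0
  linarith

theorem sq_sub_le (hf : HolderC1 δ M f) (x y : ℝ) : (f x - f y) ^ 2 ≤ M ^ 2 * (x - y) ^ 2 := by
  have := pow_le_pow_left₀ (abs_nonneg _) (hf.abs_sub_le x y) 2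
  rwa [mul_pow, sq_abs, sq_abs] at this

theorem integrable_conjKernelDeriv_mul_sq_sub (hf : HolderC1 δ M f) {ε : ℝ} (hε : 0 < ε) (x : ℝ) :
    Integrable fun y => (f x - f y) ^ 2 * conjKernelDeriv ε (x - y) := by
  refine ((integrable_conjKernelDeriv hε).comp_sub_left x).bdd_mul (c := (M + M) ^ 2)
    ((continuous_const.sub hf.continuous).pow 2).aestronglyMeasurable
    (Eventually.of_forall fun y => ?_)
  rw [norm_pow]
  gcongr
  exact (abs_sub _ _).trans (add_le_add (hf.abs_le x) (hf.abs_le y))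

/-- The term with Hf gives minus the Poisson integral. The transport terms are f(x) ∫ f K' - ½ ∫ f²
K', where K' is `conjKernelDeriv`; since ∫ K' = 0, adding ½ f(x)² ∫ K' at no cost completes the
square. As ε → 0, -K' tends to 1 / z² off zero, whence the positive sign. -/
theorem integral_kernelRate (hδ0 : 0 < δ) (hδ1 : δ < 1) (hf : HolderC1 δ M f)
    (hf2 : MemLp f 2 volume) {ε : ℝ} (hε : 0 < ε) (x : ℝ) :
    (1 / Real.pi) * ∫ y, kernelRate ε f x y = -poissonInt ε f x -
      1 / (2 * Real.pi) * ∫ y, (f x - f y) ^ 2 * conjKernelDeriv ε (x - y) := by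
  have hK := hf.mono (le_max_left M (eLpNorm f 2 volume).toReal)
  have hK2 := (l2Le_self hf2).mono (le_max_right M (eLpNorm f 2 volume).toReal)
  have hk := (integrable_conjKernelDeriv hε).comp_sub_left x
  have i1 : Integrable fun y => hilbertTransform f y * conjKernel ε (x - y) :=
    integrable_mul_of_memLp_two (l2Le_hilbertTransform hK hK2 hK.nonneg).1
      (memLp_conjKernel_sub hε x)
  have i2 : Integrable fun y => f y * deriv f y * conjKernel ε (x - y) :=
    integrable_mul_of_memLp_two (memLp_mul_deriv hδ0 hK2 hK).1 (memLp_conjKernel_sub hε x)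
  have i3 : Integrable fun y => f y * (conjKernelDeriv ε (x - y) * f x) :=
    (hk.mul_const (f x)).bdd_mul (c := M)
      hf.continuous.aestronglyMeasurable (Eventually.of_forall hf.abs_le)
  have i4 : Integrable fun y => f y ^ 2 / 2 * conjKernelDeriv ε (x - y) := by
    refine hk.bdd_mul (c := M ^ 2 / 2)
      ((hf.continuous.pow 2).div_const 2).aestronglyMeasurable (Eventually.of_forall fun y => ?_)
    rw [Real.norm_of_nonneg (by positivity)]
    have := pow_le_pow_left₀ (abs_nonneg _) (hf.abs_le y) 2
    rw [sq_abs] at this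
    linarith
  have i5 := integrable_conjKernelDeriv_mul_sq_sub hf hε x
  have h0 : ∫ y, conjKernelDeriv ε (x - y) = 0 := by
    rw [integral_sub_left_eq_self (conjKernelDeriv ε) volume x, integral_conjKernelDeriv hε]
  have hH := conjPoisson_hilbertTransform hf hf2 hδ0 hδ1 hε x
  rw [conjPoisson_eq] at hH
  have e1 : ∫ y, kernelRate ε f x y = (∫ y, hilbertTransform f y * conjKernel ε (x - y)) -
      (∫ y, f y * deriv f y * conjKernel ε (x - y)) +
      ∫ y, f y * (conjKernelDeriv ε (x - y) * f x) := by
    have i12 : Integrable fun y => hilbertTransform f y * conjKernel ε (x - y) -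
        f y * deriv f y * conjKernel ε (x - y) := i1.sub i2
    rw [← integral_sub i1 i2, ← integral_add i12 i3]
    congr 1; ext y
    simp only [kernelRate, burgersRHS]; ring
  have e2 : ∫ y, (f x - f y) ^ 2 * conjKernelDeriv ε (x - y) =
      f x ^ 2 * (∫ y, conjKernelDeriv ε (x - y)) -
      2 * (∫ y, f y * (conjKernelDeriv ε (x - y) * f x)) +
      2 * ∫ y, f y ^ 2 / 2 * conjKernelDeriv ε (x - y) := by
    have i34 : Integrable fun y => f x ^ 2 * conjKernelDeriv ε (x - y) -
        2 * (f y * (conjKernelDeriv ε (x - y) * f x)) := (hk.const_mul _).sub (i3.const_mul _)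
    rw [← integral_const_mul, ← integral_const_mul, ← integral_const_mul,
      ← integral_sub (hk.const_mul _) (i3.const_mul _), ← integral_add i34 (i4.const_mul _)]
    congr 1; ext y; ring
  rw [e1, e2, h0, ← hH, integral_mul_deriv_conjKernel hδ0 hf hf2 hε x]
  have := Real.pi_pos
  generalize ∫ y, f y * (conjKernelDeriv ε (x - y) * f x) = a
  generalize ∫ y, f y ^ 2 / 2 * conjKernelDeriv ε (x - y) = b
  field_simp
  ring

/-- Pointwise (a - b)² ≥ a²/2 - b². The kernel has mass π / r for the first term and is at most 1 /
r² for the second. -/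
theorem integral_sq_sub_div_ge (hf : HolderC1 δ M f) (hf2 : MemLp f 2 volume) (x : ℝ)
    {r : ℝ} (hr : 0 < r) :
    f x ^ 2 * Real.pi / (2 * r) - (∫ y, f y ^ 2) / r ^ 2 ≤
      ∫ y, (f x - f y) ^ 2 * ((x - y) ^ 2 + r ^ 2)⁻¹ := by
  have hk := (integrable_inv_sq hr).comp_sub_left x
  have hk' : ∫ y, ((x - y) ^ 2 + r ^ 2)⁻¹ = Real.pi / r := by
    rw [integral_sub_left_eq_self (fun z => (z ^ 2 + r ^ 2)⁻¹) volume x, integral_inv_sq hr]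
  have hE := hf2.integrable_sq
  have i1 : Integrable fun y => (f x - f y) ^ 2 * ((x - y) ^ 2 + r ^ 2)⁻¹ := by
    refine hk.bdd_mul (c := (M + M) ^ 2) ((continuous_const.sub hf.continuous).pow
      2).aestronglyMeasurable (Eventually.of_forall fun y => ?_)
    rw [norm_pow]
    gcongr
    exact (abs_sub _ _).trans (add_le_add (hf.abs_le x) (hf.abs_le y))
  have e : f x ^ 2 * Real.pi / (2 * r) - (∫ y, f y ^ 2) / r ^ 2 =
      ∫ y, (f x ^ 2 / 2 * ((x - y) ^ 2 + r ^ 2)⁻¹ - (r ^ 2)⁻¹ * f y ^ 2) := by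
    rw [integral_sub (hk.const_mul _) (hE.const_mul _), integral_const_mul, integral_const_mul, hk']
    field_simp
  rw [e]
  refine integral_mono ((hk.const_mul _).sub (hE.const_mul _)) i1 fun y => ?_
  have h1 : ((x - y) ^ 2 + r ^ 2)⁻¹ ≤ (r ^ 2)⁻¹ :=
    inv_anti₀ (by positivity) (by nlinarith [sq_nonneg (x - y)])
  have h2 : 0 ≤ ((x - y) ^ 2 + r ^ 2)⁻¹ := by positivity
  have h3 := mul_le_mul_of_nonneg_right h1 (sq_nonneg (f y))
  have h4 : (f x ^ 2 / 2 - f y ^ 2) * ((x - y) ^ 2 + r ^ 2)⁻¹ ≤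
      (f x - f y) ^ 2 * ((x - y) ^ 2 + r ^ 2)⁻¹ :=
    mul_le_mul_of_nonneg_right (by nlinarith [sq_nonneg (f x - 2 * f y)]) h2
  simp only
  linarith

/-- Write -K' = 1 / (z² + ε²) - 2ε² / (z² + ε²)². The first part dominates 1 / (z² + r²) because ε ≤
r; the second is absorbed by the Lipschitz bound (f x - f y)² ≤ M² z², at a total cost 2πM²ε that
vanishes with ε. -/
theorem neg_integral_conjKernelDeriv_ge (hf : HolderC1 δ M f) (hf2 : MemLp f 2 volume) (x : ℝ)
    {ε r : ℝ} (hε : 0 < ε) (hr : ε ≤ r) :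
    f x ^ 2 * Real.pi / (2 * r) - (∫ y, f y ^ 2) / r ^ 2 - 2 * Real.pi * M ^ 2 * ε ≤
      -∫ y, (f x - f y) ^ 2 * conjKernelDeriv ε (x - y) := by
  have hr0 := hε.trans_le hr
  have hk : ∀ {s : ℝ}, 0 < s → Integrable fun y => ((x - y) ^ 2 + s ^ 2)⁻¹ := fun hs =>
    (integrable_inv_sq hs).comp_sub_left x
  have hk' : ∫ y, ((x - y) ^ 2 + ε ^ 2)⁻¹ = Real.pi / ε := by
    rw [integral_sub_left_eq_self (fun z => (z ^ 2 + ε ^ 2)⁻¹) volume x, integral_inv_sq hε]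
  have i1 : Integrable fun y => (f x - f y) ^ 2 * ((x - y) ^ 2 + r ^ 2)⁻¹ := by
    refine (hk hr0).bdd_mul (c := (M + M) ^ 2) ((continuous_const.sub hf.continuous).pow
      2).aestronglyMeasurable (Eventually.of_forall fun y => ?_)
    rw [norm_pow]
    gcongr
    exact (abs_sub _ _).trans (add_le_add (hf.abs_le x) (hf.abs_le y))
  have i2 := integrable_conjKernelDeriv_mul_sq_sub hf hε x
  have hm : ∫ y, ((f x - f y) ^ 2 * ((x - y) ^ 2 + r ^ 2)⁻¹ -
      2 * M ^ 2 * ε ^ 2 * ((x - y) ^ 2 + ε ^ 2)⁻¹) ≤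
      ∫ y, -((f x - f y) ^ 2 * conjKernelDeriv ε (x - y)) := by
    refine integral_mono (i1.sub ((hk hε).const_mul _)) i2.neg fun y => ?_
    have hp : 0 < (x - y) ^ 2 + ε ^ 2 := by positivity
    have h1 : ((x - y) ^ 2 + r ^ 2)⁻¹ ≤ ((x - y) ^ 2 + ε ^ 2)⁻¹ :=
      inv_anti₀ hp (by gcongr)
    have h2 : conjKernelDeriv ε (x - y) = 2 * ε ^ 2 * (((x - y) ^ 2 + ε ^ 2)⁻¹ ^ 2) -
        ((x - y) ^ 2 + ε ^ 2)⁻¹ := by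
      rw [conjKernelDeriv]; field_simp; ring
    have h3 : (f x - f y) ^ 2 * ((x - y) ^ 2 + ε ^ 2)⁻¹ ≤ M ^ 2 := by
      rw [← div_eq_mul_inv, div_le_iff₀ hp]
      nlinarith [sq_sub_le hf x y, sq_nonneg (M * ε)]
    have h4 := mul_le_mul_of_nonneg_left h3
      (show 0 ≤ 2 * ε ^ 2 * ((x - y) ^ 2 + ε ^ 2)⁻¹ by positivity)
    have h5 := mul_le_mul_of_nonneg_left h1 (sq_nonneg (f x - f y))
    simp only [h2]
    linarith
  rw [integral_neg, integral_sub i1 ((hk hε).const_mul _), integral_const_mul, hk'] at hm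
  have h6 := integral_sq_sub_div_ge hf hf2 x hr0
  have h7 : 2 * M ^ 2 * ε ^ 2 * (Real.pi / ε) = 2 * Real.pi * M ^ 2 * ε := by field_simp
  linarith

/-- The radius r = 4E / (π f(x)²) maximizes f(x)² π / (2r) - E / r², with value π² f(x)⁴ / (16E).
The upper bound on ε ensures ε ≤ r at every x simultaneously. -/
theorem integral_kernelRate_ge (hδ0 : 0 < δ) (hδ1 : δ < 1) (hf : HolderC1 δ M f)
    (hf2 : MemLp f 2 volume) {E ε : ℝ} (hE : ∫ y, f y ^ 2 = E) (hE0 : 0 < E)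
    (hε : 0 < ε) (hεM : ε ≤ 4 * E / (Real.pi * M ^ 2)) (x : ℝ) :
    -poissonInt ε f x + Real.pi / (32 * E) * f x ^ 4 - M ^ 2 * ε ≤
      (1 / Real.pi) * ∫ y, kernelRate ε f x y := by
  have hpi := Real.pi_pos
  rw [integral_kernelRate hδ0 hδ1 hf hf2 hε]
  have key : Real.pi ^ 2 / (16 * E) * f x ^ 4 - 2 * Real.pi * M ^ 2 * ε ≤
      -∫ y, (f x - f y) ^ 2 * conjKernelDeriv ε (x - y) := by
    rcases eq_or_ne (f x) 0 with h0 | h0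
    -- When f x = 0 the optimal radius is infinite, so let r → ∞.
    · have h1 : Tendsto (fun r : ℝ => f x ^ 2 * Real.pi / (2 * r) - (∫ y, f y ^ 2) / r ^ 2 -
          2 * Real.pi * M ^ 2 * ε) atTop (𝓝 (0 - 0 - 2 * Real.pi * M ^ 2 * ε)) := by
        refine (Tendsto.sub ?_ ?_).sub tendsto_const_nhds
        · exact tendsto_const_nhds.div_atTop (tendsto_id.const_mul_atTop two_pos)
        · exact tendsto_const_nhds.div_atTop (tendsto_pow_atTop two_ne_zero)
      have h2 := le_of_tendsto h1 ((eventually_ge_atTop ε).mono fun r hr =>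
        neg_integral_conjKernelDeriv_ge hf hf2 x hε hr)
      rw [h0] at h2 ⊢
      linarith
    · have hfx : 0 < f x ^ 2 := by positivity
      have hle : f x ^ 2 ≤ M ^ 2 := by
        have := pow_le_pow_left₀ (abs_nonneg _) (hf.abs_le x) 2
        rwa [sq_abs] at this
      have hr : ε ≤ 4 * E / (Real.pi * f x ^ 2) := hεM.trans (by gcongr)
      have h1 := neg_integral_conjKernelDeriv_ge hf hf2 x hε hr
      rw [hE] at h1
      refine le_trans (le_of_eq ?_) h1
      field_simp
      ring
  have h2 := mul_le_mul_of_nonneg_left key (show 0 ≤ 1 / (2 * Real.pi) by positivity)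
  have h3 : 1 / (2 * Real.pi) * (Real.pi ^ 2 / (16 * E) * f x ^ 4 - 2 * Real.pi * M ^ 2 * ε) =
      Real.pi / (32 * E) * f x ^ 4 - M ^ 2 * ε := by
    field_simp; ring
  linarith

end

end

/-! ### The differential inequality along a characteristic and the bound on the lifespan. -/

section

/-- The bound for the existence time in `le_timeBound`. -/
def timeBound (c U₀ V₀ : ℝ) : ℝ := 1 / U₀ / min (√(c * U₀) / 2) (V₀ / U₀ ^ 2)

/-- A function that satisfies `U'' ≥ c U⁴ - U` in integrated form, and starts with a large value
and a positive slope, has a bounded time of existence. -/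
theorem le_timeBound {U V : ℝ → ℝ} {S U₀ V₀ c : ℝ} (hU₀ : 0 < U₀) (hV₀ : 0 < V₀)
    (hc : 2 ≤ c * U₀ ^ 3) (hS : 0 ≤ S) (hUc : Continuous U) (hVc : Continuous V)
    (hUd : ∀ t ∈ Ioo 0 S, HasDerivAt U (V t) t) (hU : U 0 = U₀)
    (hV : ∀ t ∈ Icc 0 S, V₀ + ∫ r in (0 : ℝ)..t, (c * U r ^ 4 - U r) ≤ V t) :
    S ≤ timeBound c U₀ V₀ := by
  have hc0 : 0 < c := by
    by_contra! h
    nlinarith [pow_pos hU₀ 3]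
  have hUV : ∀ t ∈ Icc 0 S, ∫ r in (0 : ℝ)..t, V r = U t - U₀ := by
    intro t ht
    rw [← hU]
    exact intervalIntegral.integral_eq_sub_of_hasDerivAt_of_le ht.1 hUc.continuousOn
      (fun r hr => hUd r ⟨hr.1, hr.2.trans_le ht.2⟩) (hVc.intervalIntegrable _ _)
  have hUge : ∀ t ∈ Icc 0 S, (∀ r ∈ Icc 0 t, r < t → 0 ≤ V r) → U₀ ≤ U t := by
    intro t ht h
    have h1 : 0 ≤ ∫ r in (0 : ℝ)..t, V r :=
      intervalIntegral.integral_nonneg_of_ae_restrict ht.1 <| by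
        rw [← restrict_Ico_eq_restrict_Icc]
        filter_upwards [ae_restrict_mem measurableSet_Ico] with r hr using h r ⟨hr.1, hr.2.le⟩ hr.2
    rw [hUV t ht] at h1
    linarith
  -- While U ≥ U₀, the assumption c U₀³ ≥ 2 lets half of the quartic term absorb the linear one.
  have hG : ∀ r, U₀ ≤ U r → c / 2 * U r ^ 4 ≤ c * U r ^ 4 - U r := by
    intro r hr
    have h1 : 2 ≤ c * U r ^ 3 := hc.trans (by gcongr)
    have h2 := mul_le_mul_of_nonneg_right h1 (hU₀.le.trans hr)
    linarith
  have hVge : ∀ t ∈ Icc 0 S, (∀ r ∈ Icc 0 t, r < t → 0 ≤ V r) →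
      V₀ + ∫ r in (0 : ℝ)..t, c / 2 * U r ^ 4 ≤ V t := by
    intro t ht h
    refine le_trans ?_ (hV t ht)
    gcongr
    refine intervalIntegral.integral_mono_on ht.1
      ((continuous_const.mul (hUc.pow 4)).intervalIntegrable _ _)
      (((continuous_const.mul (hUc.pow 4)).sub hUc).intervalIntegrable _ _) fun r hr => hG r ?_
    exact hUge r ⟨hr.1, hr.2.trans ht.2⟩ fun s hs hsr =>
      h s ⟨hs.1, hs.2.trans hr.2⟩ (hsr.trans_le hr.2)
  have hint0 : ∀ t ∈ Icc 0 S, 0 ≤ ∫ r in (0 : ℝ)..t, c / 2 * U r ^ 4 := fun t ht =>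
    intervalIntegral.integral_nonneg ht.1 fun r _ => by positivity
  -- Bootstrap: up to the first time at which V ≤ 0, U is at least U₀, and then the integral
  -- inequality keeps V ≥ V₀ > 0 at that time, a contradiction.
  have hVpos : ∀ t ∈ Icc 0 S, 0 ≤ V t := by
    by_contra! h
    obtain ⟨t₁, ht₁, hVt₁⟩ := h
    have hcomp : IsCompact (Icc 0 S ∩ V ⁻¹' Iic 0) :=
      isCompact_Icc.inter_right (isClosed_Iic.preimage hVc)
    obtain ⟨t, ⟨ht, hVt⟩, hmin⟩ := hcomp.exists_isLeast ⟨t₁, ht₁, hVt₁.le⟩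
    have h1 : ∀ r ∈ Icc 0 t, r < t → 0 ≤ V r := by
      intro r hr hrt
      by_contra! hneg
      exact absurd (hmin ⟨⟨hr.1, hr.2.trans ht.2⟩, hneg.le⟩) (not_le.2 hrt)
    have h2 := hVge t ht h1
    have h3 : V t ≤ 0 := hVt
    linarith [hint0 t ht]
  have hVW : ∀ t ∈ Icc 0 S, V₀ + ∫ r in (0 : ℝ)..t, c / 2 * U r ^ 4 ≤ V t := fun t ht =>
    hVge t ht fun r hr _ => hVpos r ⟨hr.1, hr.2.trans ht.2⟩
  -- V is not assumed differentiable, so the argument is run on minorants: W ≤ V has derivative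
  -- (c/2) U⁴, and Y ≤ U has derivative W.
  set W : ℝ → ℝ := fun t => V₀ + ∫ r in (0 : ℝ)..t, c / 2 * U r ^ 4 with hW
  have hWd : ∀ t, HasDerivAt W (c / 2 * U t ^ 4) t := fun t =>
    (Continuous.integral_hasStrictDerivAt (by fun_prop) 0 t).hasDerivAt.const_add V₀
  have hWc : Continuous W := continuous_iff_continuousAt.2 fun t => (hWd t).continuousAt
  set Y : ℝ → ℝ := fun t => U₀ + ∫ r in (0 : ℝ)..t, W r with hY
  have hYd : ∀ t, HasDerivAt Y (W t) t := fun t =>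
    (hWc.integral_hasStrictDerivAt 0 t).hasDerivAt.const_add U₀
  have hYc : Continuous Y := continuous_iff_continuousAt.2 fun t => (hYd t).continuousAt
  have hW0 : ∀ t ∈ Icc 0 S, 0 < W t := fun t ht => add_pos_of_pos_of_nonneg hV₀ (hint0 t ht)
  have hY0 : ∀ t ∈ Icc 0 S, U₀ ≤ Y t := fun t ht =>
    le_add_of_nonneg_right (intervalIntegral.integral_nonneg ht.1 fun r hr =>
      (hW0 r ⟨hr.1, hr.2.trans ht.2⟩).le)
  have hYU : ∀ t ∈ Icc 0 S, Y t ≤ U t := by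
    intro t ht
    have h1 := intervalIntegral.integral_mono_on (μ := volume) ht.1 (hWc.intervalIntegrable _ _)
      (hVc.intervalIntegrable _ _) fun r hr => hVW r ⟨hr.1, hr.2.trans ht.2⟩
    rw [hUV t ht] at h1
    linarith
  -- The aim is Y' = W ≥ κ Y². The second entry makes it true at time 0. The first gives κ² ≤ c U₀ /
  -- 4, which with U₀ ≤ Y ≤ U makes W² - κ² Y⁴ nondecreasing.
  set κ := min (√(c * U₀) / 2) (V₀ / U₀ ^ 2) with hκ
  have hκ0 : 0 < κ := lt_min (by positivity) (by positivity)
  have hκ1 : κ ^ 2 ≤ c * U₀ / 4 := by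
    have := pow_le_pow_left₀ hκ0.le (min_le_left (√(c * U₀) / 2) (V₀ / U₀ ^ 2)) 2
    rw [div_pow, Real.sq_sqrt (by positivity)] at this
    linarith
  have hκ2 : κ * U₀ ^ 2 ≤ V₀ := by
    rw [← le_div_iff₀ (by positivity)]; exact min_le_right _ _
  have hsub : interior (Icc 0 S) ⊆ Icc 0 S := interior_subset
  have hZd : ∀ t, HasDerivAt (fun t => W t ^ 2 - κ ^ 2 * Y t ^ 4)
      (2 * W t * (c / 2 * U t ^ 4 - 2 * κ ^ 2 * Y t ^ 3)) t := by
    intro t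
    refine (((hWd t).pow 2).sub (((hYd t).pow 4).const_mul (κ ^ 2))).congr_deriv ?_
    push_cast
    ring
  have hZ : MonotoneOn (fun t => W t ^ 2 - κ ^ 2 * Y t ^ 4) (Icc 0 S) := by
    refine monotoneOn_of_deriv_nonneg (convex_Icc 0 S) (by fun_prop)
      (fun t _ => (hZd t).differentiableAt.differentiableWithinAt) fun t ht => ?_
    rw [(hZd t).deriv]
    replace ht := hsub ht
    have h1 := hY0 t ht
    have h2 := hYU t ht
    have hYt : 0 < Y t := hU₀.trans_le h1
    have h3 : 2 * κ ^ 2 * Y t ^ 3 ≤ c / 2 * U t ^ 4 :=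
      calc 2 * κ ^ 2 * Y t ^ 3 ≤ 2 * (c * U₀ / 4) * Y t ^ 3 := by gcongr
        _ = c / 2 * (U₀ * Y t ^ 3) := by ring
        _ ≤ c / 2 * (U t * U t ^ 3) := by
          have := h1.trans h2
          have := hU₀.le.trans this
          gcongr
        _ = c / 2 * U t ^ 4 := by ring
    exact mul_nonneg (mul_nonneg two_pos.le (hW0 t ht).le) (by linarith)
  have hWY : ∀ t ∈ Icc 0 S, κ * Y t ^ 2 ≤ W t := by
    intro t ht
    have h1 := hZ ⟨le_rfl, hS⟩ ht ht.1
    have hW00 : W 0 = V₀ := by simp [hW]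
    have hY00 : Y 0 = U₀ := by simp [hY]
    simp only [hW00, hY00] at h1
    have h2 := pow_le_pow_left₀ (by positivity) hκ2 2
    refine le_of_sq_le_sq ?_ (hW0 t ht).le
    nlinarith
  have hRd : ∀ t ∈ Icc 0 S, HasDerivAt (fun t => (Y t)⁻¹ + κ * t) (-W t / Y t ^ 2 + κ) t := by
    intro t ht
    refine ((hYd t).inv (hU₀.trans_le (hY0 t ht)).ne').add ?_
    simpa using (hasDerivAt_id t).const_mul κ
  -- From Y' ≥ κ Y², 1/Y decreases at rate at least κ; since it starts at 1/U₀ and stays positive, κ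
  -- S ≤ 1/U₀.
  have hR : AntitoneOn (fun t => (Y t)⁻¹ + κ * t) (Icc 0 S) := by
    refine antitoneOn_of_deriv_nonpos (convex_Icc 0 S)
      (fun t ht => (hRd t ht).continuousAt.continuousWithinAt)
      (fun t ht => (hRd t (hsub ht)).differentiableAt.differentiableWithinAt) fun t ht => ?_
    replace ht := hsub ht
    have hYt : 0 < Y t := hU₀.trans_le (hY0 t ht)
    rw [(hRd t ht).deriv]
    have : κ ≤ W t / Y t ^ 2 := by rw [le_div_iff₀ (by positivity)]; exact hWY t ht
    rw [neg_div]
    linarith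
  have h1 := hR ⟨le_rfl, hS⟩ ⟨hS, le_rfl⟩ hS
  have hY00 : Y 0 = U₀ := by simp [hY]
  have hYS : 0 < Y S := hU₀.trans_le (hY0 S ⟨hS, le_rfl⟩)
  have h2 : 0 < (Y S)⁻¹ := by positivity
  simp only [hY00, mul_zero, add_zero] at h1
  rw [timeBound, ← hκ, le_div_iff₀ hκ0, one_div]
  linarith

namespace ContPath

variable {δ M : ℝ} {g : ℝ → ℝ → ℝ}

/-- The velocity is bounded by M, so the characteristic cannot leave the ball of radius M S before
time S and Picard–Lindelöf applies on the whole interval. Clamping time extends it continuously to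
the line. -/
theorem exists_characteristic (hg : ContPath δ M g) {S : ℝ} (hS : 0 ≤ S) (x₀ : ℝ) :
    ∃ X : ℝ → ℝ, Continuous X ∧ X 0 = x₀ ∧ ∀ t ∈ Ioo 0 S, HasDerivAt X (g t (X t)) t := by
  have hM := hg.nonneg
  have hpl : IsPicardLindelof g (tmin := 0) (tmax := S) ⟨0, le_rfl, hS⟩ x₀ (⟨M, hM⟩ * ⟨S, hS⟩) 0
      ⟨M, hM⟩ ⟨M, hM⟩ := by
    refine ⟨fun t _ => ?_, fun x _ => (hg.continuous_time x).continuousOn, fun t _ x _ => ?_, ?_⟩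
    · exact (LipschitzWith.of_dist_le_mul fun x y => (hg.holder t).abs_sub_le x y).lipschitzOnWith
    · exact (hg.holder t).abs_le x
    · simp only [sub_zero, sub_self, max_eq_left hS, NNReal.coe_zero]
      exact le_of_eq rfl
  obtain ⟨X, hX0, hX⟩ := hpl.exists_eq_forall_mem_Icc_hasDerivWithinAt₀
  have hXc : ContinuousOn X (Icc 0 S) := fun t ht => (hX t ht).continuousWithinAt
  refine ⟨fun t => X (clampTime S t), ?_, ?_, fun t ht => ?_⟩
  · exact hXc.comp_continuous (by unfold clampTime; fun_prop)
      fun t => ⟨clampTime_nonneg S t, clampTime_le hS t⟩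
  · simp only [clampTime_of_mem le_rfl hS]; exact hX0
  · simp only [clampTime_of_mem ht.1.le ht.2.le]
    refine ((hX t ⟨ht.1.le, ht.2.le⟩).hasDerivAt (Icc_mem_nhds ht.1 ht.2)).congr_of_eventuallyEq ?_
    filter_upwards [Icc_mem_nhds ht.1 ht.2] with s hs
    rw [clampTime_of_mem hs.1 hs.2]

variable {X : ℝ → ℝ} {S : ℝ}

/-- The solution along a characteristic. -/
theorem hasDerivAt_characteristic (hδ0 : 0 < δ) (hg : ContPath δ M g)
    (hder : ∀ t ∈ Ioo 0 S, ∀ x, HasDerivAt (fun s => g s x) (burgersRHS (g t) x) t)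
    (hX : ∀ t ∈ Ioo 0 S, HasDerivAt X (g t (X t)) t) {t : ℝ} (ht : t ∈ Ioo 0 S) :
    HasDerivAt (fun s => g s (X s)) (hilbertTransform (g t) (X t)) t := by
  have h1 := hasDerivWithinAt_transport hδ0 (mem_univ t) (fun s _ => hg.holder s)
    (fun x => ((hg.continuous_time x).tendsto t).mono_left nhdsWithin_le_nhds)
    (hX t ht).hasDerivWithinAt
  have h2 := (hasDerivWithinAt_univ.1 h1).add (hder t ht (X t))
  refine (h2.congr_deriv ?_).congr_of_eventuallyEq (Eventually.of_forall fun s => ?_)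
  · rw [burgersRHS]; ring
  · simp

theorem continuous_comp (hg : ContPath δ M g) (hX : Continuous X) :
    Continuous fun t => g t (X t) :=
  hg.continuous_uncurry.comp (continuous_id.prodMk hX)

/-- The evolution of the regularized Hilbert transform along a characteristic. -/
theorem conjPoisson_sub_eq (hδ0 : 0 < δ) (hδ1 : δ < 1) (hg : ContPath δ M g)
    (hder : ∀ t ∈ Ioo 0 S, ∀ x, HasDerivAt (fun s => g s x) (burgersRHS (g t) x) t)
    (hXc : Continuous X) (hX : ∀ t ∈ Ioo 0 S, HasDerivAt X (g t (X t)) t) {ε : ℝ} (hε : 0 < ε)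
    {t : ℝ} (ht : t ∈ Icc 0 S) :
    IntervalIntegrable (fun r => (1 / Real.pi) * ∫ y, kernelRate ε (g r) (X r) y) volume 0 t ∧
    conjPoisson ε (g t) (X t) - conjPoisson ε (g 0) (X 0) =
      ∫ r in (0 : ℝ)..t, (1 / Real.pi) * ∫ y, kernelRate ε (g r) (X r) y := by
  have hM := hg.nonneg
  have c1 := hg.continuous_uncurry
  have c2 := hg.continuous_uncurry_deriv hδ0
  have c3 := (hg.hilbert hδ0 hδ1).continuous_uncurry
  have c4 := hg.continuous_comp hXc
  have hb : ∀ r, MemLp (burgersRHS (g r)) 2 volume := fun r =>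
    (l2Le_burgersRHS hδ0 (hg.holder r) (hg.l2 r)).1
  have hi : ∀ r, Integrable (fun y => g r y * conjKernel ε (X r - y)) := fun r =>
    integrable_mul_of_memLp_two (hg.l2 r).1 (memLp_conjKernel_sub hε _)
  have hk : ∀ r, Integrable (kernelRate ε (g r) (X r)) := fun r =>
    integrable_kernelRate hδ0 (hg.holder r) (hg.l2 r).1 hε _
  have h := integral_sub_eq_intervalIntegral (a := 0) (b := t)
    (φ := fun s y => g s y * conjKernel ε (X s - y)) (φ' := fun r => kernelRate ε (g r) (X r))
    (C := (M + M * M) ^ 2 + (1 + M * M) * (Real.pi / ε)) ht.1 ?_ ?_ ?_ hk ?_ (hi 0) (hi t)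
  · refine ⟨h.1.const_mul _, ?_⟩
    rw [intervalIntegral.integral_const_mul, ← h.2, mul_sub, conjPoisson_eq, conjPoisson_eq]
  · intro y
    exact ((hg.continuous_time y).mul ((continuous_conjKernel hε).comp
      (hXc.sub continuous_const))).continuousOn
  · intro y r hr
    have hr' : r ∈ Ioo 0 S := ⟨hr.1, hr.2.trans_le ht.2⟩
    refine ((hder r hr' y).mul ((hasDerivAt_conjKernel hε (X r - y)).comp r
      ((hX r hr').sub_const y))).congr_deriv rfl
  · have d1 : Continuous fun p : ℝ × ℝ => X p.1 - p.2 := by fun_prop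
    exact ((c3.sub (c1.mul c2)).mul ((continuous_conjKernel hε).comp d1)).add
      (c1.mul (((continuous_conjKernelDeriv hε).comp d1).mul (c4.comp continuous_fst)))
  · intro r
    have j := ((integrable_inv_sq hε).comp_sub_left (X r)).const_mul (1 + M * M)
    refine (integral_mono (hk r).norm ((hb r).integrable_sq.add j) fun y =>
      abs_kernelRate_le (hg.holder r) hε (X r) y).trans ?_
    simp only [Pi.add_apply]
    rw [integral_add (hb r).integrable_sq j, integral_const_mul,
      integral_sub_left_eq_self (fun z => (z ^ 2 + ε ^ 2)⁻¹) volume (X r), integral_inv_sq hε]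
    gcongr
    exact (l2Le_burgersRHS hδ0 (hg.holder r) (hg.l2 r)).integral_sq_le (by positivity)

theorem continuous_poissonKernel {s : ℝ} (hs : 0 < s) :
    Continuous fun z : ℝ => s / (z ^ 2 + s ^ 2) :=
  continuous_const.div (by fun_prop) fun z => by positivity

theorem aestronglyMeasurable_poissonInt (hg : ContPath δ M g) (hXc : Continuous X) {ε : ℝ}
    (hε : 0 < ε) (μ : Measure ℝ) [SFinite μ] :
    AEStronglyMeasurable (fun r => poissonInt ε (g r) (X r)) μ := by
  have h : Continuous fun p : ℝ × ℝ => g p.1 p.2 * (ε / ((X p.1 - p.2) ^ 2 + ε ^ 2)) :=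
    hg.continuous_uncurry.mul ((continuous_poissonKernel hε).comp (by fun_prop))
  have h1 : AEStronglyMeasurable
      (fun p : ℝ × ℝ => g p.1 p.2 * (ε / ((X p.1 - p.2) ^ 2 + ε ^ 2))) (μ.prod volume) :=
    h.aestronglyMeasurable
  exact h1.integral_prod_right'.const_mul _

end ContPath

theorem abs_poissonInt_le {δ M : ℝ} {f : ℝ → ℝ} (hf : HolderC1 δ M f) {ε : ℝ} (hε : 0 < ε) (x : ℝ) :
    |poissonInt ε f x| ≤ M := by
  have hpi := Real.pi_pos
  have hk := (integrable_poissonKernel hε).comp_sub_left x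
  have h1 : ‖∫ y, f y * (ε / ((x - y) ^ 2 + ε ^ 2))‖ ≤ ∫ y, M * (ε / ((x - y) ^ 2 + ε ^ 2)) := by
    refine norm_integral_le_of_norm_le (hk.const_mul M) (Eventually.of_forall fun y => ?_)
    have h0 : 0 ≤ ε / ((x - y) ^ 2 + ε ^ 2) := by positivity
    rw [norm_mul, Real.norm_of_nonneg h0]
    exact mul_le_mul_of_nonneg_right (hf.abs_le y) h0
  rw [integral_const_mul, integral_sub_left_eq_self (fun z => ε / (z ^ 2 + ε ^ 2)) volume x,
    integral_poissonKernel hε, Real.norm_eq_abs] at h1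
  rw [poissonInt, abs_mul, abs_of_pos (a := 1 / Real.pi) (by positivity)]
  have := mul_le_mul_of_nonneg_left h1 (show 0 ≤ 1 / Real.pi by positivity)
  refine this.trans (le_of_eq ?_)
  field_simp

namespace ContPath

variable {δ M : ℝ} {g : ℝ → ℝ → ℝ} {X : ℝ → ℝ} {S : ℝ}

/-- The growth of the Hilbert transform along a characteristic. -/
theorem hilbertTransform_characteristic_ge (hδ0 : 0 < δ) (hδ1 : δ < 1) (hg : ContPath δ M g)
    (hder : ∀ t ∈ Ioo 0 S, ∀ x, HasDerivAt (fun s => g s x) (burgersRHS (g t) x) t)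
    (hXc : Continuous X) (hX : ∀ t ∈ Ioo 0 S, HasDerivAt X (g t (X t)) t) {E : ℝ} (hE0 : 0 < E)
    (hE : ∀ t, ∫ y, g t y ^ 2 = E) {t : ℝ} (ht : t ∈ Icc 0 S) :
    hilbertTransform (g 0) (X 0) +
      ∫ r in (0 : ℝ)..t, (Real.pi / (32 * E) * g r (X r) ^ 4 - g r (X r)) ≤
      hilbertTransform (g t) (X t) := by
  have hpi := Real.pi_pos
  have hcU := hg.continuous_comp hXc
  have hcU4 : Continuous fun r => Real.pi / (32 * E) * g r (X r) ^ 4 :=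
    continuous_const.mul (hcU.pow 4)
  -- Enlarging M to at least 1 makes the threshold 4E / (πK²) for ε meaningful when M = 0.
  set K := max M 1
  have hgK := hg.mono (le_max_left M 1)
  have hK : 0 < K := zero_lt_one.trans_le (le_max_right _ _)
  have hlim1 : Tendsto (fun ε => conjPoisson ε (g t) (X t) - conjPoisson ε (g 0) (X 0))
      (𝓝[>] (0 : ℝ)) (𝓝 (hilbertTransform (g t) (X t) - hilbertTransform (g 0) (X 0))) :=
    (tendsto_conjPoisson (hg.holder t) (hg.l2 t).1 _).sub
      (tendsto_conjPoisson (hg.holder 0) (hg.l2 0).1 _)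
  have hpm : ∀ ε, 0 < ε → IntervalIntegrable (fun r => poissonInt ε (g r) (X r)) volume 0 t := by
    intro ε hε
    refine (intervalIntegrable_const (c := M)).mono_fun'
      (hg.aestronglyMeasurable_poissonInt hXc hε _)
      (Eventually.of_forall fun r => abs_poissonInt_le (hg.holder r) hε _)
  have hlim2 : Tendsto (fun ε => ∫ r in (0 : ℝ)..t, poissonInt ε (g r) (X r)) (𝓝[>] (0 : ℝ))
      (𝓝 (∫ r in (0 : ℝ)..t, g r (X r))) := by
    refine intervalIntegral.tendsto_integral_filter_of_dominated_convergence (fun _ => M) ?_ ?_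
      (by simp) (Eventually.of_forall fun r _ => tendsto_poissonInt (hg.holder r) (X r))
    · filter_upwards [self_mem_nhdsWithin] with ε hε using
        hg.aestronglyMeasurable_poissonInt hXc hε _
    · filter_upwards [self_mem_nhdsWithin] with ε hε
      exact Eventually.of_forall fun r _ => abs_poissonInt_le (hg.holder r) hε _
  have hlim3 : Tendsto (fun ε => -(∫ r in (0 : ℝ)..t, poissonInt ε (g r) (X r)) +
      (∫ r in (0 : ℝ)..t, Real.pi / (32 * E) * g r (X r) ^ 4) - K ^ 2 * ε * t) (𝓝[>] (0 : ℝ))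
      (𝓝 (-(∫ r in (0 : ℝ)..t, g r (X r)) +
        (∫ r in (0 : ℝ)..t, Real.pi / (32 * E) * g r (X r) ^ 4) - K ^ 2 * 0 * t)) := by
    refine (hlim2.neg.add tendsto_const_nhds).sub ?_
    exact ((tendsto_id.mono_left nhdsWithin_le_nhds).const_mul (K ^ 2)).mul_const t
  -- The inequality is integrated in time for fixed ε and only then ε → 0, so differentiability of
  -- Hu along the characteristic is never needed.
  have hfin := le_of_tendsto_of_tendsto hlim3 hlim1 ?_
  · rw [intervalIntegral.integral_sub (hcU4.intervalIntegrable _ _) (hcU.intervalIntegrable _ _)]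
    linarith
  · filter_upwards [Ioc_mem_nhdsGT (show 0 < 4 * E / (Real.pi * K ^ 2) by positivity)] with ε hε
    obtain ⟨h1, h2⟩ := hg.conjPoisson_sub_eq hδ0 hδ1 hder hXc hX hε.1 ht
    rw [h2]
    have hi := (hpm ε hε.1).neg.add (hcU4.intervalIntegrable 0 t)
    have hi2 : IntervalIntegrable (fun _ : ℝ => K ^ 2 * ε) volume 0 t := by simp
    have h3 := intervalIntegral.integral_mono_on ht.1 (hi.sub hi2) h1 fun r _ =>
      integral_kernelRate_ge hδ0 hδ1 (hgK.holder r) (hg.l2 r).1 (hE r) hE0 hε.1 hε.2 (X r)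
    refine le_trans (le_of_eq ?_) h3
    rw [intervalIntegral.integral_sub hi hi2, intervalIntegral.integral_const]
    rw [intervalIntegral.integral_add (hpm ε hε.1).neg (hcU4.intervalIntegrable 0 t)]
    simp only [Pi.neg_apply, intervalIntegral.integral_neg, smul_eq_mul, sub_zero]
    ring

end ContPath

/-- The time of existence is bounded. -/
theorem IsSolution.le_timeBound {δ : ℝ≥0} (hδ0 : 0 < δ) (hδ1 : δ < 1) {u₀ : ℝ → ℝ} {T : ℝ}
    {u : ℝ → ℝ → ℝ} (hu : IsSolution δ u₀ T u) {E β : ℝ} (hE0 : 0 < E) (hE : ∫ y, u₀ y ^ 2 = E)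
    (hU₀ : 0 < u₀ β) (hV₀ : 0 < hilbertTransform u₀ β) (hβ : 32 * Real.pi * E ≤ u₀ β ^ 3) :
    T ≤ timeBound (Real.pi / (32 * E)) (u₀ β) (hilbertTransform u₀ β) := by
  have hδ0' : (0 : ℝ) < δ := by exact_mod_cast hδ0
  have hδ1' : (δ : ℝ) < 1 := by exact_mod_cast hδ1
  -- The hypothesis on u₀ β gives at least π² here, which is more than the required 2.
  have hc : 2 ≤ Real.pi / (32 * E) * u₀ β ^ 3 := by
    have h1 : Real.pi / (32 * E) * (32 * Real.pi * E) ≤ Real.pi / (32 * E) * u₀ β ^ 3 := by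
      have := Real.pi_pos
      gcongr
    have h2 : Real.pi / (32 * E) * (32 * Real.pi * E) = Real.pi ^ 2 := by field_simp
    nlinarith [Real.pi_gt_three]
  refine le_of_forall_lt_imp_le_of_dense fun S hS => ?_
  rcases lt_or_ge S 0 with hS0 | hS0
  · refine hS0.le.trans ?_
    unfold timeBound
    positivity
  obtain ⟨M, hg⟩ := hu.exists_contPath (S := S) ⟨hS0, hS⟩
  obtain ⟨X, hXc, hX0, hX⟩ := hg.exists_characteristic hS0 β
  have hg0 : u (clampTime S 0) = u₀ := by rw [clampTime_of_mem le_rfl hS0, hu.initial]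
  have hder : ∀ t ∈ Ioo 0 S, ∀ x, HasDerivAt (fun s => u (clampTime S s) x)
      (burgersRHS (u (clampTime S t)) x) t := by
    intro t ht x
    rw [clampTime_of_mem ht.1.le ht.2.le]
    refine (hu.hasDerivAt ⟨ht.1, ht.2.trans hS⟩ x).congr_of_eventuallyEq ?_
    filter_upwards [Icc_mem_nhds ht.1 ht.2] with s hs
    rw [clampTime_of_mem hs.1 hs.2]
  have hEt : ∀ t, ∫ y, u (clampTime S t) y ^ 2 = E := fun t => by
    rw [hu.integral_sq_eq hδ0 hδ1 ⟨clampTime_nonneg S t, (clampTime_le hS0 t).trans_lt hS⟩, hE]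
  refine BurgersHilbert.le_timeBound hU₀ hV₀ hc hS0 (hg.continuous_comp hXc)
    ((hg.hilbert hδ0' hδ1').continuous_comp hXc)
    (fun t ht => hg.hasDerivAt_characteristic hδ0' hder hX ht) (by rw [hg0, hX0]) fun t ht => ?_
  have := hg.hilbertTransform_characteristic_ge hδ0' hδ1' hder hXc hX hE0 hEt ht
  rwa [hg0, hX0] at this

/-- A large value at a point where the Hilbert transform is positive bounds the time of existence of all
solutions. -/
theorem exists_time_bound {δ : ℝ≥0} (hδ0 : 0 < δ) (hδ1 : δ < 1) {u₀ : ℝ → ℝ}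
    (hL2 : MemLp u₀ 2 volume) (hC : MemC1Holder δ u₀) {β₀ : ℝ} (hH : 0 < hilbertTransform u₀ β₀)
    (hβ : (32 * Real.pi * (eLpNorm u₀ 2 volume).toReal ^ 2) ^ ((1 : ℝ) / 3) ≤ u₀ β₀) :
    ∃ Tmax, ∀ T u, IsSolution δ u₀ T u → T ≤ Tmax := by
  have hpi := Real.pi_pos
  rw [toReal_eLpNorm_two_sq hL2] at hβ
  set E := ∫ y, u₀ y ^ 2 with hE
  -- Zero energy would force u₀ = 0, hence Hu₀ = 0, contrary to Hu₀(β₀) > 0.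
  have hE0 : 0 < E := by
    refine (integral_nonneg fun y => sq_nonneg _).lt_of_ne fun h0 => ?_
    obtain ⟨M, hM⟩ : ∃ M, HolderC1 δ M u₀ :=
      ⟨(c1HolderNorm δ u₀).toNNReal, holderC1_of_norm_le hC (ENNReal.coe_toNNReal hC.2.ne).ge⟩
    have hz : u₀ = fun _ => 0 := by
      ext x
      have h1 := abs_pow_three_le (K := M + 1) (by linarith [hM.nonneg]) hL2 (fun a b =>
        (hM.abs_sub_le a b).trans (mul_le_mul_of_nonneg_right (by linarith) (abs_nonneg _))) x
      have h2 : |u₀ x| ^ 3 ≤ 0 := by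
        rwa [← h0, mul_zero] at h1
      exact abs_eq_zero.1 ((pow_eq_zero_iff three_ne_zero).1 (le_antisymm h2 (by positivity)))
    rw [hz, hilbertTransform_zero] at hH
    exact lt_irrefl _ hH
  have hp : 0 < 32 * Real.pi * E := by positivity
  have hU₀ : 0 < u₀ β₀ := (Real.rpow_pos_of_pos hp _).trans_le hβ
  have h3 : 32 * Real.pi * E ≤ u₀ β₀ ^ 3 := by
    have h := pow_le_pow_left₀ (Real.rpow_nonneg hp.le _) hβ 3
    rwa [← Real.rpow_natCast, ← Real.rpow_mul hp.le, Nat.cast_ofNat, one_div_mul_cancel three_ne_zero,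
      Real.rpow_one] at h
  exact ⟨_, fun T u hu => hu.le_timeBound hδ0 hδ1 hE0 rfl hU₀ hH h3⟩

end

end BurgersHilbert

end

theorem theorem2p1 (δ : ℝ≥0) (hδ0 : 0 < δ) (hδ1 : δ < 1)
    (u₀ : ℝ → ℝ) (hL2 : MemLp u₀ 2 volume) (hC : BurgersHilbert.MemC1Holder δ u₀)
    (β₀ : ℝ) (hH : 0 < BurgersHilbert.hilbertTransform u₀ β₀)
    (hβ : (32 * Real.pi * (eLpNorm u₀ 2 volume).toReal ^ 2) ^ ((1 : ℝ) / 3) ≤ u₀ β₀) :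
    ∃ T : ℝ, 0 < T ∧ ∃ u : ℝ → ℝ → ℝ,
      BurgersHilbert.IsSolution δ u₀ T u ∧
      (∀ (T' : ℝ) (v : ℝ → ℝ → ℝ), BurgersHilbert.IsSolution δ u₀ T' v →
        T' ≤ T ∧ ∀ t ∈ Ico 0 T', v t = u t) ∧
      Tendsto (fun t => BurgersHilbert.c1HolderNorm δ (u t)) (𝓝[<] T) (𝓝 ∞) := by
  obtain ⟨Tmax, hT⟩ := BurgersHilbert.exists_time_bound hδ0 hδ1 hL2 hC hH hβ
  exact BurgersHilbert.exists_maximal hδ0 hδ1 hL2 hC hT
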